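/- **Corollary 3.9 (Nash-type inequality).** Let $n\ge 2$, let $Q\in\mathcal D'(\mathbb R^n)$ be a complex-valued distribution, let $0<p<1$, and put $p_*=\frac n{n+2}$, $p^*=\frac{n+1}{n+2}$. For $u\in C_0^\infty(\mathbb R^n)$ (complex-valued) write $\langle Qu,u\rangle=\langle Q,|u|^2\rangle$, and consider the inequality $$|\langle Qu,u\rangle|\le C\,\|\nabla u\|_{L^2(\mathbb R^n)}^{2p}\,\|u\|_{L^1(\mathbb R^n)}^{2(1-p)}\qquad\text{for all }u\in C_0^\infty(\mathbb R^n),\tag{N}$$ with a constant $C$ independent of $u$. For vector fields $\vec\Gamma:\mathbb R^n\to\mathbb C^n$ we write: $\vec\Gamma\in\mathrm{Lip}_\alpha$ if $|\vec\Gamma(x)-\vec\Gamma(y)|\le c|x-y|^\alpha$ for all $x,y$; $\vec\Gamma\in\mathrm{BMO}$ if $\vec\Gamma\in L^1_{\rm loc}$ and its mean oscillations $\frac1{|B|}\int_B|\vec\Gamma-m_B(\vec\Gamma)|\,dx$, where $m_B(\vec\Gamma)=\frac1{|B|}\int_B\vec\Gamma\,dx$, are bounded over all balls $B$; $\vec\Gamma\in\mathcal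 L^{2,\lambda}$ if $\int_{B_\delta(x_0)}|\vec\Gamma|^2dx\le c\,\delta^\lambda$ for all $x_0\in\mathbb R^n$, $\delta>0$. Let $E$ be the fundamental solution of $\Delta$, so that $\partial_jE(x)=\frac{x_j}{n|B_1(0)|\,|x|^n}$. For a compactly supported distribution $T$, $\nabla\Delta^{-1}T=(\nabla E)\star T$. For general $Q$, $\nabla\Delta^{-1}Q$ is the limit in $\mathcal D'(\mathbb R^n)$ of $\nabla\Delta^{-1}(\eta(\cdot/R)Q)$ as $R\to\infty$, provided that the limit exists and is the same for every $\eta\in C_0^\infty(\mathbb R^n)$ with $\eta=1$ near $0$; in (c) and (d), where the spaces are considered modulo constants, the limit is taken in $\mathcal D'(\mathbb R^n)$ modulo constants (i.e. componentwise against test functions with integral $0$), and $\nabla\Delta^{-1}Q\in X$ means that some representative lies in $X$. Then: (a) If $0<p<p_*$, then (N) holds for some $C$ if and only if $Q=0$. (b) If $p=p_*$, then (N) holds for some $C$ if and only if $Q\in L^\infty(\mathbb R^n)$. In each of the remaining cases let - (c) $X=\mathrm{Lip}_{n+1-p(n+2)}(\mathbb R^n)$ if $p_*<p<p^*$; - (d)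 $X=\mathrm{BMO}(\mathbb R^n)$ if $p=p^*$; - (e) $X=\mathcal L^{2,\lambda}(\mathbb R^n)$ with $\lambda=3n+2-2p(n+2)$ if $p^*<p<1$. Then the following are equivalent: (1) (N) holds for some $C$; (2) $Q=\operatorname{div}\vec\Gamma$ in the sense of distributions for some $\vec\Gamma\in X$; (3) $\nabla\Delta^{-1}Q$ exists and lies in $X$; (4) $\nabla\Delta^{-1}Q$ exists, lies in $X$, and some representative $\vec\Gamma\in X$ of it satisfies $Q=\operatorname{div}\vec\Gamma$. -/

import Mathlib

open MeasureTheory Filter Topology TopologicalSpace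
open scoped Distributions LineDeriv NNReal ENNReal

namespace NashForm

/-- Euclidean space `ℝⁿ`. -/
abbrev Rn (n : ℕ) : Type := EuclideanSpace ℝ (Fin n)

/-- The whole space as an open set. -/
abbrev whole (n : ℕ) : Opens (Rn n) := ⊤

/-- Complex valued distributions on `ℝⁿ` (complex test functions are handled by linearity). -/
abbrev Distr (n : ℕ) : Type := 𝓓'(whole n, ℂ)

/-- Complex vector fields on `ℝⁿ`. -/
abbrev VectorField (n : ℕ) : Type := Rn n → EuclideanSpace ℂ (Fin n)

/-! ### The quadratic form and the inequality -/

/-- The real test function `|u|²`. -/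
noncomputable def absSq {n : ℕ} (u : 𝓓(whole n, ℂ)) : 𝓓(whole n, ℝ) where
  toFun x := ‖u x‖ ^ 2
  contDiff' := u.contDiff.norm_sq ℝ
  hasCompactSupport' := u.hasCompactSupport.comp_left (g := fun z : ℂ => ‖z‖ ^ 2) (by simp)
  tsupport_subset' := Set.subset_univ _

/-- The quadratic form `⟨Q u, u⟩ = ⟨Q, |u|²⟩`. -/
noncomputable def quadForm {n : ℕ} (Q : Distr n) (u : 𝓓(whole n, ℂ)) : ℂ := Q (absSq u)

/-- `‖∇u‖_{L²}`, where `|∇u|² = ∑ⱼ |∂ⱼu|²`. -/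
noncomputable def gradL2 {n : ℕ} (u : 𝓓(whole n, ℂ)) : ℝ :=
  √(∫ x, ∑ j : Fin n, ‖fderiv ℝ u x (EuclideanSpace.single j 1)‖ ^ 2)

/-- `‖u‖_{L¹}`. -/
noncomputable def normL1 {n : ℕ} (u : 𝓓(whole n, ℂ)) : ℝ := ∫ x, ‖u x‖

/-- The inequality `|⟨Q u, u⟩| ≤ C ‖∇u‖₂^{2p} ‖u‖₁^{2(1-p)}` for all `u ∈ C₀^∞(ℝⁿ)`, with a
constant `C` independent of `u`. -/
def NashInequality {n : ℕ} (Q : Distr n) (p : ℝ) : Prop :=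
  ∃ C : ℝ, ∀ u : 𝓓(whole n, ℂ),
    ‖quadForm Q u‖ ≤ C * gradL2 u ^ (2 * p) * normL1 u ^ (2 * (1 - p))

/-! ### Function spaces -/

/-- `Q ∈ L^∞(ℝⁿ)`. -/
def IsBoundedFunction {n : ℕ} (Q : Distr n) : Prop :=
  ∃ f : Rn n → ℂ, MemLp f ∞ volume ∧ ∀ φ : 𝓓(whole n, ℝ), Q φ = ∫ x, φ x • f x

/-- The homogeneous Lipschitz (Hölder) space `Lip_α`, for `0 < α < 1`:
`|Γ(x) - Γ(y)| ≤ C |x - y|^α` for all `x, y`. -/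
def MemLip {n : ℕ} (α : ℝ) (Γ : VectorField n) : Prop :=
  ∃ C : ℝ, ∀ x y, ‖Γ x - Γ y‖ ≤ C * ‖x - y‖ ^ α

/-- The space `BMO` of functions with bounded mean oscillation over all balls. -/
def MemBMO {n : ℕ} (Γ : VectorField n) : Prop :=
  LocallyIntegrable Γ ∧ ∃ C : ℝ, ∀ (x : Rn n) (δ : ℝ), 0 < δ →
    ⨍ y in Metric.ball x δ, ‖Γ y - ⨍ z in Metric.ball x δ, Γ z‖ ≤ C

/-- The Morrey space `ℒ^{2,lam}`: `∫_{B_δ(x)} |Γ|² ≤ C δ^lam` for all balls. -/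
def MemMorrey {n : ℕ} (lam : ℝ) (Γ : VectorField n) : Prop :=
  AEStronglyMeasurable Γ volume ∧ ∃ C : ℝ≥0, ∀ (x : Rn n) (δ : ℝ), 0 < δ →
    ∫⁻ y in Metric.ball x δ, ‖Γ y‖ₑ ^ 2 ≤ C * ENNReal.ofReal (δ ^ lam)

/-! ### Divergence and `∇ Δ⁻¹ Q` -/

/-- `Q = div Γ` in the sense of distributions. -/
def IsDivergence {n : ℕ} (Q : Distr n) (Γ : VectorField n) : Prop :=
  LocallyIntegrable Γ ∧ ∀ φ : 𝓓(whole n, ℝ),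
    Q φ = -∑ j : Fin n, ∫ x, (fderiv ℝ φ x (EuclideanSpace.single j 1)) • Γ x j

/-- `∂ⱼE(x) = xⱼ / (n |B₁| |x|ⁿ)`, where `E` is the fundamental solution of the Laplacian. -/
noncomputable def kernel {n : ℕ} (j : Fin n) (x : Rn n) : ℝ :=
  x j / (n * volume.real (Metric.ball (0 : Rn n) 1) * ‖x‖ ^ n)

theorem locallyIntegrable_kernel {n : ℕ} (j : Fin n) :
    LocallyIntegrable (kernel j) (volume : Measure (Rn n)) := by
  have hn : n ≠ 0 := by
    rintro rfl
    exact j.elim0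
  have : Nonempty (Fin n) := ⟨j⟩
  have : Nontrivial (Rn n) := inferInstance
  have key : ∀ r : ℝ, IntegrableOn (kernel j) (Metric.ball (0 : Rn n) r) := by
    intro r
    have h1 : IntegrableOn (fun x : Rn n => (‖x‖ ^ (n - 1))⁻¹) (Metric.ball (0 : Rn n) r) := by
      have := (integrableOn_fun_norm_addHaar (volume : Measure (Rn n))
        (f := fun y : ℝ => (y ^ (n - 1))⁻¹) (r := r)).2
      apply this
      rw [finrank_euclideanSpace_fin]
      have h2 : IntegrableOn (fun _ : ℝ => (1 : ℝ)) (Set.Ioo 0 r) := by simp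
      refine h2.congr_fun ?_ measurableSet_Ioo
      intro y hy
      have : y ^ (n - 1) ≠ 0 := pow_ne_zero _ hy.1.ne'
      simp [this]
    have h3 := h1.const_mul ((n * volume.real (Metric.ball (0 : Rn n) 1))⁻¹)
    refine h3.mono' ?_ ?_
    · apply Measurable.aestronglyMeasurable
      unfold kernel
      fun_prop
    · refine Eventually.of_forall fun x => ?_
      unfold kernel
      rw [norm_div, Real.norm_of_nonneg
        (show 0 ≤ (n * volume.real (Metric.ball (0 : Rn n) 1) * ‖x‖ ^ n) by positivity)]
      rcases eq_or_ne x 0 with rfl | hx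
      · simp only [PiLp.zero_apply, norm_zero, zero_div]
        positivity
      · have hx' : 0 < ‖x‖ := norm_pos_iff.2 hx
        have hpow : ‖x‖ ^ n = ‖x‖ ^ (n - 1) * ‖x‖ := by
          rw [← pow_succ, Nat.sub_add_cancel (Nat.one_le_iff_ne_zero.2 hn)]
        calc ‖x j‖ / (n * volume.real (Metric.ball (0 : Rn n) 1) * ‖x‖ ^ n)
            ≤ ‖x‖ / (n * volume.real (Metric.ball (0 : Rn n) 1) * ‖x‖ ^ n) := by
              gcongr
              exact PiLp.norm_apply_le x j
          _ = (n * volume.real (Metric.ball (0 : Rn n) 1))⁻¹ * (‖x‖ ^ (n - 1))⁻¹ := by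
              rw [hpow, ← mul_assoc, div_mul_cancel_right₀ hx'.ne', mul_inv]
  intro x
  exact ⟨Metric.ball 0 (‖x‖ + 1), Metric.isOpen_ball.mem_nhds (by simp), key _⟩

/-- `Δ⁻¹ ∂ⱼψ = ∂ⱼE ⋆ ψ` for a test function `ψ`. -/
noncomputable def invLaplacianDeriv {n : ℕ} (j : Fin n) (ψ : 𝓓(whole n, ℝ)) : Rn n → ℝ :=
  convolution (kernel j) ψ (ContinuousLinearMap.mul ℝ ℝ) volume

theorem contDiff_invLaplacianDeriv {n : ℕ} (j : Fin n) (ψ : 𝓓(whole n, ℝ)) :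
    ContDiff ℝ ((⊤ : ℕ∞) : WithTop ℕ∞) (invLaplacianDeriv j ψ) :=
  ψ.hasCompactSupport.contDiff_convolution_right _ (locallyIntegrable_kernel j) ψ.contDiff

open Classical in
/-- The test function `x ↦ η(x / R) (Δ⁻¹ ∂ⱼψ)(x)`, for `R ≠ 0`. -/
noncomputable def truncated {n : ℕ} (η : 𝓓(whole n, ℝ)) (R : ℝ) (j : Fin n)
    (ψ : 𝓓(whole n, ℝ)) : 𝓓(whole n, ℝ) :=
  if hR : R = 0 then 0 else
  { toFun := fun x => η (R⁻¹ • x) * invLaplacianDeriv j ψ x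
    contDiff' := (η.contDiff.comp (contDiff_const_smul R⁻¹)).mul (contDiff_invLaplacianDeriv j ψ)
    hasCompactSupport' := (η.hasCompactSupport.comp_smul (inv_ne_zero hR)).mul_right
    tsupport_subset' := Set.subset_univ _ }

/-- The pairing with `ψ` of the `j`-th component of `∇ Δ⁻¹ (η(·/R) Q)`, where `η(·/R) Q` is a
compactly supported distribution: by duality it is `-⟨η(·/R) Q, Δ⁻¹ ∂ⱼψ⟩`. -/
noncomputable def truncatedPairing {n : ℕ} (Q : Distr n) (η : 𝓓(whole n, ℝ)) (R : ℝ) (j : Fin n)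
    (ψ : 𝓓(whole n, ℝ)) : ℂ :=
  -Q (truncated η R j ψ)

/-- `Γ = ∇ Δ⁻¹ Q`: for every cutoff `η ∈ C₀^∞` equal to `1` near the origin, `∇ Δ⁻¹ (η(·/R) Q)`
converges to `Γ` in the sense of distributions as `R → ∞`. -/
def IsGradInvLaplacian {n : ℕ} (Q : Distr n) (Γ : VectorField n) : Prop :=
  LocallyIntegrable Γ ∧ ∀ η : 𝓓(whole n, ℝ), (∀ᶠ x in 𝓝 (0 : Rn n), η x = 1) →
    ∀ (j : Fin n) (ψ : 𝓓(whole n, ℝ)),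
      Tendsto (fun R : ℝ => truncatedPairing Q η R j ψ) atTop (𝓝 (∫ x, ψ x • Γ x j))

/-- `Γ = ∇ Δ⁻¹ Q` modulo additive constants: as `IsGradInvLaplacian`, but the convergence is that of
distributions modulo constants, that is, it is tested on the `ψ` with `∫ ψ = 0`. This is the usual
meaning of `∇ Δ⁻¹ Q` as an element of a space of functions modulo constants. -/
def IsGradInvLaplacianModConst {n : ℕ} (Q : Distr n) (Γ : VectorField n) : Prop :=
  LocallyIntegrable Γ ∧ ∀ η : 𝓓(whole n, ℝ), (∀ᶠ x in 𝓝 (0 : Rn n), η x = 1) →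
    ∀ (j : Fin n) (ψ : 𝓓(whole n, ℝ)), ∫ x, ψ x = 0 →
      Tendsto (fun R : ℝ => truncatedPairing Q η R j ψ) atTop (𝓝 (∫ x, ψ x • Γ x j))

end NashForm

/-! Put α = n+1-p(n+2) and lam = n+2α. Everything passes through one condition, `LocalBound`: for
real u supported in a ball of radius δ, |Q(u)| ≤ K δ^{lam/2} ‖∇u‖₂. The cases are read off from lam:
lam > n+2 in (a), lam = n+2 in (b), n < lam < n+2 in (c), lam = n in (d), lam < n in (e).

From (N) to the local bound (`NashInequality.localBound`). The inequality controls Q on squares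
only. If v is a cutoff equal to 1 on the support of u, then 4u = (u+v)² - (u-v)². Once u is
normalised so that its gradient norm matches that of v, (N) applied to u+v and u-v gives the bound;
Poincaré's inequality takes care of the L¹ norms.

From the local bound to a field (`LocalBound.exists_field`). The components of ∇Δ⁻¹Q should be the
functionals ψ ↦ -Q(Δ⁻¹∂ⱼψ). The function Δ⁻¹∂ⱼψ has no compact support, but it decays like
|x|^{1-n}, and like |x|^{-n} if ∫ψ = 0. By a Caccioppoli estimate the contributions of dyadic annuli
form a convergent geometric series when lam < n, respectively lam < n+2. Hence the truncations
converge, all cutoffs give the same limit, and the limit is at most C δ^{lam/2} ‖ψ‖₂ for ψ supported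
in a ball of radius δ. By duality it is given by a function Γ with ∫_{B_δ}|Γ-c|² ≤ C δ^lam, where c
= 0 if no moment condition was needed. This is the Morrey condition for lam < n, bounded mean
oscillation for lam = n, and Hölder continuity (Campanato) for n < lam < n+2. The identity div Γ = Q
follows from ∑ⱼ Δ⁻¹∂ⱼ∂ⱼφ = φ.

For lam ≥ n+2 the local bound is tested on translated mollifiers at scale δ, which gives |Q(ψ)| ≤ C
δ^{α-1} ‖ψ‖₁ + C_ψ δ (`LocalBound.exists_integral_bound`). As δ → 0 this yields Q = 0 if α > 1 and a
bounded density if α = 1.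

From a field back to (N). It suffices to prove |⟨Qu,u⟩| ≤ C(δ^{α+1}‖∇u‖₂² + δ^{α-1-n}‖u‖₁²) for
every δ > 0 and to optimise in δ (`nashInequality_of_additive`). At scale δ, Γ is split into its
mollification, whose derivatives are O(δ^{α-1}), and a remainder Γ₁. The measure |Γ₁|²dx grows
slowly enough on balls of radius at most δ for a trace inequality (`exists_trace_inequality`) to
bound ∫|Γ₁|²|u|². A Morrey field needs no mollification; for BMO the growth estimate rests on the
John–Nirenberg inequality in L². -/

namespace NashForm

/-! ### Partial derivatives and test functions -/

/-- The partial derivative `∂ⱼu`. -/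
noncomputable def pderiv {n : ℕ} {F : Type*} [NormedAddCommGroup F] [NormedSpace ℝ F]
    (j : Fin n) (u : Rn n → F) (x : Rn n) : F :=
  fderiv ℝ u x (EuclideanSpace.single j 1)

/-- The test function with given underlying function. -/
def testOf {n : ℕ} {F : Type*} [NormedAddCommGroup F] [NormedSpace ℝ F] (f : Rn n → F)
    (hf : ContDiff ℝ ((⊤ : ℕ∞) : WithTop ℕ∞) f) (hc : HasCompactSupport f) : 𝓓(whole n, F) where
  toFun := f
  contDiff' := hf
  hasCompactSupport' := hc
  tsupport_subset' := Set.subset_univ _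

section pderiv

variable {n : ℕ} {F : Type*} [NormedAddCommGroup F] [NormedSpace ℝ F]

theorem coe_testOf (f : Rn n → F) (hf : ContDiff ℝ ((⊤ : ℕ∞) : WithTop ℕ∞) f)
    (hc : HasCompactSupport f) : ⇑(testOf f hf hc) = f := rfl

theorem test_differentiable (u : 𝓓(whole n, F)) : Differentiable ℝ u :=
  u.contDiff.differentiable (by simp)

theorem pderiv_add {u v : Rn n → F} {x : Rn n} (j : Fin n) (hu : DifferentiableAt ℝ u x)
    (hv : DifferentiableAt ℝ v x) : pderiv j (fun y => u y + v y) x = pderiv j u x + pderiv j v x := by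
  unfold pderiv; rw [fderiv_fun_add hu hv]; rfl

theorem pderiv_sub {u v : Rn n → F} {x : Rn n} (j : Fin n) (hu : DifferentiableAt ℝ u x)
    (hv : DifferentiableAt ℝ v x) : pderiv j (fun y => u y - v y) x = pderiv j u x - pderiv j v x := by
  unfold pderiv; rw [fderiv_fun_sub hu hv]; rfl

theorem pderiv_mul {u v : Rn n → ℝ} {x : Rn n} (j : Fin n) (hu : DifferentiableAt ℝ u x)
    (hv : DifferentiableAt ℝ v x) :
    pderiv j (fun y => u y * v y) x = u x * pderiv j v x + v x * pderiv j u x := by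
  unfold pderiv; rw [fderiv_fun_mul hu hv]; simp

theorem pderiv_const_mul {u : Rn n → ℝ} {x : Rn n} (j : Fin n) (c : ℝ)
    (hu : DifferentiableAt ℝ u x) : pderiv j (fun y => c * u y) x = c * pderiv j u x := by
  unfold pderiv; rw [fderiv_const_mul hu]; simp

theorem pderiv_comp_affine {u : Rn n → F} {x : Rn n} (j : Fin n) (c : ℝ) (a : Rn n)
    (hu : Differentiable ℝ u) :
    pderiv j (fun y => u (c • (y - a))) x = c • pderiv j u (c • (x - a)) := by
  unfold pderiv
  have h1 : HasFDerivAt (fun y : Rn n => c • (y - a)) (c • ContinuousLinearMap.id ℝ (Rn n)) x :=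
    ((hasFDerivAt_id x).sub_const a).const_smul c
  have h2 := (hu (c • (x - a))).hasFDerivAt.comp x h1
  have h3 := h2.fderiv
  simp only [Function.comp_def] at h3
  rw [h3]; simp

theorem pderiv_comp_const_sub {u : Rn n → F} {x : Rn n} (j : Fin n) (a : Rn n)
    (hu : Differentiable ℝ u) :
    pderiv j (fun y => u (a - y)) x = - pderiv j u (a - x) := by
  unfold pderiv
  have h1 : HasFDerivAt (fun y : Rn n => a - y) (-ContinuousLinearMap.id ℝ (Rn n)) x :=
    (hasFDerivAt_id x).const_sub a
  have h2 := (hu (a - x)).hasFDerivAt.comp x h1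
  have h3 := h2.fderiv
  simp only [Function.comp_def] at h3
  rw [h3]; simp

theorem contDiff_pderiv (j : Fin n) {u : Rn n → F} (hu : ContDiff ℝ ((⊤ : ℕ∞) : WithTop ℕ∞) u) :
    ContDiff ℝ ((⊤ : ℕ∞) : WithTop ℕ∞) (pderiv j u) :=
  (hu.fderiv_right (m := ((⊤ : ℕ∞) : WithTop ℕ∞)) (by simp)).clm_apply contDiff_const

theorem continuous_pderiv (j : Fin n) {u : Rn n → F} (hu : ContDiff ℝ 1 u) :
    Continuous (pderiv j u) :=
  (hu.continuous_fderiv (by simp)).clm_apply continuous_const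

theorem hasCompactSupport_pderiv (j : Fin n) {u : Rn n → F} (hu : HasCompactSupport u) :
    HasCompactSupport (pderiv j u) :=
  hu.fderiv_apply ℝ _

theorem pderiv_eq_zero_of_notMem (j : Fin n) {u : Rn n → F} {x : Rn n} (hx : x ∉ tsupport u) :
    pderiv j u x = 0 := by
  unfold pderiv; rw [fderiv_of_notMem_tsupport (𝕜 := ℝ) hx]; rfl

theorem pderiv_eq_zero_of_eventually (j : Fin n) {u : Rn n → F} {x : Rn n} {c : F}
    (h : u =ᶠ[𝓝 x] fun _ => c) : pderiv j u x = 0 := by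
  unfold pderiv; rw [h.fderiv_eq]; simp

/-- The test function `∂ⱼu`. -/
noncomputable def testPderiv (j : Fin n) (u : 𝓓(whole n, F)) : 𝓓(whole n, F) :=
  testOf (pderiv j u) (contDiff_pderiv j u.contDiff) (hasCompactSupport_pderiv j u.hasCompactSupport)

@[simp] theorem testPderiv_apply (j : Fin n) (u : 𝓓(whole n, F)) (x : Rn n) :
    testPderiv j u x = pderiv j u x := rfl

theorem test_integrable (u : 𝓓(whole n, F)) : Integrable u :=
  u.continuous.integrable_of_hasCompactSupport u.hasCompactSupport

theorem test_memLp (u : 𝓓(whole n, F)) : MemLp u 2 :=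
  u.continuous.memLp_of_hasCompactSupport u.hasCompactSupport

theorem integral_mul_pderiv {u v : Rn n → ℝ} (j : Fin n) (hu : ContDiff ℝ 1 u)
    (hv : ContDiff ℝ 1 v) (hc : HasCompactSupport v) :
    ∫ x, u x * pderiv j v x = - ∫ x, pderiv j u x * v x := by
  refine integral_mul_fderiv_eq_neg_fderiv_mul_of_integrable ?_ ?_ ?_
    (fun x _ => (hu.differentiable (by simp)).differentiableAt)
    (fun x _ => (hv.differentiable (by simp)).differentiableAt)
  · exact ((continuous_pderiv j hu).mul hv.continuous).integrable_of_hasCompactSupport hc.mul_left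
  · exact (hu.continuous.mul (continuous_pderiv j hv)).integrable_of_hasCompactSupport
      (hasCompactSupport_pderiv j hc).mul_left
  · exact (hu.continuous.mul hv.continuous).integrable_of_hasCompactSupport hc.mul_left

theorem integral_pderiv_eq_zero {v : Rn n → ℝ} (j : Fin n)
    (hv : ContDiff ℝ 1 v) (hc : HasCompactSupport v) : ∫ x, pderiv j v x = 0 := by
  have h := integral_mul_pderiv (u := fun _ => 1) j contDiff_const hv hc
  have h0 : ∀ x, pderiv j (fun _ : Rn n => (1 : ℝ)) x = 0 := fun x =>
    pderiv_eq_zero_of_eventually j (c := 1) (Eventually.of_forall fun _ => rfl)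
  simpa [h0] using h

end pderiv

/-! ### Norms -/

theorem abs_integral_mul_le_sqrt {α : Type*} [MeasurableSpace α] {μ : Measure α} {f g : α → ℝ}
    (hf : MemLp f 2 μ) (hg : MemLp g 2 μ) :
    |∫ x, f x * g x ∂μ| ≤ √(∫ x, f x ^ 2 ∂μ) * √(∫ x, g x ^ 2 ∂μ) := by
  have h := integral_mul_norm_le_Lp_mul_Lq (μ := μ) (f := f) (g := g) (p := 2) (q := 2)
    Real.HolderConjugate.two_two (by simpa using hf) (by simpa using hg)
  have e : ∀ f : α → ℝ, (∫ a, ‖f a‖ ^ (2 : ℝ) ∂μ) ^ (1 / 2 : ℝ) = √(∫ x, f x ^ 2 ∂μ) := by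
    intro f
    rw [Real.sqrt_eq_rpow]
    congr 1
    refine integral_congr_ae (Eventually.of_forall fun x => ?_)
    simp
  rw [e, e] at h
  refine le_trans ?_ h
  rw [← Real.norm_eq_abs]
  refine (norm_integral_le_integral_norm _).trans_eq ?_
  simp

theorem integral_norm_le_sqrt_volume_mul {n : ℕ} {F : Type*} [NormedAddCommGroup F] {f : Rn n → F}
    {s : Set (Rn n)} (hs' : volume s ≠ ∞)
    (hf : MemLp f 2 (volume.restrict s)) :
    ∫ x in s, ‖f x‖ ≤ √(volume.real s) * √(∫ x in s, ‖f x‖ ^ 2) := by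
  have : IsFiniteMeasure (volume.restrict s) := ⟨by simpa using lt_top_iff_ne_top.2 hs'⟩
  have h := abs_integral_mul_le_sqrt (f := fun _ => (1 : ℝ)) (memLp_const 1) hf.norm
  refine (le_abs_self _).trans ?_
  simpa [Measure.real] using h

/-- `‖∇u‖²` in `L²`. -/
noncomputable def gradSq {n : ℕ} (u : Rn n → ℝ) : ℝ := ∫ x, ∑ j : Fin n, pderiv j u x ^ 2

theorem gradSq_nonneg {n : ℕ} (u : Rn n → ℝ) : 0 ≤ gradSq u :=
  integral_nonneg fun _ => Finset.sum_nonneg fun _ _ => sq_nonneg _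

theorem integrable_pderiv_sq {n : ℕ} (j : Fin n) (u : 𝓓(whole n, ℝ)) :
    Integrable fun x => pderiv j u x ^ 2 :=
  (test_memLp (testPderiv j u)).integrable_sq

theorem integrable_sum_pderiv_sq {n : ℕ} (u : 𝓓(whole n, ℝ)) :
    Integrable fun x => ∑ j, pderiv j u x ^ 2 :=
  integrable_finsetSum _ fun j _ => integrable_pderiv_sq j u

theorem gradSq_eq_sum {n : ℕ} (u : 𝓓(whole n, ℝ)) : gradSq u = ∑ j, ∫ x, pderiv j u x ^ 2 :=
  integral_finsetSum _ fun j _ => integrable_pderiv_sq j u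

theorem integral_pderiv_sq_le_gradSq {n : ℕ} (j : Fin n) (u : 𝓓(whole n, ℝ)) :
    ∫ x, pderiv j u x ^ 2 ≤ gradSq u := by
  rw [gradSq_eq_sum]
  exact Finset.single_le_sum (f := fun j => ∫ x, pderiv j u x ^ 2)
    (fun i _ => integral_nonneg fun x => sq_nonneg _) (Finset.mem_univ j)

theorem gradSq_smul {n : ℕ} (c : ℝ) (u : 𝓓(whole n, ℝ)) : gradSq (c • u) = c ^ 2 * gradSq u := by
  unfold gradSq
  rw [← integral_const_mul]
  refine integral_congr_ae (Eventually.of_forall fun x => ?_)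
  simp only [Finset.mul_sum]
  refine Finset.sum_congr rfl fun j _ => ?_
  have := pderiv_const_mul j c (test_differentiable u x)
  rw [← mul_pow, ← this]
  rfl

theorem gradSq_add_le {n : ℕ} (u v : 𝓓(whole n, ℝ)) :
    gradSq (u + v) ≤ 2 * gradSq u + 2 * gradSq v := by
  unfold gradSq
  rw [← integral_const_mul, ← integral_const_mul, ← integral_add
    ((integrable_sum_pderiv_sq u).const_mul 2) ((integrable_sum_pderiv_sq v).const_mul 2)]
  refine integral_mono (integrable_sum_pderiv_sq (u + v))
    (((integrable_sum_pderiv_sq u).const_mul 2).add ((integrable_sum_pderiv_sq v).const_mul 2))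
    fun x => ?_
  simp only [Finset.mul_sum, ← Finset.sum_add_distrib]
  refine Finset.sum_le_sum fun j _ => ?_
  have := pderiv_add j (test_differentiable u x) (test_differentiable v x)
  change pderiv j (fun y => u y + v y) x ^ 2 ≤ _
  rw [this]
  nlinarith [sq_nonneg (pderiv j u x - pderiv j v x)]

/-- The volume of the unit ball. -/
noncomputable def ballVol (n : ℕ) : ℝ := volume.real (Metric.ball (0 : Rn n) 1)

theorem ballVol_pos (n : ℕ) : 0 < ballVol n :=
  ENNReal.toReal_pos (Metric.measure_ball_pos _ _ one_pos).ne' measure_ball_lt_top.ne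

theorem volume_real_closedBall {n : ℕ} (x : Rn n) {r : ℝ} (hr : 0 ≤ r) :
    volume.real (Metric.closedBall x r) = ballVol n * r ^ n := by
  rw [Measure.addHaar_real_closedBall _ _ hr, finrank_euclideanSpace_fin, mul_comm]; rfl

theorem volume_real_ball {n : ℕ} (x : Rn n) {r : ℝ} (hr : 0 < r) :
    volume.real (Metric.ball x r) = ballVol n * r ^ n := by
  rw [Measure.real, Measure.addHaar_ball_of_pos _ _ hr, finrank_euclideanSpace_fin, mul_comm,
    ENNReal.toReal_mul, ENNReal.toReal_ofReal (by positivity)]; rfl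

theorem integral_le_of_support_closedBall {n : ℕ} {f : Rn n → ℝ} {M r : ℝ} {x₀ : Rn n}
    (hr : 0 ≤ r) (hM : ∀ x, f x ≤ M) (h0 : ∀ x, x ∉ Metric.closedBall x₀ r → f x = 0)
    (hf : Integrable f) : ∫ x, f x ≤ M * (ballVol n * r ^ n) := by
  have h1 : ∫ x, f x = ∫ x in Metric.closedBall x₀ r, f x :=
    (setIntegral_eq_integral_of_forall_compl_eq_zero fun x hx => h0 x hx).symm
  rw [h1]
  calc ∫ x in Metric.closedBall x₀ r, f x ≤ ∫ x in Metric.closedBall x₀ r, M := by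
        refine setIntegral_mono hf.integrableOn ?_ hM
        simp [integrableOn_const_iff, measure_closedBall_lt_top]
    _ = M * (ballVol n * r ^ n) := by
        rw [setIntegral_const, volume_real_closedBall _ hr, smul_eq_mul, mul_comm]

/-- Poincaré's inequality for functions supported in a ball. -/
theorem integral_sq_le_gradSq {n : ℕ} (hn : 0 < n) (u : 𝓓(whole n, ℝ)) {x₀ : Rn n} {δ : ℝ}
    (hδ : 0 < δ) (hu : tsupport u ⊆ Metric.closedBall x₀ δ) :
    ∫ x, u x ^ 2 ≤ 4 * δ ^ 2 * gradSq u := by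
  set j : Fin n := ⟨0, hn⟩
  -- The function xⱼ - x₀ⱼ has j-th derivative 1, so integration by parts turns ∫u² into -2∫(xⱼ -
  -- x₀ⱼ) u ∂ⱼu, and |xⱼ - x₀ⱼ| ≤ δ on the support.
  have hlin : ContDiff ℝ 1 (fun x : Rn n => x j - x₀ j) := by fun_prop
  have hpd : ∀ x, pderiv j (fun x : Rn n => x j - x₀ j) x = 1 := by
    intro x
    unfold pderiv
    rw [fderiv_sub_const]
    have : (fun x : Rn n => x j) = (EuclideanSpace.proj j : Rn n →L[ℝ] ℝ) := rfl
    rw [this, ContinuousLinearMap.fderiv]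
    simp
  have huc : ContDiff ℝ 1 u := u.contDiff.of_le (by simp)
  have hc2 : HasCompactSupport (fun x => u x * u x) := u.hasCompactSupport.mul_left
  have h1 := integral_mul_pderiv j hlin (huc.mul huc) hc2
  have h2 : ∀ x, pderiv j (fun x => u x * u x) x = 2 * (u x * pderiv j u x) := fun x => by
    rw [pderiv_mul j (test_differentiable u x) (test_differentiable u x)]; ring
  simp only [hpd, h2, one_mul] at h1
  have h3 : ∫ x, u x ^ 2 = -∫ x, u x * ((x j - x₀ j) * 2 * pderiv j u x) := by
    have h1' : ∫ x, u x ^ 2 = -∫ x, (x j - x₀ j) * (2 * (u x * pderiv j u x)) := by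
      rw [h1]; simp [pow_two]
    rw [h1']
    congr 2; ext x; ring
  have hm : MemLp (fun x => (x j - x₀ j) * 2 * pderiv j u x) 2 := by
    refine Continuous.memLp_of_hasCompactSupport ?_ ?_
    · have := continuous_pderiv j huc
      fun_prop
    · exact (hasCompactSupport_pderiv j u.hasCompactSupport).mul_left
  have h4 : ∫ x, u x ^ 2 ≤
      √(∫ x, u x ^ 2) * √(∫ x, ((x j - x₀ j) * 2 * pderiv j u x) ^ 2) := by
    calc ∫ x, u x ^ 2 ≤ |∫ x, u x * ((x j - x₀ j) * 2 * pderiv j u x)| := by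
          rw [h3]; exact neg_le_abs _
      _ ≤ _ := abs_integral_mul_le_sqrt (test_memLp u) hm
  have h5 : ∫ x, ((x j - x₀ j) * 2 * pderiv j u x) ^ 2 ≤ 4 * δ ^ 2 * gradSq u := by
    calc ∫ x, ((x j - x₀ j) * 2 * pderiv j u x) ^ 2
        ≤ ∫ x, 4 * δ ^ 2 * pderiv j u x ^ 2 := by
          refine integral_mono hm.integrable_sq ((integrable_pderiv_sq j u).const_mul _) fun x => ?_
          by_cases hx : x ∈ tsupport u
          · have h6 : |x j - x₀ j| ≤ δ := by
              have := PiLp.norm_apply_le (x - x₀) j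
              have h7 := hu hx
              rw [mem_closedBall_iff_norm] at h7
              simpa using this.trans h7
            have h8 : (x j - x₀ j) ^ 2 ≤ δ ^ 2 := sq_le_sq' (abs_le.1 h6).1 (abs_le.1 h6).2
            have := mul_le_mul_of_nonneg_right h8 (sq_nonneg (pderiv j u x))
            simp only
            nlinarith
          · simp [pderiv_eq_zero_of_notMem j hx]
      _ = 4 * δ ^ 2 * ∫ x, pderiv j u x ^ 2 := integral_const_mul _ _
      _ ≤ _ := by
          gcongr
          exact integral_pderiv_sq_le_gradSq j u
  have hA : 0 ≤ ∫ x, u x ^ 2 := integral_nonneg fun x => sq_nonneg _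
  set A := ∫ x, u x ^ 2
  set B := ∫ x, ((x j - x₀ j) * 2 * pderiv j u x) ^ 2
  have hB : 0 ≤ B := integral_nonneg fun x => sq_nonneg _
  -- From A ≤ √A √B; squaring avoids a division by √A, which may vanish.
  have h6 : A ≤ B := by
    rw [← Real.sqrt_mul hA] at h4
    have h7 := Real.sq_sqrt (mul_nonneg hA hB)
    by_contra hlt
    push Not at hlt
    have hAB : A ^ 2 ≤ A * B := by
      rw [← h7]; exact pow_le_pow_left₀ hA h4 2
    nlinarith
  exact h6.trans h5

end NashForm

namespace NashForm

/-! ### Cutoff functions -/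

/-- A smooth bump function equal to `1` on the unit ball and vanishing outside the ball of
radius `2`. -/
noncomputable def unitBump (n : ℕ) : ContDiffBump (0 : Rn n) where
  rIn := 1
  rOut := 2
  rIn_pos := one_pos
  rIn_lt_rOut := one_lt_two

/-- The standard cutoff function. -/
noncomputable def stdCutoff (n : ℕ) : 𝓓(whole n, ℝ) :=
  testOf (unitBump n) (unitBump n).contDiff (unitBump n).hasCompactSupport

section cutoff

variable {n : ℕ}

theorem tsupport_stdCutoff : tsupport (stdCutoff n) = Metric.closedBall 0 2 :=
  (unitBump n).tsupport_eq

theorem stdCutoff_eq_one {x : Rn n} (hx : ‖x‖ ≤ 1) : stdCutoff n x = 1 :=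
  (unitBump n).one_of_mem_closedBall (by simpa [unitBump] using hx)

theorem stdCutoff_nonneg (x : Rn n) : 0 ≤ stdCutoff n x := (unitBump n).nonneg

theorem stdCutoff_le_one (x : Rn n) : stdCutoff n x ≤ 1 := (unitBump n).le_one

theorem exists_pderiv_bound (u : 𝓓(whole n, ℝ)) :
    ∃ M : ℝ, 0 ≤ M ∧ ∀ j x, |pderiv j u x| ≤ M := by
  have h : ∀ j, ∃ M : ℝ, ∀ x, |pderiv j u x| ≤ M := fun j => by
    simpa using (testPderiv j u).continuous.bounded_above_of_compact_support
      (testPderiv j u).hasCompactSupport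
  choose M hM using h
  refine ⟨∑ j, |M j|, Finset.sum_nonneg fun _ _ => abs_nonneg _, fun j x => ?_⟩
  exact (hM j x).trans ((le_abs_self _).trans
    (Finset.single_le_sum (f := fun j => |M j|) (fun _ _ => abs_nonneg _) (Finset.mem_univ j)))

theorem hasCompactSupport_comp_affine {F : Type*} [NormedAddCommGroup F] [NormedSpace ℝ F]
    (u : 𝓓(whole n, F)) (x₀ : Rn n) {R : ℝ} (hR : R ≠ 0) :
    HasCompactSupport fun x => u (R⁻¹ • (x - x₀)) := by
  have h := u.hasCompactSupport.comp_homeomorph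
    ((Homeomorph.subRight x₀).trans (Homeomorph.smulOfNeZero R⁻¹ (inv_ne_zero hR)))
  exact h

open Classical in
/-- The test function `x ↦ u((x - x₀) / R)`. -/
noncomputable def rescale {F : Type*} [NormedAddCommGroup F] [NormedSpace ℝ F]
    (u : 𝓓(whole n, F)) (x₀ : Rn n) (R : ℝ) : 𝓓(whole n, F) :=
  if hR : R = 0 then 0 else
  testOf (fun x => u (R⁻¹ • (x - x₀)))
    (u.contDiff.comp ((contDiff_id.sub contDiff_const).const_smul R⁻¹))
    (hasCompactSupport_comp_affine u x₀ hR)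

section rescale

variable {F : Type*} [NormedAddCommGroup F] [NormedSpace ℝ F] (u : 𝓓(whole n, F)) (x₀ : Rn n)
  {R : ℝ}

theorem coe_rescale (hR : 0 < R) : ⇑(rescale u x₀ R) = fun x => u (R⁻¹ • (x - x₀)) := by
  simp [rescale, hR.ne', coe_testOf]

theorem rescale_apply (hR : 0 < R) (x : Rn n) : rescale u x₀ R x = u (R⁻¹ • (x - x₀)) := by
  rw [coe_rescale u x₀ hR]

theorem pderiv_rescale (hR : 0 < R) (j : Fin n) (x : Rn n) :
    pderiv j (rescale u x₀ R) x = R⁻¹ • pderiv j u (R⁻¹ • (x - x₀)) := by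
  rw [coe_rescale u x₀ hR, pderiv_comp_affine j R⁻¹ x₀ (test_differentiable u)]

theorem tsupport_rescale_subset (hR : 0 < R) {a : ℝ}
    (hu : tsupport u ⊆ Metric.closedBall 0 a) :
    tsupport (rescale u x₀ R) ⊆ Metric.closedBall x₀ (a * R) := by
  refine closure_minimal (fun x hx => ?_) Metric.isClosed_closedBall
  rw [Function.mem_support, rescale_apply u x₀ hR] at hx
  have h1 := hu (subset_tsupport _ hx)
  rw [mem_closedBall_zero_iff, norm_smul, norm_inv, Real.norm_of_nonneg hR.le,
    inv_mul_le_iff₀ hR] at h1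
  rw [mem_closedBall_iff_norm]
  linarith

end rescale

/-- The cutoff function adapted to the ball of radius `R` around `x₀`. -/
noncomputable def cutoffAt (x₀ : Rn n) (R : ℝ) : 𝓓(whole n, ℝ) := rescale (stdCutoff n) x₀ R

theorem cutoffAt_eq_one {x₀ x : Rn n} {R : ℝ} (hR : 0 < R) (hx : ‖x - x₀‖ ≤ R) :
    cutoffAt x₀ R x = 1 := by
  rw [cutoffAt, rescale_apply _ _ hR]
  apply stdCutoff_eq_one
  rw [norm_smul, norm_inv, Real.norm_of_nonneg hR.le, inv_mul_le_iff₀ hR]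
  linarith

theorem cutoffAt_nonneg {x₀ x : Rn n} {R : ℝ} (hR : 0 < R) : 0 ≤ cutoffAt x₀ R x := by
  rw [cutoffAt, rescale_apply _ _ hR]; exact stdCutoff_nonneg _

theorem cutoffAt_le_one {x₀ x : Rn n} {R : ℝ} (hR : 0 < R) : cutoffAt x₀ R x ≤ 1 := by
  rw [cutoffAt, rescale_apply _ _ hR]; exact stdCutoff_le_one _

theorem tsupport_cutoffAt {x₀ : Rn n} {R : ℝ} (hR : 0 < R) :
    tsupport (cutoffAt x₀ R) ⊆ Metric.closedBall x₀ (2 * R) :=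
  tsupport_rescale_subset _ _ hR tsupport_stdCutoff.subset

/-- The gradient is of size R⁻¹ on a set of volume of order Rⁿ. The power R^{n-2} is kept as a
product, since subtraction of natural numbers truncates. -/
theorem gradSq_rescale_le (u : 𝓓(whole n, ℝ)) {a : ℝ} (ha : 0 ≤ a)
    (hu : tsupport u ⊆ Metric.closedBall 0 a) :
    ∃ C : ℝ, 0 ≤ C ∧ ∀ (x₀ : Rn n) (R : ℝ), 0 < R → gradSq (rescale u x₀ R) ≤ C * (R⁻¹ ^ 2 * R ^ n) := by
  obtain ⟨M, hM0, hM⟩ := exists_pderiv_bound u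
  refine ⟨n * M ^ 2 * (ballVol n * a ^ n), by have := ballVol_pos n; positivity, fun x₀ R hR => ?_⟩
  have hs := tsupport_rescale_subset u x₀ hR hu
  have := integral_le_of_support_closedBall (f := fun x => ∑ j : Fin n, pderiv j (rescale u x₀ R) x ^ 2)
    (M := n * (R⁻¹ * M) ^ 2) (x₀ := x₀) (r := a * R) (by positivity) (fun x => ?_) (fun x hx => ?_)
    (integrable_sum_pderiv_sq _)
  · refine this.trans_eq ?_
    rw [mul_pow, mul_pow]; ring
  · calc ∑ j : Fin n, pderiv j (rescale u x₀ R) x ^ 2 ≤ ∑ j : Fin n, (R⁻¹ * M) ^ 2 := by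
          refine Finset.sum_le_sum fun j _ => ?_
          rw [pderiv_rescale u x₀ hR, smul_eq_mul, ← sq_abs, abs_mul, abs_of_pos (inv_pos.2 hR)]
          gcongr
          exact hM _ _
      _ = _ := by simp
  · exact Finset.sum_eq_zero fun j _ => by
      rw [pderiv_eq_zero_of_notMem j (fun h => hx (hs h))]; simp

end cutoff

/-! ### From the inequality to local bounds -/

/-- `Q` belongs to a homogeneous local `H⁻¹` space of Campanato type: on functions supported in a
ball of radius `δ` it is bounded by `K δ^{lam/2} ‖∇u‖₂`. -/
def LocalBound {n : ℕ} (Q : Distr n) (K lam : ℝ) : Prop :=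
  0 ≤ K ∧ ∀ (x₀ : Rn n) (δ : ℝ), 0 < δ → ∀ u : 𝓓(whole n, ℝ),
    tsupport u ⊆ Metric.closedBall x₀ δ → ‖Q u‖ ≤ K * δ ^ (lam / 2) * √(gradSq u)

section

variable {n : ℕ}

/-- A real test function as a complex one. -/
noncomputable def complexify (u : 𝓓(whole n, ℝ)) : 𝓓(whole n, ℂ) :=
  testOf (fun x => (u x : ℂ)) (Complex.ofRealCLM.contDiff.comp u.contDiff)
    (u.hasCompactSupport.comp_left Complex.ofReal_zero)

theorem gradL2_complexify (u : 𝓓(whole n, ℝ)) : gradL2 (complexify u) = √(gradSq u) := by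
  unfold gradL2 gradSq
  congr 2; ext x
  refine Finset.sum_congr rfl fun j _ => ?_
  have : HasFDerivAt (complexify u) (Complex.ofRealCLM.comp (fderiv ℝ u x)) x :=
    Complex.ofRealCLM.hasFDerivAt.comp x (test_differentiable u x).hasFDerivAt
  rw [this.fderiv]
  simp [pderiv]

theorem complexify_apply (u : 𝓓(whole n, ℝ)) (x : Rn n) : complexify u x = (u x : ℂ) := rfl

theorem normL1_complexify (u : 𝓓(whole n, ℝ)) : normL1 (complexify u) = ∫ x, |u x| := by
  simp [normL1, complexify_apply]

theorem gradL2_nonneg (u : 𝓓(whole n, ℂ)) : 0 ≤ gradL2 u := Real.sqrt_nonneg _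

theorem normL1_nonneg (u : 𝓓(whole n, ℂ)) : 0 ≤ normL1 u := integral_nonneg fun _ => norm_nonneg _

/-- The product of two real test functions. -/
noncomputable def testMul (u v : 𝓓(whole n, ℝ)) : 𝓓(whole n, ℝ) :=
  testOf (fun x => u x * v x) (u.contDiff.mul v.contDiff) u.hasCompactSupport.mul_right

/-- Poincaré's inequality on a ball containing the support. It disposes of the case in which the
normalisation in `NashInequality.localBound` would divide by zero. -/
theorem test_eq_zero_of_gradSq_eq_zero (hn : 0 < n) {u : 𝓓(whole n, ℝ)} (hu : gradSq u = 0) :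
    u = 0 := by
  obtain ⟨R, hR, hs⟩ := u.hasCompactSupport.isBounded.subset_closedBall_lt 0 0
  have h1 := integral_sq_le_gradSq hn u hR hs
  rw [hu, mul_zero] at h1
  have h2 := le_antisymm h1 (integral_nonneg fun x => sq_nonneg (u x))
  have h3 : HasCompactSupport fun x => u x ^ 2 :=
    u.hasCompactSupport.comp_left (g := fun t : ℝ => t ^ 2) (by simp)
  ext x
  by_contra hx
  have := Continuous.integral_pos_of_hasCompactSupport_nonneg_nonzero (μ := volume)
    (f := fun x => u x ^ 2) (by fun_prop) h3 (fun x => sq_nonneg _) (pow_ne_zero 2 hx)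
  exact this.ne' h2

/-- The form in which (N) is used: real functions, squares written as products so that they can be
polarised, and a constant made nonnegative so that monotonicity applies. -/
theorem NashInequality.exists_testMul_self_bound {Q : Distr n} {p : ℝ} (h : NashInequality Q p) :
    ∃ C : ℝ, 0 ≤ C ∧ ∀ u : 𝓓(whole n, ℝ),
      ‖Q (testMul u u)‖ ≤ C * √(gradSq u) ^ (2 * p) * (∫ x, |u x|) ^ (2 * (1 - p)) := by
  obtain ⟨C, hC⟩ := h
  refine ⟨|C|, abs_nonneg _, fun u => ?_⟩
  have h1 := hC (complexify u)
  have h2 : absSq (complexify u) = testMul u u := by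
    ext x
    change ‖(u x : ℂ)‖ ^ 2 = u x * u x
    simp [pow_two]
  rw [gradL2_complexify, normL1_complexify, quadForm, h2] at h1
  refine h1.trans ?_
  have : 0 ≤ ∫ x, |u x| := integral_nonneg fun x => abs_nonneg _
  gcongr
  exact le_abs_self C

theorem integral_abs_le_of_tsupport (u : 𝓓(whole n, ℝ)) {x₀ : Rn n} {r : ℝ} (hr : 0 ≤ r)
    (hu : tsupport u ⊆ Metric.closedBall x₀ r) :
    ∫ x, |u x| ≤ √(ballVol n * r ^ n) * √(∫ x, u x ^ 2) := by
  have h0 : ∀ x, x ∉ Metric.closedBall x₀ r → u x = 0 := fun x hx =>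
    image_eq_zero_of_notMem_tsupport fun h => hx (hu h)
  have h := integral_norm_le_sqrt_volume_mul (f := u) (s := Metric.closedBall x₀ r)
    measure_closedBall_lt_top.ne ((test_memLp u).restrict _)
  rw [volume_real_closedBall _ hr,
    setIntegral_eq_integral_of_forall_compl_eq_zero (fun x hx => by simp [h0 x hx]),
    setIntegral_eq_integral_of_forall_compl_eq_zero (fun x hx => by simp [h0 x hx])] at h
  simpa using h

/-- The Nash type inequality implies the local bound. -/
theorem NashInequality.localBound {Q : Distr n} {p : ℝ} (hn : 2 ≤ n) (hp0 : 0 < p) (hp1 : p < 1)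
    (h : NashInequality Q p) : ∃ K, LocalBound Q K (3 * n + 2 - 2 * p * (n + 2)) := by
  obtain ⟨C, hC0, hC⟩ := h.exists_testMul_self_bound
  obtain ⟨G, hG0, hG⟩ := gradSq_rescale_le (stdCutoff n) (a := 2) (by norm_num)
    tsupport_stdCutoff.subset
  have hω := ballVol_pos n
  set c₁ := √(2 + 2 * G) with hc₁
  set c₂ := 2 * √(ballVol n) + ballVol n * 2 ^ n with hc₂
  have hc₂0 : 0 ≤ c₂ := by positivity
  set B := C * c₁ ^ (2 * p) * c₂ ^ (2 * (1 - p)) with hB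
  have hB0 : 0 ≤ B := by positivity
  refine ⟨B, hB0, fun x₀ δ hδ u hu => ?_⟩
  rcases eq_or_ne (gradSq u) 0 with hz | hz
  · rw [test_eq_zero_of_gradSq_eq_zero (by lia) hz, map_zero]
    simp only [norm_zero]
    positivity
  have hgpos : 0 < gradSq u := lt_of_le_of_ne (gradSq_nonneg _) (Ne.symm hz)
  set g := √(gradSq u) with hg
  have hg0 : 0 < g := Real.sqrt_pos.2 hgpos
  have hgsq : g ^ 2 = gradSq u := Real.sq_sqrt hgpos.le
  -- D is the order of magnitude of ‖∇v‖₂ for a cutoff v at scale δ. Dividing u by s = ‖∇u‖₂ / D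
  -- produces a function a with ‖∇a‖₂ = D, so that a and v enter the polarisation on an equal
  -- footing.
  set D : ℝ := δ ^ (((n : ℝ) - 2) / 2) with hD
  have hD0 : 0 < D := Real.rpow_pos_of_pos hδ _
  have hDsq : D ^ 2 = δ⁻¹ ^ 2 * δ ^ n := by
    rw [hD, ← Real.rpow_natCast, ← Real.rpow_mul hδ.le, ← Real.rpow_natCast δ⁻¹,
      ← Real.rpow_natCast δ, Real.inv_rpow hδ.le, ← Real.rpow_neg hδ.le, ← Real.rpow_add hδ]
    congr 1; push_cast; ring
  set s := g / D with hs
  have hs0 : 0 < s := by positivity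
  set a : 𝓓(whole n, ℝ) := s⁻¹ • u with ha
  set v := cutoffAt x₀ δ with hv
  have ha_apply : ∀ x, a x = s⁻¹ * u x := fun x => rfl
  have hga : gradSq a = D ^ 2 := by
    rw [ha, gradSq_smul, ← hgsq, hs]; field_simp
  have hta : tsupport a ⊆ Metric.closedBall x₀ δ := by
    refine closure_minimal (fun x hx => ?_) Metric.isClosed_closedBall
    refine hu (subset_tsupport _ ?_)
    rw [Function.mem_support] at hx ⊢
    intro h0; exact hx (by rw [ha_apply, h0, mul_zero])
  have hgv : gradSq v ≤ G * D ^ 2 := by rw [hDsq]; exact hG x₀ δ hδ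
  have hav : ∀ x, a x * v x = a x := fun x => by
    by_cases hx : x ∈ tsupport u
    · rw [hv, cutoffAt_eq_one hδ (by simpa [dist_eq_norm] using hu hx), mul_one]
    · rw [ha_apply, image_eq_zero_of_notMem_tsupport hx]; simp
  have hδn : √(δ ^ n) * (δ * D) = δ ^ n := by
    rw [hD, Real.sqrt_eq_rpow, ← Real.rpow_natCast, ← Real.rpow_mul hδ.le]
    nth_rewrite 2 [← Real.rpow_one δ]
    rw [← Real.rpow_add hδ, ← Real.rpow_add hδ]
    congr 1; ring
  -- Poincaré gives ‖a‖₂ ≤ 2δD, and Cauchy–Schwarz on the ball costs a multiple of δ^{n/2}; the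
  -- powers of δ combine to δⁿ, the size of ‖v‖₁.
  have ha1 : ∫ x, |a x| ≤ 2 * √(ballVol n) * δ ^ n := by
    have h2 := integral_sq_le_gradSq (by lia) a hδ hta
    rw [hga] at h2
    have h3 : √(∫ x, a x ^ 2) ≤ 2 * δ * D := Real.sqrt_le_iff.2 ⟨by positivity, by nlinarith⟩
    have h1 := integral_abs_le_of_tsupport a hδ.le hta
    rw [Real.sqrt_mul hω.le] at h1
    calc ∫ x, |a x| ≤ √(ballVol n) * √(δ ^ n) * (2 * δ * D) := h1.trans (by gcongr)
      _ = 2 * √(ballVol n) * (√(δ ^ n) * (δ * D)) := by ring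
      _ = 2 * √(ballVol n) * δ ^ n := by rw [hδn]
  have hv1 : ∫ x, |v x| ≤ ballVol n * 2 ^ n * δ ^ n := by
    have := integral_le_of_support_closedBall (f := fun x => |v x|) (M := 1) (x₀ := x₀)
      (r := 2 * δ) (by positivity)
      (fun x => by rw [abs_of_nonneg (cutoffAt_nonneg hδ)]; exact cutoffAt_le_one hδ)
      (fun x hx => by
        rw [image_eq_zero_of_notMem_tsupport fun h => hx (tsupport_cutoffAt hδ h), abs_zero])
      (test_integrable v).abs
    refine this.trans_eq ?_
    rw [mul_pow]; ring
  have key : ∀ b : 𝓓(whole n, ℝ), gradSq b ≤ (2 + 2 * G) * D ^ 2 → ∫ x, |b x| ≤ c₂ * δ ^ n →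
      ‖Q (testMul b b)‖ ≤ B * (D ^ (2 * p) * (δ ^ n) ^ (2 * (1 - p))) := by
    intro b hb1 hb2
    have h1 : √(gradSq b) ≤ c₁ * D := by
      rw [hc₁, ← Real.sqrt_sq hD0.le, ← Real.sqrt_mul (by positivity)]
      exact Real.sqrt_le_sqrt hb1
    have h0 : 0 ≤ ∫ x, |b x| := integral_nonneg fun x => abs_nonneg _
    calc ‖Q (testMul b b)‖ ≤ C * √(gradSq b) ^ (2 * p) * (∫ x, |b x|) ^ (2 * (1 - p)) := hC b
      _ ≤ C * (c₁ * D) ^ (2 * p) * (c₂ * δ ^ n) ^ (2 * (1 - p)) := by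
          have : 0 ≤ 2 * (1 - p) := by linarith
          gcongr
      _ = _ := by
          rw [Real.mul_rpow (by positivity) hD0.le, Real.mul_rpow hc₂0 (by positivity), hB]; ring
  have hplus := key (a + v) ((gradSq_add_le a v).trans (by rw [hga]; nlinarith)) (by
    calc ∫ x, |(a + v) x| ≤ ∫ x, (|a x| + |v x|) :=
          integral_mono (test_integrable (a + v)).abs
            ((test_integrable a).abs.add (test_integrable v).abs) fun x => abs_add_le (a x) (v x)
      _ = (∫ x, |a x|) + ∫ x, |v x| :=
          integral_add (test_integrable a).abs (test_integrable v).abs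
      _ ≤ _ := by rw [hc₂]; linarith)
  have hminus := key (a + (-1 : ℝ) • v) ((gradSq_add_le a _).trans (by
      rw [hga, gradSq_smul]; nlinarith)) (by
    calc ∫ x, |(a + (-1 : ℝ) • v) x| ≤ ∫ x, (|a x| + |v x|) :=
          integral_mono (test_integrable _).abs
            ((test_integrable a).abs.add (test_integrable v).abs) fun x => by
              have := abs_add_le (a x) ((-1 : ℝ) * v x)
              rw [abs_mul, abs_neg, abs_one, one_mul] at this
              exact this
      _ = (∫ x, |a x|) + ∫ x, |v x| :=
          integral_add (test_integrable a).abs (test_integrable v).abs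
      _ ≤ _ := by rw [hc₂]; linarith)
  -- Polarisation: (a+v)² - (a-v)² = 4av, and av = a because v = 1 on the support of u.
  have hpol : u = (s / 4) • (testMul (a + v) (a + v) -
      testMul (a + (-1 : ℝ) • v) (a + (-1 : ℝ) • v)) := by
    ext x
    change u x = s / 4 * ((a x + v x) * (a x + v x) - (a x + (-1) * v x) * (a x + (-1) * v x))
    have h1 := hav x
    have h2 : u x = s * a x := by rw [ha_apply]; field_simp
    rw [h2]; linear_combination (-s) * h1
  -- With s = g/D the power of δ is (2p-1)(n-2)/2 + 2n(1-p), which equals lam/2.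
  have hexp : s * (D ^ (2 * p) * (δ ^ n) ^ (2 * (1 - p))) =
      δ ^ ((3 * n + 2 - 2 * p * (n + 2)) / 2) * g := by
    have : s * (D ^ (2 * p) * (δ ^ n) ^ (2 * (1 - p))) =
        g * (D⁻¹ * D ^ (2 * p) * (δ ^ n) ^ (2 * (1 - p))) := by rw [hs]; ring
    rw [this, mul_comm g]
    congr 1
    rw [hD, ← Real.rpow_neg hδ.le, ← Real.rpow_mul hδ.le, ← Real.rpow_natCast,
      ← Real.rpow_mul hδ.le, ← Real.rpow_add hδ, ← Real.rpow_add hδ]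
    congr 1; ring
  rw [hpol, map_smul, map_sub, norm_smul, Real.norm_of_nonneg (by positivity)]
  calc s / 4 * ‖Q (testMul (a + v) (a + v)) - Q (testMul (a + (-1 : ℝ) • v) (a + (-1 : ℝ) • v))‖
      ≤ s / 4 * (B * (D ^ (2 * p) * (δ ^ n) ^ (2 * (1 - p))) +
          B * (D ^ (2 * p) * (δ ^ n) ^ (2 * (1 - p)))) := by
        gcongr; exact (norm_sub_le _ _).trans (add_le_add hplus hminus)
    _ = B / 2 * (s * (D ^ (2 * p) * (δ ^ n) ^ (2 * (1 - p)))) := by ring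
    _ = B / 2 * (δ ^ ((3 * n + 2 - 2 * p * (n + 2)) / 2) * g) := by rw [hexp]
    _ ≤ B * δ ^ ((3 * n + 2 - 2 * p * (n + 2)) / 2) * g := by
        rw [mul_assoc B]
        exact mul_le_mul_of_nonneg_right (half_le_self hB0) (by positivity)

end

end NashForm

namespace NashForm

/-! ### A trace inequality -/

theorem sq_lintegral_mul_le {α : Type*} [MeasurableSpace α] {μ : Measure α} {f g : α → ℝ≥0∞}
    (hf : AEMeasurable f μ) (hg : AEMeasurable g μ) :
    (∫⁻ x, f x * g x ∂μ) ^ 2 ≤ (∫⁻ x, f x ^ 2 ∂μ) * ∫⁻ x, g x ^ 2 ∂μ := by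
  have h := ENNReal.lintegral_mul_le_Lp_mul_Lq μ Real.HolderConjugate.two_two hf hg
  calc (∫⁻ x, f x * g x ∂μ) ^ 2
      ≤ ((∫⁻ a, f a ^ (2 : ℝ) ∂μ) ^ (1 / 2 : ℝ) * (∫⁻ a, g a ^ (2 : ℝ) ∂μ) ^ (1 / 2 : ℝ)) ^ 2 := by
        gcongr; exact h
    _ = _ := by
        rw [mul_pow, ← ENNReal.rpow_natCast, ← ENNReal.rpow_natCast, ← ENNReal.rpow_mul,
          ← ENNReal.rpow_mul]
        norm_num

theorem sq_lintegral_le_measure_univ_mul {α : Type*} [MeasurableSpace α] {μ : Measure α}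
    {f : α → ℝ≥0∞} (hf : AEMeasurable f μ) :
    (∫⁻ x, f x ∂μ) ^ 2 ≤ μ Set.univ * ∫⁻ x, f x ^ 2 ∂μ := by
  simpa using sq_lintegral_mul_le (f := fun _ => 1) aemeasurable_const hf

section

variable {n : ℕ}

/-- The integral over the unit ball of the rescaled function. -/
noncomputable def ballMean (s : ℝ) (h : Rn n → ℝ≥0∞) (x : Rn n) : ℝ≥0∞ :=
  ∫⁻ z in Metric.ball (0 : Rn n) 1, h (x + s • z)

theorem ballMean_eq {s : ℝ} (hs : 0 < s) {h : Rn n → ℝ≥0∞} (hh : Measurable h) (x : Rn n) :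
    ballMean s h x = ENNReal.ofReal (s ^ n)⁻¹ * ∫⁻ y in Metric.ball x s, h y := by
  unfold ballMean
  rw [← lintegral_indicator measurableSet_ball, ← lintegral_indicator measurableSet_ball]
  have hm : Measurable fun y => (Metric.ball x s).indicator h (x + y) :=
    (hh.indicator measurableSet_ball).comp (measurable_const_add x)
  have h1 : ∀ z : Rn n, (Metric.ball (0 : Rn n) 1).indicator (fun z => h (x + s • z)) z =
      (Metric.ball x s).indicator h (x + s • z) := by
    intro z
    have : x + s • z ∈ Metric.ball x s ↔ z ∈ Metric.ball (0 : Rn n) 1 := by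
      rw [mem_ball_iff_norm, mem_ball_zero_iff, add_sub_cancel_left, norm_smul,
        Real.norm_of_nonneg hs.le, mul_lt_iff_lt_one_right hs]
    by_cases hz : z ∈ Metric.ball (0 : Rn n) 1
    · rw [Set.indicator_of_mem hz, Set.indicator_of_mem (this.2 hz)]
    · rw [Set.indicator_of_notMem hz, Set.indicator_of_notMem (fun h => hz (this.1 h))]
  simp_rw [h1]
  rw [← lintegral_map (f := fun y => (Metric.ball x s).indicator h (x + y)) hm
    (measurable_const_smul s), Measure.map_addHaar_smul _ hs.ne', lintegral_smul_measure,
    finrank_euclideanSpace_fin, abs_of_pos (by positivity),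
    lintegral_add_left_eq_self (fun y => (Metric.ball x s).indicator h y) x]
  rfl

/-- By Tonelli and the symmetry of y ∈ B(x,s), the μ-integral of ball integrals of h is the integral
of h weighted by μ(B(y,s)). The growth s^{n+e} against the normalisation s^{-n} leaves s^e. -/
theorem lintegral_ballMean_le {μ : Measure (Rn n)} [SFinite μ] {s e A : ℝ} (hs : 0 < s)
    (hμ : ∀ x, μ (Metric.ball x s) ≤ ENNReal.ofReal (A * s ^ (n + e)))
    {h : Rn n → ℝ≥0∞} (hh : Measurable h) :
    ∫⁻ x, ballMean s h x ∂μ ≤ ENNReal.ofReal (A * s ^ e) * ∫⁻ y, h y := by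
  simp_rw [ballMean_eq hs hh]
  have hset : MeasurableSet {q : Rn n × Rn n | dist q.2 q.1 < s} :=
    measurableSet_lt (measurable_snd.dist measurable_fst) measurable_const
  have hm : Measurable (Function.uncurry fun x y : Rn n => (Metric.ball x s).indicator h y) := by
    have := (hh.comp measurable_snd).indicator hset
    convert this using 1
    ext q
    simp [Function.uncurry, Set.indicator, Metric.mem_ball]
  have hswap : ∫⁻ x, (∫⁻ y in Metric.ball x s, h y) ∂μ = ∫⁻ y, h y * μ (Metric.ball y s) := by
    simp_rw [← lintegral_indicator measurableSet_ball]
    rw [lintegral_lintegral_swap hm.aemeasurable]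
    refine lintegral_congr fun y => ?_
    have : ∀ x, (Metric.ball x s).indicator h y = (Metric.ball y s).indicator (fun _ => h y) x := by
      intro x
      simp only [Set.indicator, Metric.mem_ball, dist_comm]
    simp_rw [this]
    rw [lintegral_indicator measurableSet_ball, setLIntegral_const]
  have hmx : Measurable fun x => ∫⁻ y in Metric.ball x s, h y := by
    simp_rw [← lintegral_indicator measurableSet_ball]
    exact hm.lintegral_prod_right'
  rw [lintegral_const_mul _ hmx, hswap]
  calc ENNReal.ofReal (s ^ n)⁻¹ * ∫⁻ y, h y * μ (Metric.ball y s)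
      ≤ ENNReal.ofReal (s ^ n)⁻¹ * ∫⁻ y, h y * ENNReal.ofReal (A * s ^ (n + e)) := by
        gcongr with y; exact hμ y
    _ = _ := by
        rw [lintegral_mul_const _ hh, mul_comm (∫⁻ y, h y), ← mul_assoc,
          ← ENNReal.ofReal_mul (by positivity), Real.rpow_add hs, Real.rpow_natCast]
        congr 2
        field_simp

theorem measurable_ballMean {s : ℝ} {h : Rn n → ℝ≥0∞} (hh : Measurable h) :
    Measurable (ballMean s h) :=
  Measurable.lintegral_prod_right' (f := fun q : Rn n × Rn n => h (q.1 + s • q.2))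
    (by fun_prop)

theorem measurable_uncurry_ballMean {δ : ℝ} {h : Rn n → ℝ≥0∞} (hh : Measurable h) :
    Measurable fun q : Rn n × ℝ => ballMean (q.2 * δ) h q.1 :=
  Measurable.lintegral_prod_right'
    (f := fun q : (Rn n × ℝ) × Rn n => h (q.1.1 + (q.1.2 * δ) • q.2)) (by fun_prop)

theorem measurable_ballMean_mul {δ : ℝ} {h : Rn n → ℝ≥0∞} (hh : Measurable h) (x : Rn n) :
    Measurable fun t : ℝ => ballMean (t * δ) h x :=
  Measurable.lintegral_prod_right'
    (f := fun q : ℝ × Rn n => h (x + (q.1 * δ) • q.2)) (by fun_prop)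

theorem enorm_le_add_lintegral_fderiv {F : Type*} [NormedAddCommGroup F] [NormedSpace ℝ F]
    [CompleteSpace F] {u : Rn n → F} (hu : ContDiff ℝ 1 u) (x v : Rn n) :
    ‖u x‖ₑ ≤ ‖u (x + v)‖ₑ + ∫⁻ t in Set.Ioc (0 : ℝ) 1, ‖fderiv ℝ u (x + t • v)‖ₑ * ‖v‖ₑ := by
  have hd : ∀ t : ℝ, HasDerivAt (fun t : ℝ => u (x + t • v)) (fderiv ℝ u (x + t • v) v) t := by
    intro t
    have h1 : HasDerivAt (fun t : ℝ => x + t • v) v t := by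
      simpa using ((hasDerivAt_id t).smul_const v).const_add x
    exact ((hu.differentiable (by simp)) (x + t • v)).hasFDerivAt.comp_hasDerivAt t h1
  have hc : Continuous fun t : ℝ => fderiv ℝ u (x + t • v) v :=
    ((hu.continuous_fderiv (by simp)).comp (by fun_prop)).clm_apply continuous_const
  have h2 := intervalIntegral.integral_eq_sub_of_hasDerivAt (a := 0) (b := 1) (fun t _ => hd t)
    (hc.intervalIntegrable 0 1)
  simp only [one_smul, zero_smul, add_zero] at h2
  have h3 : u x = u (x + v) - ∫ t in (0 : ℝ)..1, fderiv ℝ u (x + t • v) v := by rw [h2]; abel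
  rw [h3]
  refine (enorm_sub_le).trans ?_
  gcongr
  rw [intervalIntegral.integral_of_le zero_le_one]
  refine (enorm_integral_le_lintegral_enorm _).trans ?_
  refine lintegral_mono fun t => ?_
  exact ContinuousLinearMap.le_opENorm _ _

/-- The fundamental theorem of calculus on the segment from x to x+δz, integrated over z in the unit
ball. An integral over the scales tδ takes the place of the singular kernel |x-y|^{1-n}, so that
`lintegral_ballMean_le` applies at each scale. -/
theorem mul_enorm_le_ballMean_add {F : Type*} [NormedAddCommGroup F] [NormedSpace ℝ F]
    [CompleteSpace F] {u : Rn n → F} (hu : ContDiff ℝ 1 u) {δ : ℝ} (hδ : 0 < δ) (x : Rn n) :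
    volume (Metric.ball (0 : Rn n) 1) * ‖u x‖ₑ ≤ ballMean δ (fun y => ‖u y‖ₑ) x +
      ENNReal.ofReal δ *
        ∫⁻ t in Set.Ioc (0 : ℝ) 1, ballMean (t * δ) (fun y => ‖fderiv ℝ u y‖ₑ) x := by
  have hgm : Measurable fun y => ‖fderiv ℝ u y‖ₑ := (hu.continuous_fderiv (by simp)).enorm.measurable
  have hum : Measurable fun y => ‖u y‖ₑ := hu.continuous.enorm.measurable
  calc volume (Metric.ball (0 : Rn n) 1) * ‖u x‖ₑ
      = ∫⁻ z in Metric.ball (0 : Rn n) 1, ‖u x‖ₑ := by rw [setLIntegral_const, mul_comm]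
    _ ≤ ∫⁻ z in Metric.ball (0 : Rn n) 1, (‖u (x + δ • z)‖ₑ + ENNReal.ofReal δ *
          ∫⁻ t in Set.Ioc (0 : ℝ) 1, ‖fderiv ℝ u (x + (t * δ) • z)‖ₑ) := by
        refine setLIntegral_mono' measurableSet_ball fun z hz => ?_
        refine (enorm_le_add_lintegral_fderiv hu x (δ • z)).trans ?_
        gcongr
        rw [lintegral_mul_const _ (by simp only [smul_smul]; fun_prop), mul_comm]
        simp only [smul_smul]
        gcongr
        rw [enorm_smul, Real.enorm_eq_ofReal hδ.le]
        refine mul_le_of_le_one_right' ?_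
        rw [mem_ball_zero_iff] at hz
        rw [← ofReal_norm]
        exact ENNReal.ofReal_le_one.2 hz.le
    _ = _ := by
        have h1 : Measurable fun z => ‖u (x + δ • z)‖ₑ := hum.comp (by fun_prop)
        rw [lintegral_add_left h1, lintegral_const_mul']
        · congr 2
          rw [lintegral_lintegral_swap]
          · rfl
          · apply Measurable.aemeasurable
            fun_prop
        · exact ENNReal.ofReal_ne_top

/-- The trace inequality: a measure with `μ(B_r) ≤ A r^{n+e}`, `e > -2`, for `r ≤ δ`, satisfies
`∫ |u|² dμ ≤ C A (δ^{e+2} ‖∇u‖₂² + δ^{e-n} ‖u‖₁²)`. -/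
theorem exists_trace_inequality (n : ℕ) {e : ℝ} (he : -2 < e) :
    ∃ C : ℝ≥0, ∀ {F : Type} [NormedAddCommGroup F] [NormedSpace ℝ F] [CompleteSpace F]
      (μ : Measure (Rn n)) [SFinite μ] (A δ : ℝ), 0 ≤ A → 0 < δ →
      (∀ x r, 0 < r → r ≤ δ → μ (Metric.ball x r) ≤ ENNReal.ofReal (A * r ^ (n + e))) →
      ∀ u : Rn n → F, ContDiff ℝ 1 u →
        ∫⁻ x, ‖u x‖ₑ ^ 2 ∂μ ≤ C * (ENNReal.ofReal (A * δ ^ (e + 2)) * ∫⁻ x, ‖fderiv ℝ u x‖ₑ ^ 2) +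
          C * (ENNReal.ofReal (A * δ ^ (e - n)) * (∫⁻ x, ‖u x‖ₑ) ^ 2) := by
  -- The hypothesis e > -2 enters here only: it makes t^{e/2} integrable at 0.
  set c : ℝ≥0∞ := ∫⁻ t in Set.Ioc (0 : ℝ) 1, ENNReal.ofReal (t ^ (e / 2)) with hc
  have hcfin : c ≠ ∞ := by
    have h1 : IntegrableOn (fun t : ℝ => t ^ (e / 2)) (Set.Ioc 0 1) := by
      rw [← intervalIntegrable_iff_integrableOn_Ioc_of_le zero_le_one]
      exact intervalIntegral.intervalIntegrable_rpow' (by linarith)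
    exact (Integrable.lintegral_lt_top h1).ne
  set ω : ℝ≥0∞ := volume (Metric.ball (0 : Rn n) 1) with hω
  have hω0 : ω ≠ 0 := (Metric.measure_ball_pos _ _ one_pos).ne'
  have hωt : ω ≠ ∞ := measure_ball_lt_top.ne
  have hfin : (ω⁻¹) ^ 2 * (2 * (1 + c * c * ω)) ≠ ∞ := by
    refine ENNReal.mul_ne_top (ENNReal.pow_ne_top (ENNReal.inv_ne_top.2 hω0)) ?_
    refine ENNReal.mul_ne_top ENNReal.ofNat_ne_top ?_
    refine ENNReal.add_ne_top.2 ⟨ENNReal.one_ne_top, ?_⟩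
    exact ENNReal.mul_ne_top (ENNReal.mul_ne_top hcfin hcfin) hωt
  refine ⟨((ω⁻¹) ^ 2 * (2 * (1 + c * c * ω))).toNNReal, ?_⟩
  intro F _ _ _ μ _ A δ hA hδ hμ u hu
  rw [ENNReal.coe_toNNReal hfin]
  set g : Rn n → ℝ≥0∞ := fun y => ‖fderiv ℝ u y‖ₑ with hg
  have hgm : Measurable g := (hu.continuous_fderiv (by simp)).enorm.measurable
  have hum : Measurable fun y => ‖u y‖ₑ := hu.continuous.enorm.measurable
  set P := ballMean δ (fun y => ‖u y‖ₑ) with hP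
  set G : Rn n → ℝ≥0∞ := fun x => ∫⁻ t in Set.Ioc (0 : ℝ) 1, ballMean (t * δ) g x with hG
  have hGm : Measurable G := (measurable_uncurry_ballMean hgm).lintegral_prod_right'
  have hPm : Measurable P := measurable_ballMean hum
  have hpt : ∀ x, ω ^ 2 * ‖u x‖ₑ ^ 2 ≤ 2 * P x ^ 2 + 2 * (ENNReal.ofReal (δ ^ 2) * G x ^ 2) := by
    intro x
    rw [← mul_pow]
    calc (ω * ‖u x‖ₑ) ^ 2 ≤ (P x + ENNReal.ofReal δ * G x) ^ 2 := by
          gcongr; exact mul_enorm_le_ballMean_add hu hδ x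
      _ ≤ 2 * (P x ^ 2 + (ENNReal.ofReal δ * G x) ^ 2) := by
          have := ENNReal.rpow_add_le_mul_rpow_add_rpow (P x) (ENNReal.ofReal δ * G x)
            (p := 2) (by norm_num)
          norm_num at this
          exact this
      _ = _ := by rw [mul_pow, ENNReal.ofReal_pow hδ.le, mul_add]
  -- One factor P is bounded pointwise by δ^{-n}‖u‖₁, the other is integrated against μ.
  have hP2 : ∫⁻ x, P x ^ 2 ∂μ ≤ ENNReal.ofReal (A * δ ^ (e - n)) * (∫⁻ x, ‖u x‖ₑ) ^ 2 := by
    calc ∫⁻ x, P x ^ 2 ∂μ ≤ ∫⁻ x, (ENNReal.ofReal (δ ^ n)⁻¹ * ∫⁻ y, ‖u y‖ₑ) * P x ∂μ := by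
          refine lintegral_mono fun x => ?_
          rw [pow_two]
          gcongr
          rw [hP, ballMean_eq hδ hum]
          gcongr
          exact Measure.restrict_le_self
      _ = (ENNReal.ofReal (δ ^ n)⁻¹ * ∫⁻ y, ‖u y‖ₑ) * ∫⁻ x, P x ∂μ := lintegral_const_mul _ hPm
      _ ≤ (ENNReal.ofReal (δ ^ n)⁻¹ * ∫⁻ y, ‖u y‖ₑ) *
            (ENNReal.ofReal (A * δ ^ e) * ∫⁻ y, ‖u y‖ₑ) := by
          gcongr
          exact lintegral_ballMean_le hδ (fun x => hμ x δ hδ le_rfl) hum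
      _ = (ENNReal.ofReal (δ ^ n)⁻¹ * ENNReal.ofReal (A * δ ^ e)) * (∫⁻ x, ‖u x‖ₑ) ^ 2 := by ring
      _ = _ := by
          rw [← ENNReal.ofReal_mul (by positivity), Real.rpow_sub hδ, Real.rpow_natCast]
          congr 2
          field_simp
  -- Cauchy–Schwarz in t with weights t^{e/4} and t^{-e/4}. Integrating the ball means at scale tδ
  -- against μ yields (tδ)^e, and t^{-e/2} t^e = t^{e/2} is again integrable, so the constant c
  -- appears twice.
  have hG2 : ∫⁻ x, G x ^ 2 ∂μ ≤ c * c * ω * (ENNReal.ofReal (A * δ ^ e) * ∫⁻ x, g x ^ 2) := by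
    have hg2 : Measurable fun y => g y ^ 2 := hgm.pow_const 2
    have hpt2 : ∀ x, G x ^ 2 ≤ c * ∫⁻ t in Set.Ioc (0 : ℝ) 1,
        ENNReal.ofReal (t ^ (-(e / 2))) * (ω * ballMean (t * δ) (fun y => g y ^ 2) x) := by
      intro x
      have h1 : G x = ∫⁻ t in Set.Ioc (0 : ℝ) 1, ENNReal.ofReal (t ^ (e / 4)) *
          (ENNReal.ofReal (t ^ (-(e / 4))) * ballMean (t * δ) g x) := by
        refine setLIntegral_congr_fun measurableSet_Ioc fun t ht => ?_
        rw [← mul_assoc, ← ENNReal.ofReal_mul (Real.rpow_nonneg ht.1.le _),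
          ← Real.rpow_add ht.1]
        simp
      have hbm : Measurable fun t : ℝ => ballMean (t * δ) g x :=
        measurable_ballMean_mul hgm x
      have hf1 : AEMeasurable (fun t : ℝ => ENNReal.ofReal (t ^ (e / 4)))
          (volume.restrict (Set.Ioc 0 1)) := by fun_prop
      have hf2 : AEMeasurable (fun t : ℝ => ENNReal.ofReal (t ^ (-(e / 4))) * ballMean (t * δ) g x)
          (volume.restrict (Set.Ioc 0 1)) := by
        have : Measurable fun t : ℝ => ENNReal.ofReal (t ^ (-(e / 4))) := by fun_prop
        exact (this.mul hbm).aemeasurable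
      have hsq : ∀ a t : ℝ, 0 < t → ENNReal.ofReal (t ^ (a / 4)) ^ 2 = ENNReal.ofReal (t ^ (a / 2)) := by
        intro a t ht
        rw [← ENNReal.ofReal_pow (Real.rpow_nonneg ht.le _), ← Real.rpow_natCast,
          ← Real.rpow_mul ht.le]
        congr 2; push_cast; ring
      have h3 : ∫⁻ t in Set.Ioc (0 : ℝ) 1, ENNReal.ofReal (t ^ (e / 4)) ^ 2 = c :=
        setLIntegral_congr_fun measurableSet_Ioc fun t ht => hsq e t ht.1
      rw [h1]
      have h4 := sq_lintegral_mul_le hf1 hf2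
      rw [h3] at h4
      refine h4.trans ?_
      gcongr 1
      refine setLIntegral_mono' measurableSet_Ioc fun t ht => ?_
      rw [mul_pow, ← neg_div, hsq (-e) t ht.1, neg_div]
      gcongr 1
      unfold ballMean
      refine (sq_lintegral_le_measure_univ_mul
        (hgm.comp (measurable_const.add (measurable_const_smul _))).aemeasurable).trans ?_
      rw [Measure.restrict_apply_univ]
      exact le_rfl
    have hbm2 : Measurable fun q : Rn n × ℝ => ballMean (q.2 * δ) (fun y => g y ^ 2) q.1 :=
      measurable_uncurry_ballMean hg2
    have hjm : Measurable (Function.uncurry fun (x : Rn n) (t : ℝ) =>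
        ENNReal.ofReal (t ^ (-(e / 2))) * (ω * ballMean (t * δ) (fun y => g y ^ 2) x)) := by
      have h2 : Measurable fun q : Rn n × ℝ => ENNReal.ofReal (q.2 ^ (-(e / 2))) := by fun_prop
      exact h2.mul (hbm2.const_mul ω)
    calc ∫⁻ x, G x ^ 2 ∂μ ≤ ∫⁻ x, (c * ∫⁻ t in Set.Ioc (0 : ℝ) 1,
          ENNReal.ofReal (t ^ (-(e / 2))) * (ω * ballMean (t * δ) (fun y => g y ^ 2) x)) ∂μ :=
          lintegral_mono hpt2
      _ = c * ∫⁻ t in Set.Ioc (0 : ℝ) 1, (∫⁻ x,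
          ENNReal.ofReal (t ^ (-(e / 2))) * (ω * ballMean (t * δ) (fun y => g y ^ 2) x) ∂μ) := by
          rw [lintegral_const_mul' _ _ hcfin, lintegral_lintegral_swap hjm.aemeasurable]
      _ ≤ c * ∫⁻ t in Set.Ioc (0 : ℝ) 1, ENNReal.ofReal (t ^ (e / 2)) *
            (ω * (ENNReal.ofReal (A * δ ^ e) * ∫⁻ x, g x ^ 2)) := by
          gcongr 1
          refine setLIntegral_mono' measurableSet_Ioc fun t ht => ?_
          have htδ : 0 < t * δ := mul_pos ht.1 hδ
          rw [lintegral_const_mul' _ _ ENNReal.ofReal_ne_top, lintegral_const_mul' _ _ hωt]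
          calc ENNReal.ofReal (t ^ (-(e / 2))) *
                (ω * ∫⁻ x, ballMean (t * δ) (fun y => g y ^ 2) x ∂μ)
              ≤ ENNReal.ofReal (t ^ (-(e / 2))) *
                (ω * (ENNReal.ofReal (A * (t * δ) ^ e) * ∫⁻ x, g x ^ 2)) := by
                gcongr
                exact lintegral_ballMean_le htδ
                  (fun x => hμ x _ htδ (mul_le_of_le_one_left hδ.le ht.2)) hg2
            _ = (ENNReal.ofReal (t ^ (-(e / 2))) * ENNReal.ofReal (A * (t * δ) ^ e)) *
                (ω * ∫⁻ x, g x ^ 2) := by ring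
            _ = (ENNReal.ofReal (t ^ (e / 2)) * ENNReal.ofReal (A * δ ^ e)) *
                (ω * ∫⁻ x, g x ^ 2) := by
                rw [← ENNReal.ofReal_mul (Real.rpow_nonneg ht.1.le _),
                  ← ENNReal.ofReal_mul (Real.rpow_nonneg ht.1.le _), Real.mul_rpow ht.1.le hδ.le]
                have : t ^ e = t ^ (e / 2) * t ^ (e / 2) := by
                  rw [← Real.rpow_add ht.1]; ring_nf
                have h2 : t ^ (-(e / 2)) * t ^ (e / 2) = 1 := by
                  rw [← Real.rpow_add ht.1]; simp
                congr 2
                rw [this]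
                linear_combination (A * t ^ (e / 2) * δ ^ e) * h2
            _ = _ := by ring
      _ = _ := by
          rw [lintegral_mul_const'' _ (by fun_prop), ← hc]
          ring
  have hmain : ω ^ 2 * ∫⁻ x, ‖u x‖ₑ ^ 2 ∂μ ≤ 2 * (1 + c * c * ω) *
      (ENNReal.ofReal (A * δ ^ (e + 2)) * (∫⁻ x, g x ^ 2) +
        ENNReal.ofReal (A * δ ^ (e - n)) * (∫⁻ x, ‖u x‖ₑ) ^ 2) := by
    calc ω ^ 2 * ∫⁻ x, ‖u x‖ₑ ^ 2 ∂μ = ∫⁻ x, ω ^ 2 * ‖u x‖ₑ ^ 2 ∂μ :=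
          (lintegral_const_mul _ (hum.pow_const 2)).symm
      _ ≤ ∫⁻ x, (2 * P x ^ 2 + 2 * (ENNReal.ofReal (δ ^ 2) * G x ^ 2)) ∂μ := lintegral_mono hpt
      _ = 2 * (∫⁻ x, P x ^ 2 ∂μ) + 2 * (ENNReal.ofReal (δ ^ 2) * ∫⁻ x, G x ^ 2 ∂μ) := by
          rw [lintegral_add_left (by fun_prop), lintegral_const_mul _ (by fun_prop),
            lintegral_const_mul _ (by fun_prop), lintegral_const_mul _ (by fun_prop)]
      _ ≤ 2 * (ENNReal.ofReal (A * δ ^ (e - n)) * (∫⁻ x, ‖u x‖ₑ) ^ 2) +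
          2 * (ENNReal.ofReal (δ ^ 2) *
            (c * c * ω * (ENNReal.ofReal (A * δ ^ e) * ∫⁻ x, g x ^ 2))) := by gcongr
      _ = 2 * (ENNReal.ofReal (A * δ ^ (e - n)) * (∫⁻ x, ‖u x‖ₑ) ^ 2) +
          2 * (c * c * ω) * (ENNReal.ofReal (A * δ ^ (e + 2)) * ∫⁻ x, g x ^ 2) := by
          have : ENNReal.ofReal (A * δ ^ (e + 2)) =
              ENNReal.ofReal (δ ^ 2) * ENNReal.ofReal (A * δ ^ e) := by
            rw [← ENNReal.ofReal_mul (by positivity), Real.rpow_add hδ, Real.rpow_two]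
            congr 1; ring
          rw [this]; ring
      _ ≤ 2 * (1 + c * c * ω) * (ENNReal.ofReal (A * δ ^ (e - n)) * (∫⁻ x, ‖u x‖ₑ) ^ 2) +
          2 * (1 + c * c * ω) * (ENNReal.ofReal (A * δ ^ (e + 2)) * ∫⁻ x, g x ^ 2) := by
          gcongr
          · rw [mul_add, mul_one]; exact le_self_add
          · exact le_add_self
      _ = _ := by ring
  calc ∫⁻ x, ‖u x‖ₑ ^ 2 ∂μ = (ω⁻¹) ^ 2 * (ω ^ 2 * ∫⁻ x, ‖u x‖ₑ ^ 2 ∂μ) := by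
        rw [← mul_assoc, ← mul_pow, ENNReal.inv_mul_cancel hω0 hωt, one_pow, one_mul]
    _ ≤ (ω⁻¹) ^ 2 * (2 * (1 + c * c * ω) *
      (ENNReal.ofReal (A * δ ^ (e + 2)) * (∫⁻ x, g x ^ 2) +
        ENNReal.ofReal (A * δ ^ (e - n)) * (∫⁻ x, ‖u x‖ₑ) ^ 2)) := by gcongr
    _ = _ := by ring

end

end NashForm

namespace NashForm

/-! ### Sufficient conditions for the inequality -/

section

variable {n : ℕ}

/-- The operator norm is at most the Hilbert–Schmidt norm. This passes from `fderiv` in the trace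
inequality to the coordinate expression in `gradL2`. -/
theorem norm_sq_le_sum_single {F : Type*} [NormedAddCommGroup F] [NormedSpace ℝ F]
    (L : Rn n →L[ℝ] F) : ‖L‖ ^ 2 ≤ ∑ j : Fin n, ‖L (EuclideanSpace.single j 1)‖ ^ 2 := by
  have h0 : 0 ≤ ∑ j : Fin n, ‖L (EuclideanSpace.single j 1)‖ ^ 2 :=
    Finset.sum_nonneg fun _ _ => sq_nonneg _
  have h : ‖L‖ ≤ √(∑ j : Fin n, ‖L (EuclideanSpace.single j 1)‖ ^ 2) := by
    refine L.opNorm_le_bound (Real.sqrt_nonneg _) fun v => ?_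
    have hv : v = ∑ j, v j • EuclideanSpace.single j (1 : ℝ) := by
      ext i
      simp [Finset.sum_apply, Pi.single_apply]
    have h1 : ‖L v‖ ≤ ∑ j, ‖L (EuclideanSpace.single j 1)‖ * ‖v j‖ := by
      nth_rewrite 1 [hv]
      rw [map_sum]
      refine (norm_sum_le _ _).trans (Finset.sum_le_sum fun j _ => ?_)
      rw [map_smul, norm_smul, mul_comm]
    refine h1.trans ((Real.sum_mul_le_sqrt_mul_sqrt _ _ _).trans ?_)
    rw [EuclideanSpace.norm_eq]
  calc ‖L‖ ^ 2 ≤ (√(∑ j : Fin n, ‖L (EuclideanSpace.single j 1)‖ ^ 2)) ^ 2 := by gcongr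
    _ = _ := Real.sq_sqrt h0

theorem integrable_gradL2_integrand (u : 𝓓(whole n, ℂ)) :
    Integrable fun x => ∑ j : Fin n, ‖fderiv ℝ u x (EuclideanSpace.single j 1)‖ ^ 2 :=
  integrable_finsetSum _ fun j _ => (test_memLp (testPderiv j u)).norm.integrable_sq

theorem gradL2_sq (u : 𝓓(whole n, ℂ)) :
    ENNReal.ofReal (gradL2 u ^ 2) =
      ∫⁻ x, ENNReal.ofReal (∑ j : Fin n, ‖fderiv ℝ u x (EuclideanSpace.single j 1)‖ ^ 2) := by
  have h0 : ∀ x, 0 ≤ ∑ j : Fin n, ‖fderiv ℝ u x (EuclideanSpace.single j 1)‖ ^ 2 :=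
    fun x => Finset.sum_nonneg fun _ _ => sq_nonneg _
  rw [gradL2, Real.sq_sqrt (integral_nonneg h0),
    ofReal_integral_eq_lintegral_ofReal (integrable_gradL2_integrand u)
      (Eventually.of_forall h0)]

theorem lintegral_fderiv_sq_le (u : 𝓓(whole n, ℂ)) :
    ∫⁻ x, ‖fderiv ℝ u x‖ₑ ^ 2 ≤ ENNReal.ofReal (gradL2 u ^ 2) := by
  rw [gradL2_sq]
  refine lintegral_mono fun x => ?_
  rw [← ofReal_norm, ← ENNReal.ofReal_pow (norm_nonneg _)]
  exact ENNReal.ofReal_le_ofReal (norm_sq_le_sum_single _)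

theorem ofReal_normL1 (u : 𝓓(whole n, ℂ)) : ENNReal.ofReal (normL1 u) = ∫⁻ x, ‖u x‖ₑ := by
  rw [normL1, ofReal_integral_norm_eq_lintegral_enorm (test_integrable u)]

/-- The trace inequality in terms of the norms of the Nash type inequality. -/
theorem exists_trace_inequality_real (n : ℕ) {e : ℝ} (he : -2 < e) :
    ∃ C : ℝ, 0 ≤ C ∧ ∀ (μ : Measure (Rn n)) [SFinite μ] (A δ : ℝ), 0 ≤ A → 0 < δ →
      (∀ x r, 0 < r → r ≤ δ → μ (Metric.ball x r) ≤ ENNReal.ofReal (A * r ^ (n + e))) →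
      ∀ u : 𝓓(whole n, ℂ), ∫⁻ x, ‖u x‖ₑ ^ 2 ∂μ ≤
        ENNReal.ofReal (C * A * (δ ^ (e + 2) * gradL2 u ^ 2 + δ ^ (e - n) * normL1 u ^ 2)) := by
  obtain ⟨C, hC⟩ := exists_trace_inequality n he
  refine ⟨C, C.2, fun μ _ A δ hA hδ hμ u => ?_⟩
  refine (hC μ A δ hA hδ hμ u (u.contDiff.of_le (by simp))).trans ?_
  have h0 := normL1_nonneg u
  calc _ ≤ ENNReal.ofReal C * (ENNReal.ofReal (A * δ ^ (e + 2)) * ENNReal.ofReal (gradL2 u ^ 2)) +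
        ENNReal.ofReal C * (ENNReal.ofReal (A * δ ^ (e - n)) * ENNReal.ofReal (normL1 u ^ 2)) := by
        rw [ENNReal.ofReal_coe_nnreal, ENNReal.ofReal_pow h0, ofReal_normL1]
        gcongr
        exact lintegral_fderiv_sq_le u
    _ = _ := by
        rw [← ENNReal.ofReal_mul (by positivity), ← ENNReal.ofReal_mul (by positivity),
          ← ENNReal.ofReal_mul (by positivity), ← ENNReal.ofReal_mul (by positivity),
          ← ENNReal.ofReal_add (by positivity) (by positivity)]
        congr 1; ring

/-- The multiplicative inequality follows from the family of additive ones. -/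
theorem nashInequality_of_additive {Q : Distr n} {p C : ℝ} (hp0 : 0 < p) (hp1 : p < 1)
    (h : ∀ (u : 𝓓(whole n, ℂ)) (δ : ℝ), 0 < δ → ‖quadForm Q u‖ ≤
      C * (δ ^ ((n + 2) * (1 - p)) * gradL2 u ^ 2 + δ ^ (-((n + 2) * p)) * normL1 u ^ 2)) :
    NashInequality Q p := by
  refine ⟨2 * C, fun u => ?_⟩
  have hn2 : (0 : ℝ) < n + 2 := by positivity
  have hX := gradL2_nonneg u
  have hY := normL1_nonneg u
  -- If ‖∇u‖₂ = 0, only the term with a negative power of δ is left, and δ → ∞ removes it.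
  rcases hX.eq_or_lt with hX0 | hX0
  · rw [← hX0, Real.zero_rpow (by positivity)]
    simp only [mul_zero, zero_mul]
    have h1 : Tendsto (fun δ : ℝ => C * (δ ^ (-((n + 2) * p)) * normL1 u ^ 2)) atTop
        (𝓝 (C * (0 * normL1 u ^ 2))) :=
      ((tendsto_rpow_neg_atTop (by positivity)).mul_const _).const_mul _
    simp only [zero_mul, mul_zero] at h1
    refine ge_of_tendsto h1 ?_
    filter_upwards [eventually_gt_atTop 0] with δ hδ
    simpa [← hX0] using h u δ hδ
  -- If ‖u‖₁ = 0, only the term with a positive power is left; δ⁻¹ is inserted for δ, so that the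
  -- limit is again taken at infinity.
  rcases hY.eq_or_lt with hY0 | hY0
  · rw [← hY0, Real.zero_rpow (by linarith)]
    simp only [mul_zero]
    have hpos : 0 < (n + 2) * (1 - p) := mul_pos hn2 (by linarith)
    have h1 : Tendsto (fun δ : ℝ => C * ((δ⁻¹) ^ ((n + 2) * (1 - p)) * gradL2 u ^ 2)) atTop
        (𝓝 (C * (0 * gradL2 u ^ 2))) := by
      refine Tendsto.const_mul _ (Tendsto.mul_const _ ?_)
      have := tendsto_rpow_neg_atTop hpos
      refine this.congr' ?_
      filter_upwards [eventually_gt_atTop 0] with δ hδ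
      rw [Real.rpow_neg hδ.le, Real.inv_rpow hδ.le]
    simp only [zero_mul, mul_zero] at h1
    refine ge_of_tendsto h1 ?_
    filter_upwards [eventually_gt_atTop 0] with δ hδ
    simpa [← hY0] using h u δ⁻¹ (inv_pos.2 hδ)
  set X := gradL2 u
  set Y := normL1 u
  -- The choice δ = (Y/X)^{2/(n+2)} makes both terms equal to X^{2p} Y^{2(1-p)}; hence the factor 2
  -- in the constant.
  have hδ : 0 < (Y / X) ^ (2 / ((n : ℝ) + 2)) := Real.rpow_pos_of_pos (by positivity) _
  have h1 := h u _ hδ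
  have hq : 0 < Y / X := by positivity
  have e1 : ((Y / X) ^ (2 / ((n : ℝ) + 2))) ^ ((n + 2) * (1 - p)) * X ^ 2 =
      X ^ (2 * p) * Y ^ (2 * (1 - p)) := by
    rw [← Real.rpow_mul hq.le]
    have : 2 / ((n : ℝ) + 2) * ((n + 2) * (1 - p)) = 2 * (1 - p) := by field_simp
    rw [this, Real.div_rpow hY0.le hX0.le, div_mul_eq_mul_div, mul_comm (Y ^ _), mul_div_right_comm,
      ← Real.rpow_natCast, ← Real.rpow_sub hX0]
    congr 2; push_cast; ring
  have e2 : ((Y / X) ^ (2 / ((n : ℝ) + 2))) ^ (-((n + 2) * p)) * Y ^ 2 =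
      X ^ (2 * p) * Y ^ (2 * (1 - p)) := by
    rw [← Real.rpow_mul hq.le]
    have : 2 / ((n : ℝ) + 2) * (-((n + 2) * p)) = -(2 * p) := by field_simp
    rw [this, Real.rpow_neg hq.le, Real.div_rpow hY0.le hX0.le, inv_div, div_mul_eq_mul_div,
      mul_div_assoc, ← Real.rpow_natCast, ← Real.rpow_sub hY0]
    congr 2; push_cast; ring
  rw [e1, e2] at h1
  refine h1.trans_eq ?_
  ring

theorem pderiv_absSq (u : 𝓓(whole n, ℂ)) (j : Fin n) (x : Rn n) :
    ‖pderiv j (absSq u) x‖ ≤ 2 * ‖u x‖ * ‖fderiv ℝ u x (EuclideanSpace.single j 1)‖ := by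
  have h1 : HasFDerivAt u (fderiv ℝ u x) x := (test_differentiable u x).hasFDerivAt
  have h2 := h1.norm_sq
  have h3 : pderiv j (absSq u) x = 2 * inner ℝ (u x) (fderiv ℝ u x (EuclideanSpace.single j 1)) := by
    unfold pderiv
    have : HasFDerivAt (absSq u) (2 • (innerSL ℝ (u x)).comp (fderiv ℝ u x)) x := h2
    rw [this.fderiv]; simp; ring
  rw [h3, norm_mul, mul_assoc, Real.norm_of_nonneg zero_le_two]
  gcongr
  exact norm_inner_le_norm _ _

theorem norm_sum_smul_le (a : Fin n → ℝ) (v : EuclideanSpace ℂ (Fin n)) :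
    ‖∑ j, a j • v j‖ ≤ √(∑ j, a j ^ 2) * ‖v‖ := by
  refine (norm_sum_le _ _).trans ?_
  simp_rw [norm_smul]
  refine (Real.sum_mul_le_sqrt_mul_sqrt _ _ _).trans ?_
  rw [EuclideanSpace.norm_eq]
  simp

theorem integrable_pderiv_smul {Γ : VectorField n} (hΓ : LocallyIntegrable Γ) (v : 𝓓(whole n, ℝ))
    (j : Fin n) : Integrable fun x => pderiv j v x • Γ x j := by
  have h1 : LocallyIntegrable fun x => Γ x j := by
    intro x
    obtain ⟨s, hs, h⟩ := hΓ x
    exact ⟨s, hs, (EuclideanSpace.proj j : EuclideanSpace ℂ (Fin n) →L[ℂ] ℂ).integrable_comp h⟩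
  exact h1.integrable_smul_left_of_hasCompactSupport
    (testPderiv j v).continuous (testPderiv j v).hasCompactSupport

theorem IsDivergence.apply_eq {Q : Distr n} {Γ : VectorField n} (hQ : IsDivergence Q Γ)
    (φ : 𝓓(whole n, ℝ)) : Q φ = -∫ x, ∑ j, pderiv j φ x • Γ x j := by
  rw [hQ.2, integral_finsetSum _ fun j _ => integrable_pderiv_smul hQ.1 φ j]
  rfl

/-- The pairing of `Γ` with `∇|u|²` when `Γ` satisfies a Morrey type condition up to scale `δ`. -/
theorem exists_pairing_bound (n : ℕ) {e : ℝ} (he : -2 < e) :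
    ∃ C : ℝ, 0 ≤ C ∧ ∀ (Γ : VectorField n) (A α δ : ℝ), 0 ≤ A → 0 < δ →
      AEStronglyMeasurable Γ volume →
      (∀ x r, 0 < r → r ≤ δ → ∫⁻ y in Metric.ball x r, ‖Γ y‖ₑ ^ 2 ≤
        ENNReal.ofReal (A * δ ^ (2 * α - e) * r ^ (n + e))) →
      ∀ u : 𝓓(whole n, ℂ), ‖∫ x, ∑ j, pderiv j (absSq u) x • Γ x j‖ ≤
        (1 + C * A) * (δ ^ (α + 1) * gradL2 u ^ 2 + δ ^ (α - 1 - n) * normL1 u ^ 2) := by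
  obtain ⟨C, hC0, hC⟩ := exists_trace_inequality_real n he
  refine ⟨C, hC0, fun Γ A α δ hA hδ hΓ hM u => ?_⟩
  set S := δ ^ (α + 1) * gradL2 u ^ 2 + δ ^ (α - 1 - n) * normL1 u ^ 2 with hS
  have hS0 : 0 ≤ S := by positivity
  obtain ⟨w, hw, hwe⟩ : ∃ w : Rn n → ℝ≥0∞, Measurable w ∧ (fun x => ‖Γ x‖ₑ ^ 2) =ᵐ[volume] w :=
    ⟨_, (hΓ.enorm.pow_const 2).measurable_mk, (hΓ.enorm.pow_const 2).ae_eq_mk⟩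
  -- The trace inequality for the measure |Γ|²dx, with A δ^{2α-e} as the growth constant; w is a
  -- measurable version of |Γ|².
  have htr := hC (volume.withDensity w) (A * δ ^ (2 * α - e)) δ (by positivity) hδ
    (fun x r hr hrδ => by
      rw [withDensity_apply _ measurableSet_ball]
      refine le_trans (le_of_eq ?_) (hM x r hr hrδ)
      exact (lintegral_congr_ae (ae_restrict_of_ae hwe)).symm) u
  have hum : Measurable fun x => ‖u x‖ₑ ^ 2 := (u.continuous.enorm.measurable).pow_const 2
  rw [lintegral_withDensity_eq_lintegral_mul _ hw hum] at htr
  have htr' : ∫⁻ x, ‖Γ x‖ₑ ^ 2 * ‖u x‖ₑ ^ 2 ≤ ENNReal.ofReal (δ ^ (α + 1) * (C * A * S)) := by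
    refine le_trans (le_of_eq ?_) (htr.trans (le_of_eq ?_))
    · refine lintegral_congr_ae ?_
      filter_upwards [hwe] with x hx
      rw [Pi.mul_apply, ← hx]
    · congr 1
      have e1 : δ ^ (2 * α - e) * δ ^ (e + 2) = δ ^ (α + 1) * δ ^ (α + 1) := by
        rw [← Real.rpow_add hδ, ← Real.rpow_add hδ]; ring_nf
      have e2 : δ ^ (2 * α - e) * δ ^ (e - n) = δ ^ (α + 1) * δ ^ (α - 1 - n) := by
        rw [← Real.rpow_add hδ, ← Real.rpow_add hδ]; ring_nf
      rw [hS]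
      linear_combination C * A * gradL2 u ^ 2 * e1 + C * A * normL1 u ^ 2 * e2
  set g : Rn n → ℝ := fun x => ∑ j : Fin n, ‖fderiv ℝ u x (EuclideanSpace.single j 1)‖ ^ 2 with hg
  have hg0 : ∀ x, 0 ≤ g x := fun x => Finset.sum_nonneg fun _ _ => sq_nonneg _
  have hgm : Measurable g := by
    have : Continuous g := by
      refine continuous_finsetSum _ fun j _ => ?_
      exact (((testPderiv j u).continuous).norm).pow 2
    exact this.measurable
  have hpt : ∀ x, ‖∑ j, pderiv j (absSq u) x • Γ x j‖ₑ ≤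
      ENNReal.ofReal (δ ^ (α + 1)) * ENNReal.ofReal (g x) +
        ENNReal.ofReal (δ ^ (-(α + 1))) * (‖Γ x‖ₑ ^ 2 * ‖u x‖ₑ ^ 2) := by
    intro x
    have h1 : ‖∑ j, pderiv j (absSq u) x • Γ x j‖ ≤ 2 * ‖u x‖ * √(g x) * ‖Γ x‖ := by
      refine (norm_sum_smul_le _ _).trans ?_
      gcongr
      rw [← Real.sqrt_sq (show (0 : ℝ) ≤ 2 * ‖u x‖ by positivity), ← Real.sqrt_mul (by positivity)]
      apply Real.sqrt_le_sqrt
      rw [hg, Finset.mul_sum]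
      refine Finset.sum_le_sum fun j _ => ?_
      rw [← mul_pow, ← sq_abs]
      gcongr
      exact pderiv_absSq u j x
    have hD : 0 < δ ^ (α + 1) := Real.rpow_pos_of_pos hδ _
    -- The weight δ^{α+1} in Young's inequality is the one wanted in front of ‖∇u‖₂². Its inverse
    -- cancels against the factor δ^{α+1} contained in `htr'`.
    have h2 : 2 * ‖u x‖ * √(g x) * ‖Γ x‖ ≤
        δ ^ (α + 1) * g x + δ ^ (-(α + 1)) * (‖Γ x‖ ^ 2 * ‖u x‖ ^ 2) := by
      rw [Real.rpow_neg hδ.le]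
      set D := δ ^ (α + 1)
      have h3 := sq_nonneg (D * √(g x) - ‖Γ x‖ * ‖u x‖)
      have h4 : √(g x) ^ 2 = g x := Real.sq_sqrt (hg0 x)
      have h5 : D * g x + D⁻¹ * (‖Γ x‖ ^ 2 * ‖u x‖ ^ 2) - 2 * ‖u x‖ * √(g x) * ‖Γ x‖ =
          D⁻¹ * (D * √(g x) - ‖Γ x‖ * ‖u x‖) ^ 2 := by
        nth_rewrite 1 [← h4]
        field_simp
        ring
      have h6 : 0 ≤ D⁻¹ * (D * √(g x) - ‖Γ x‖ * ‖u x‖) ^ 2 := by positivity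
      linarith
    rw [← ofReal_norm, ← ofReal_norm, ← ofReal_norm, ← ENNReal.ofReal_pow (norm_nonneg _),
      ← ENNReal.ofReal_pow (norm_nonneg _), ← ENNReal.ofReal_mul (by positivity),
      ← ENNReal.ofReal_mul (by positivity), ← ENNReal.ofReal_mul (by positivity),
      ← ENNReal.ofReal_add (mul_nonneg hD.le (hg0 x)) (by positivity)]
    exact ENNReal.ofReal_le_ofReal (h1.trans h2)
  have hfin : ‖∫ x, ∑ j, pderiv j (absSq u) x • Γ x j‖ₑ ≤ ENNReal.ofReal ((1 + C * A) * S) := by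
    refine (enorm_integral_le_lintegral_enorm _).trans ((lintegral_mono hpt).trans ?_)
    have hgm' : Measurable fun x => ENNReal.ofReal (δ ^ (α + 1)) * ENNReal.ofReal (g x) := by
      fun_prop
    rw [lintegral_add_left hgm', lintegral_const_mul' _ _ ENNReal.ofReal_ne_top,
      lintegral_const_mul' _ _ ENNReal.ofReal_ne_top, ← gradL2_sq]
    calc _ ≤ ENNReal.ofReal (δ ^ (α + 1)) * ENNReal.ofReal (gradL2 u ^ 2) +
          ENNReal.ofReal (δ ^ (-(α + 1))) * ENNReal.ofReal (δ ^ (α + 1) * (C * A * S)) := by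
          gcongr
      _ = ENNReal.ofReal (δ ^ (α + 1) * gradL2 u ^ 2 + C * A * S) := by
          rw [← ENNReal.ofReal_mul (by positivity), ← ENNReal.ofReal_mul (by positivity),
            ← ENNReal.ofReal_add (by positivity) (by positivity), ← mul_assoc (δ ^ (-(α + 1))),
            ← Real.rpow_add hδ]
          simp
      _ ≤ _ := by
          apply ENNReal.ofReal_le_ofReal
          have : 0 ≤ δ ^ (α - 1 - n) * normL1 u ^ 2 := by positivity
          rw [add_mul, one_mul, hS]
          linarith
  rw [← ofReal_norm] at hfin
  exact (ENNReal.ofReal_le_ofReal_iff (by positivity)).1 hfin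

/-- The trace inequality for Lebesgue measure, where e = 0. It serves bounded Q directly, and it
serves the smooth part of a splitting. -/
theorem exists_L2_bound (n : ℕ) :
    ∃ C : ℝ, 0 ≤ C ∧ ∀ (δ : ℝ), 0 < δ → ∀ u : 𝓓(whole n, ℂ), ∫ x, |absSq u x| ≤
        C * (δ ^ (2 : ℝ) * gradL2 u ^ 2 + δ ^ (-(n : ℝ)) * normL1 u ^ 2) := by
  obtain ⟨C, hC0, hC⟩ := exists_trace_inequality_real n (e := 0) (by norm_num)
  have hω := ballVol_pos n
  refine ⟨C * ballVol n, by positivity, fun δ hδ u => ?_⟩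
  have h := hC volume (ballVol n) δ hω.le hδ (fun x r hr _ => by
    rw [add_zero, Real.rpow_natCast, ← volume_real_ball x hr, Measure.real,
      ENNReal.ofReal_toReal measure_ball_lt_top.ne]) u
  have h1 : ∀ x, |absSq u x| = ‖u x‖ ^ 2 := fun x => by
    change |‖u x‖ ^ 2| = _
    rw [abs_of_nonneg (sq_nonneg _)]
  simp_rw [h1]
  have h2 : ENNReal.ofReal (∫ x, ‖u x‖ ^ 2) = ∫⁻ x, ‖u x‖ₑ ^ 2 := by
    rw [ofReal_integral_eq_lintegral_ofReal (test_memLp u).norm.integrable_sq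
      (Eventually.of_forall fun x => sq_nonneg _)]
    refine lintegral_congr fun x => ?_
    rw [ENNReal.ofReal_pow (norm_nonneg _), ofReal_norm]
  rw [← h2, zero_add, zero_sub] at h
  exact (ENNReal.ofReal_le_ofReal_iff (by positivity)).1 h

/-- A sufficient condition for the inequality: at every scale `δ` the field `Γ` splits into a part
with a Morrey type bound up to the scale `δ` and a part with bounded divergence. -/
theorem nashInequality_of_splitting {Q : Distr n} {Γ : VectorField n} {p e A B : ℝ}
    (hp0 : 0 < p) (hp1 : p < 1) (he : -2 < e) (hA : 0 ≤ A) (hB : 0 ≤ B) (hQ : IsDivergence Q Γ)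
    (h : ∀ δ : ℝ, 0 < δ → ∃ Γ₁ Γ₂ : VectorField n, (∀ x, Γ x = Γ₁ x + Γ₂ x) ∧
      LocallyIntegrable Γ₁ ∧ LocallyIntegrable Γ₂ ∧
      (∀ x r, 0 < r → r ≤ δ → ∫⁻ y in Metric.ball x r, ‖Γ₁ y‖ₑ ^ 2 ≤
        ENNReal.ofReal (A * δ ^ (2 * (n + 1 - p * (n + 2)) - e) * r ^ (n + e))) ∧
      ∀ v : 𝓓(whole n, ℝ), ‖∫ x, ∑ j, pderiv j v x • Γ₂ x j‖ ≤
        B * δ ^ ((n + 1 - p * (n + 2)) - 1) * ∫ x, |v x|) :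
    NashInequality Q p := by
  obtain ⟨C, hC0, hC⟩ := exists_pairing_bound n he
  obtain ⟨C', hC'0, hC'⟩ := exists_L2_bound n
  refine nashInequality_of_additive (C := (1 + C * A) + B * C') hp0 hp1
    fun u δ hδ => ?_
  obtain ⟨Γ₁, Γ₂, hsum, h1, h2, hM, hD⟩ := h δ hδ
  set α := (n : ℝ) + 1 - p * (n + 2) with hα
  have e1 : ((n : ℝ) + 2) * (1 - p) = α + 1 := by rw [hα]; ring
  have e2 : -(((n : ℝ) + 2) * p) = α - 1 - n := by rw [hα]; ring
  rw [e1, e2]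
  have hq : quadForm Q u = -((∫ x, ∑ j, pderiv j (absSq u) x • Γ₁ x j) +
      ∫ x, ∑ j, pderiv j (absSq u) x • Γ₂ x j) := by
    rw [quadForm, hQ.apply_eq, ← integral_add
      (integrable_finsetSum _ fun j _ => integrable_pderiv_smul h1 (absSq u) j)
      (integrable_finsetSum _ fun j _ => integrable_pderiv_smul h2 (absSq u) j)]
    congr 2; ext x
    rw [← Finset.sum_add_distrib]
    refine Finset.sum_congr rfl fun j _ => ?_
    rw [hsum x, PiLp.add_apply, smul_add]
  rw [hq, norm_neg]
  refine (norm_add_le _ _).trans ?_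
  rw [add_mul]
  -- The rough part goes through the trace inequality. For the smooth part a bound by ‖u‖₂² remains,
  -- and the δ² from `exists_L2_bound` raises δ^{α-1} to δ^{α+1}.
  refine add_le_add (hC Γ₁ A α δ hA hδ h1.aestronglyMeasurable hM u) ((hD (absSq u)).trans ?_)
  calc B * δ ^ (α - 1) * ∫ x, |absSq u x|
      ≤ B * δ ^ (α - 1) *
        (C' * (δ ^ (2 : ℝ) * gradL2 u ^ 2 + δ ^ (-(n : ℝ)) * normL1 u ^ 2)) := by
        gcongr
        exact hC' δ hδ u
    _ = _ := by
        have f1 : δ ^ (α + 1) = δ ^ (α - 1) * δ ^ (2 : ℝ) := by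
          rw [← Real.rpow_add hδ]; ring_nf
        have f2 : δ ^ (α - 1 - n) = δ ^ (α - 1) * δ ^ (-(n : ℝ)) := by
          rw [← Real.rpow_add hδ]; ring_nf
        rw [f1, f2]; ring

/-- Bounded functions satisfy the inequality with `p = n / (n + 2)`. -/
theorem IsBoundedFunction.nashInequality {Q : Distr n} (hn : 0 < n) (hQ : IsBoundedFunction Q) :
    NashInequality Q (n / (n + 2)) := by
  obtain ⟨f, hf, hQf⟩ := hQ
  obtain ⟨C, hC0, hC⟩ := exists_L2_bound n
  have hn' : (0 : ℝ) < n := by exact_mod_cast hn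
  set M := (eLpNorm f ∞ volume).toReal with hM
  have hfM : ∀ᵐ x, ‖f x‖ ≤ M := by
    have h1 := ae_le_eLpNormEssSup (f := f) (μ := volume)
    filter_upwards [h1] with x hx
    rw [hM, eLpNorm_exponent_top]
    have h2 : eLpNormEssSup f volume ≠ ∞ := by
      rw [← eLpNorm_exponent_top]; exact hf.eLpNorm_ne_top
    rw [← toReal_enorm]
    exact ENNReal.toReal_mono h2 hx
  refine nashInequality_of_additive (C := M * C) (by positivity)
    ((div_lt_one (by positivity)).2 (by linarith)) fun u δ hδ => ?_
  have e1 : ((n : ℝ) + 2) * (1 - n / (n + 2)) = 2 := by field_simp; ring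
  have e2 : -(((n : ℝ) + 2) * (n / (n + 2))) = -(n : ℝ) := by field_simp
  rw [e1, e2, quadForm, hQf, mul_assoc]
  calc ‖∫ x, absSq u x • f x‖ ≤ ∫ x, M * |absSq u x| := by
        refine norm_integral_le_of_norm_le ((test_integrable _).abs.const_mul M) ?_
        filter_upwards [hfM] with x hx
        rw [norm_smul, mul_comm, Real.norm_eq_abs]
        gcongr
    _ = M * ∫ x, |absSq u x| := integral_const_mul _ _
    _ ≤ _ := by gcongr; exact hC δ hδ u

end

end NashForm

namespace NashForm

/-! ### The John–Nirenberg inequality in `L²` -/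

section

variable {n : ℕ} {F : Type*} [NormedAddCommGroup F]

theorem _root_.MeasureTheory.LocallyIntegrable.integrableOn_of_isBounded {f : Rn n → F}
    (hf : LocallyIntegrable f) {s : Set (Rn n)} (hs : Bornology.IsBounded s) : IntegrableOn f s := by
  obtain ⟨r, hr⟩ := hs.subset_closedBall 0
  exact (hf.integrableOn_isCompact (isCompact_closedBall 0 r)).mono_set hr

theorem _root_.MeasureTheory.LocallyIntegrable.norm_fun {f : Rn n → F}
    (hf : LocallyIntegrable f) : LocallyIntegrable fun x => ‖f x‖ := fun x => by
  obtain ⟨s, hs, h⟩ := hf x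
  exact ⟨s, hs, h.norm⟩

variable [NormedSpace ℝ F]

theorem norm_setAverage_le {f : Rn n → F} (s : Set (Rn n)) :
    ‖⨍ x in s, f x‖ ≤ (volume.real s)⁻¹ * ∫ x in s, ‖f x‖ := by
  rw [setAverage_eq, norm_smul, norm_inv, Real.norm_of_nonneg measureReal_nonneg]
  gcongr
  exact norm_integral_le_integral_norm _

theorem setAverage_sub_const [CompleteSpace F] {f : Rn n → F} {s : Set (Rn n)}
    (hs0 : volume s ≠ 0) (hs : volume s ≠ ∞) (hf : IntegrableOn f s) (c : F) :
    ⨍ x in s, (f x - c) = (⨍ x in s, f x) - c := by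
  rw [setAverage_eq, setAverage_eq, integral_sub hf (integrableOn_const hs), smul_sub, setIntegral_const, smul_smul,
    inv_mul_cancel₀ (by simp [Measure.real, ENNReal.toReal_eq_zero_iff, hs0, hs]), one_smul]

/-- Up to a factor 2 the average is the best constant in L¹. Hence oscillations may be estimated
around any convenient constant, such as the average over a larger set. -/
theorem integral_norm_sub_average_le [CompleteSpace F] {f : Rn n → F} {s : Set (Rn n)}
    (hs0 : volume s ≠ 0) (hs : volume s ≠ ∞) (hf : IntegrableOn f s) (c : F) :
    ∫ x in s, ‖f x - ⨍ y in s, f y‖ ≤ 2 * ∫ x in s, ‖f x - c‖ := by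
  have hc : ∀ c : F, IntegrableOn (fun _ => c) s := fun c => integrableOn_const hs
  have hpos : 0 < volume.real s := ENNReal.toReal_pos hs0 hs
  have h1 := setAverage_sub_const hs0 hs hf c
  have h2 : ‖c - ⨍ y in s, f y‖ ≤ (volume.real s)⁻¹ * ∫ x in s, ‖f x - c‖ := by
    rw [norm_sub_rev, ← h1]; exact norm_setAverage_le s
  have h3 : IntegrableOn (fun x => ‖f x - c‖) s := (hf.sub (hc c)).norm
  calc ∫ x in s, ‖f x - ⨍ y in s, f y‖
      ≤ ∫ x in s, (‖f x - c‖ + ‖c - ⨍ y in s, f y‖) := by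
        refine integral_mono (hf.sub (hc _)).norm (h3.add (integrableOn_const hs)) fun x => ?_
        exact norm_sub_le_norm_sub_add_norm_sub _ _ _
    _ = (∫ x in s, ‖f x - c‖) + volume.real s * ‖c - ⨍ y in s, f y‖ := by
        rw [integral_add h3 (integrableOn_const hs), setIntegral_const, smul_eq_mul]
    _ ≤ (∫ x in s, ‖f x - c‖) + volume.real s * ((volume.real s)⁻¹ * ∫ x in s, ‖f x - c‖) := by
        gcongr
    _ = _ := by rw [mul_inv_cancel_left₀ hpos.ne']; ring

/-- The half open cube with lower corner `a` and side `s`. -/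
def cube (a : Rn n) (s : ℝ) : Set (Rn n) := {x | ∀ i, x i ∈ Set.Ico (a i) (a i + s)}

theorem measurableSet_cube (a : Rn n) (s : ℝ) : MeasurableSet (cube a s) := by
  have : cube a s = ⋂ i, (fun x : Rn n => x i) ⁻¹' Set.Ico (a i) (a i + s) := by
    ext x; simp [cube]
  rw [this]
  exact MeasurableSet.iInter fun i => measurableSet_Ico.preimage (by fun_prop)

theorem volume_cube (a : Rn n) {s : ℝ} (hs : 0 < s) : volume (cube a s) = ENNReal.ofReal (s ^ n) := by
  have h := (EuclideanSpace.volume_preserving_symm_measurableEquiv_toLp (Fin n)).measure_preimage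
    (s := Set.univ.pi fun i => Set.Ico (a i) (a i + s))
    (MeasurableSet.univ_pi fun i => measurableSet_Ico).nullMeasurableSet
  rw [Real.volume_pi_Ico] at h
  have h2 : (⇑(MeasurableEquiv.toLp 2 (Fin n → ℝ)).symm ⁻¹'
      Set.univ.pi fun i => Set.Ico (a i) (a i + s)) = cube a s := by
    ext x; simp [cube]
  rw [h2] at h
  rw [h]
  simp [ENNReal.ofReal_pow hs.le]

theorem volume_real_cube (a : Rn n) {s : ℝ} (hs : 0 < s) : volume.real (cube a s) = s ^ n := by
  rw [Measure.real, volume_cube a hs, ENNReal.toReal_ofReal (by positivity)]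

theorem norm_sub_le_of_mem_cube {a x y : Rn n} {s : ℝ} (hx : x ∈ cube a s) (hy : y ∈ cube a s) :
    ‖x - y‖ ≤ n * s := by
  have h1 : ∀ i, ‖(x - y) i‖ ≤ s := fun i => by
    have h2 := hx i; have h3 := hy i
    simp only [Set.mem_Ico] at h2 h3
    rw [PiLp.sub_apply, Real.norm_eq_abs, abs_le]
    constructor <;> linarith
  rcases Nat.eq_zero_or_pos n with rfl | hn
  · rw [Subsingleton.elim x y]; simp
  have hs : 0 ≤ s := (norm_nonneg _).trans (h1 ⟨0, hn⟩)
  rw [EuclideanSpace.norm_eq]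
  refine Real.sqrt_le_iff.2 ⟨by positivity, ?_⟩
  calc ∑ i, ‖(x - y) i‖ ^ 2 ≤ ∑ i : Fin n, s ^ 2 := by
        refine Finset.sum_le_sum fun i _ => ?_
        have := h1 i
        gcongr
    _ = n * s ^ 2 := by simp
    _ ≤ n ^ 2 * s ^ 2 := by
        gcongr
        exact_mod_cast Nat.le_self_pow two_ne_zero n
    _ = _ := by ring

theorem corner_mem_cube (a : Rn n) {s : ℝ} (hs : 0 < s) : a ∈ cube a s := fun i => by simp [hs]

theorem isBounded_cube (a : Rn n) (s : ℝ) : Bornology.IsBounded (cube a s) := by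
  refine Metric.isBounded_closedBall.subset (t := Metric.closedBall a (n * s)) fun x hx => ?_
  rcases lt_or_ge 0 s with hs | hs
  · exact mem_closedBall_iff_norm.2 (norm_sub_le_of_mem_cube hx (corner_mem_cube a hs))
  · rcases Nat.eq_zero_or_pos n with rfl | hn
    · rw [Subsingleton.elim x a]; simp
    · have := hx ⟨0, hn⟩
      simp only [Set.mem_Ico] at this
      linarith

/-- The lower corners of the children of a cube. -/
noncomputable def childCorner (a : Rn n) (s : ℝ) (ε : Fin n → Bool) : Rn n :=
  WithLp.toLp 2 fun i => a i + if ε i then s / 2 else 0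

theorem pairwise_disjoint_children (a : Rn n) (s : ℝ) :
    Pairwise (Function.onFun Disjoint fun ε => cube (childCorner a s ε) (s / 2)) := by
  intro ε ε' h
  rw [Function.onFun, Set.disjoint_left]
  intro x hx hx'
  refine h (funext fun i => ?_)
  have h1 := hx i; have h2 := hx' i
  simp only [childCorner, Set.mem_Ico] at h1 h2
  cases hi : ε i <;> cases hi' : ε' i <;> simp [hi, hi'] at h1 h2 ⊢ <;> linarith

theorem iUnion_children (a : Rn n) {s : ℝ} (hs : 0 < s) :
    ⋃ ε, cube (childCorner a s ε) (s / 2) = cube a s := by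
  ext x
  simp only [Set.mem_iUnion]
  constructor
  · rintro ⟨ε, hx⟩ i
    have h1 := hx i
    simp only [childCorner, Set.mem_Ico] at h1 ⊢
    cases hi : ε i <;> simp [hi] at h1 <;> constructor <;> linarith
  · intro hx
    classical
    refine ⟨fun i => decide (a i + s / 2 ≤ x i), fun i => ?_⟩
    have h1 := hx i
    simp only [childCorner, Set.mem_Ico, decide_eq_true_eq] at h1 ⊢
    split_ifs with h <;> constructor <;> linarith

theorem integral_cube_eq_sum_children {f : Rn n → F} (hf : LocallyIntegrable f) (a : Rn n) {s : ℝ}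
    (hs : 0 < s) :
    ∫ x in cube a s, f x = ∑ ε, ∫ x in cube (childCorner a s ε) (s / 2), f x := by
  rw [← iUnion_children a hs]
  exact integral_iUnion_fintype (fun ε => measurableSet_cube _ _) (pairwise_disjoint_children a s)
    fun ε => hf.integrableOn_of_isBounded (isBounded_cube _ _)

theorem integral_child_le {G : Type*} [NormedAddCommGroup G] {f : Rn n → G} (hf : LocallyIntegrable f) (a : Rn n) {s : ℝ}
    (hs : 0 < s) (ε : Fin n → Bool) :
    ∫ x in cube (childCorner a s ε) (s / 2), ‖f x‖ ≤ ∫ x in cube a s, ‖f x‖ := by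
  rw [integral_cube_eq_sum_children hf.norm_fun a hs]
  exact Finset.single_le_sum (f := fun ε => ∫ x in cube (childCorner a s ε) (s / 2), ‖f x‖)
    (fun i _ => integral_nonneg fun x => norm_nonneg _) (Finset.mem_univ ε)

/-- The sum over the subcubes of generation `m` of the volume times the squared norm of the
average. -/
noncomputable def dyadicEnergy (f : Rn n → F) : ℕ → Rn n → ℝ → ℝ
  | 0, a, s => s ^ n * ‖⨍ x in cube a s, f x‖ ^ 2
  | m + 1, a, s => ∑ ε, dyadicEnergy f m (childCorner a s ε) (s / 2)

/-- The average of `f` over the subcubes of generation `m`. -/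
noncomputable def dyadicAverage (f : Rn n → F) : ℕ → Rn n → ℝ → Rn n → F
  | 0, a, s => (cube a s).indicator fun _ => ⨍ x in cube a s, f x
  | m + 1, a, s => fun x => ∑ ε, dyadicAverage f m (childCorner a s ε) (s / 2) x

theorem sum_children_volume (s : ℝ) : ∑ _ε : Fin n → Bool, (s / 2) ^ n = s ^ n := by
  simp only [Finset.sum_const, Finset.card_univ, Fintype.card_fun, Fintype.card_bool,
    Fintype.card_fin, nsmul_eq_mul]
  rw [div_pow]; push_cast; field_simp

theorem volume_cube_ne_zero (a : Rn n) {s : ℝ} (hs : 0 < s) : volume (cube a s) ≠ 0 := by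
  rw [volume_cube a hs]; simpa using pow_pos hs n

theorem volume_cube_ne_top (a : Rn n) {s : ℝ} (hs : 0 < s) : volume (cube a s) ≠ ∞ := by
  rw [volume_cube a hs]; exact ENNReal.ofReal_ne_top

theorem dyadicEnergy_nonneg (f : Rn n → F) (m : ℕ) :
    ∀ (a : Rn n) {s : ℝ}, 0 < s → 0 ≤ dyadicEnergy f m a s := by
  induction m with
  | zero => intro a s hs; simp only [dyadicEnergy]; positivity
  | succ m ih => intro a s hs; exact Finset.sum_nonneg fun ε _ => ih _ (by positivity)

/-- On each subcube |A|² ≤ 2|c|² + 2|A-c|² for the average A. This restarts the estimate inside a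
stopping cube, with c its average. -/
theorem dyadicEnergy_le_sub_const [CompleteSpace F] {f : Rn n → F} (hf : LocallyIntegrable f)
    (c : F) (m : ℕ) : ∀ (a : Rn n) (s : ℝ), 0 < s → dyadicEnergy f m a s ≤
      2 * ‖c‖ ^ 2 * s ^ n + 2 * dyadicEnergy (fun x => f x - c) m a s := by
  induction m with
  | zero =>
    intro a s hs
    simp only [dyadicEnergy]
    rw [setAverage_sub_const (volume_cube_ne_zero a hs) (volume_cube_ne_top a hs)
      (hf.integrableOn_of_isBounded (isBounded_cube _ _))]
    set A := ⨍ x in cube a s, f x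
    have h1 : ‖A‖ ≤ ‖c‖ + ‖A - c‖ := by
      have := norm_add_le c (A - c); simpa using this
    have h2 : ‖A‖ ^ 2 ≤ 2 * ‖c‖ ^ 2 + 2 * ‖A - c‖ ^ 2 := by
      nlinarith [norm_nonneg A, sq_nonneg (‖c‖ - ‖A - c‖)]
    have := mul_le_mul_of_nonneg_left h2 (pow_nonneg hs.le n)
    linarith
  | succ m ih =>
    intro a s hs
    simp only [dyadicEnergy]
    calc _ ≤ ∑ ε : Fin n → Bool, (2 * ‖c‖ ^ 2 * (s / 2) ^ n +
          2 * dyadicEnergy (fun x => f x - c) m (childCorner a s ε) (s / 2)) :=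
          Finset.sum_le_sum fun ε _ => ih _ _ (by positivity)
      _ = _ := by
          rw [Finset.sum_add_distrib, ← Finset.mul_sum, ← Finset.mul_sum, sum_children_volume]

/-- The stopping time argument. -/
theorem dyadicEnergy_stopping [CompleteSpace F] {f : Rn n → F} (hf : LocallyIntegrable f)
    {L S : ℝ} (hL : 0 < L) (hS : 0 ≤ S) {m : ℕ}
    (hW : ∀ k < m, ∀ (a : Rn n) (s : ℝ), 0 < s →
      dyadicEnergy (fun x => f x - ⨍ y in cube a s, f y) k a s ≤ S * s ^ n) (k : ℕ) :
    k < m → ∀ (a : Rn n) (s : ℝ), 0 < s → ∫ x in cube a s, ‖f x‖ ≤ 2 ^ n * L * s ^ n →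
      dyadicEnergy f k a s ≤ L ^ 2 * s ^ n +
        (2 * (2 ^ n * L) ^ 2 + 2 * S) / L * ∫ x in cube a s, ‖f x‖ := by
  -- A stopping cube: the mean of |f| exceeds L but is at most 2ⁿL. Subtracting the average leaves
  -- an energy controlled by S, and since the volume is less than L⁻¹∫|f|, the whole cost can be
  -- charged to ∫|f|.
  have hterm : ∀ k < m, ∀ (a : Rn n) (s : ℝ), 0 < s → ∫ x in cube a s, ‖f x‖ ≤ 2 ^ n * L * s ^ n →
      L * s ^ n < ∫ x in cube a s, ‖f x‖ → dyadicEnergy f k a s ≤ L ^ 2 * s ^ n +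
        (2 * (2 ^ n * L) ^ 2 + 2 * S) / L * ∫ x in cube a s, ‖f x‖ := by
    intro k hk a s hs hfa h
    have hsn : 0 < s ^ n := by positivity
    have h1 : ‖⨍ x in cube a s, f x‖ ≤ (s ^ n)⁻¹ * ∫ x in cube a s, ‖f x‖ := by
      rw [← volume_real_cube a hs]; exact norm_setAverage_le _
    have h2 : ‖⨍ x in cube a s, f x‖ ≤ 2 ^ n * L := h1.trans (by
      rw [inv_mul_le_iff₀ hsn]; linarith)
    have h3 := dyadicEnergy_le_sub_const hf (⨍ x in cube a s, f x) k a s hs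
    have h4 := hW k hk a s hs
    have h5 : (2 * (2 ^ n * L) ^ 2 + 2 * S) / L * (L * s ^ n) ≤
      (2 * (2 ^ n * L) ^ 2 + 2 * S) / L * ∫ x in cube a s, ‖f x‖ := by gcongr
    have h6 : (2 * (2 ^ n * L) ^ 2 + 2 * S) / L * (L * s ^ n) =
      2 * (2 ^ n * L) ^ 2 * s ^ n + 2 * S * s ^ n := by field_simp
    have h7 : 2 * ‖⨍ x in cube a s, f x‖ ^ 2 * s ^ n ≤ 2 * (2 ^ n * L) ^ 2 * s ^ n := by gcongr
    have h8 : 0 ≤ L ^ 2 * s ^ n := by positivity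
    linarith
  induction k with
  | zero =>
    intro hk a s hs hfa
    have hsn : 0 < s ^ n := by positivity
    have hint : 0 ≤ ∫ x in cube a s, ‖f x‖ := integral_nonneg fun x => norm_nonneg _
    rcases le_or_gt (∫ x in cube a s, ‖f x‖) (L * s ^ n) with h | h
    · have h1 : ‖⨍ x in cube a s, f x‖ ≤ (s ^ n)⁻¹ * ∫ x in cube a s, ‖f x‖ := by
        rw [← volume_real_cube a hs]; exact norm_setAverage_le _
      have h2 : ‖⨍ x in cube a s, f x‖ ≤ L := h1.trans (by
        rw [inv_mul_le_iff₀ hsn]; linarith)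
      have h3 : 0 ≤ (2 * (2 ^ n * L) ^ 2 + 2 * S) / L * ∫ x in cube a s, ‖f x‖ := by positivity
      have h4 : s ^ n * ‖⨍ x in cube a s, f x‖ ^ 2 ≤ s ^ n * L ^ 2 := by gcongr
      simp only [dyadicEnergy]
      linarith
    · exact hterm 0 hk a s hs hfa h
  | succ k ih =>
    intro hk a s hs hfa
    rcases le_or_gt (∫ x in cube a s, ‖f x‖) (L * s ^ n) with h | h
    -- No stopping yet: each child has 2^{-n} of the volume, so its mean of |f| is at most 2ⁿL and
    -- the induction hypothesis applies to it.
    · have hsum := integral_cube_eq_sum_children hf.norm_fun a hs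
      simp only [dyadicEnergy]
      calc _ ≤ ∑ ε : Fin n → Bool, (L ^ 2 * (s / 2) ^ n + (2 * (2 ^ n * L) ^ 2 + 2 * S) / L *
            ∫ x in cube (childCorner a s ε) (s / 2), ‖f x‖) := by
            refine Finset.sum_le_sum fun ε _ => ih (by lia) _ _ (by positivity) ?_
            refine (integral_child_le hf a hs ε).trans (h.trans_eq ?_)
            rw [div_pow]; field_simp
        _ = _ := by
            rw [Finset.sum_add_distrib, ← Finset.mul_sum, ← Finset.mul_sum, sum_children_volume,
              ← hsum]
    · exact hterm (k + 1) hk a s hs hfa h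

/-- Strong induction on the number of generations: inside the stopping cubes fewer generations
remain, so the bound to be proved is available there. The constant is independent of m because it
returns with the factor 1/2. -/
theorem dyadicEnergy_bound [CompleteSpace F] {f : Rn n → F} (hf : LocallyIntegrable f)
    {K : ℝ} (hK : 0 < K) (h : ∀ (a : Rn n) (s : ℝ), 0 < s →
      ∫ x in cube a s, ‖f x - ⨍ y in cube a s, f y‖ ≤ K * s ^ n) (m : ℕ) :
    ∀ (a : Rn n) (s : ℝ), 0 < s → dyadicEnergy (fun x => f x - ⨍ y in cube a s, f y) m a s ≤
      (2 * (16 + 8 * 4 ^ n) * K ^ 2) * s ^ n := by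
  set S := 2 * (16 + 8 * 4 ^ n) * K ^ 2 with hS
  have hS0 : 0 ≤ S := by positivity
  induction m using Nat.strong_induction_on with
  | _ m ih =>
    intro a s hs
    set c := ⨍ y in cube a s, f y with hc
    have hsn : 0 < s ^ n := by positivity
    have hg : LocallyIntegrable (fun x => f x - c) := hf.sub (locallyIntegrable_const c)
    cases m with
    | zero =>
      simp only [dyadicEnergy]
      rw [setAverage_sub_const (volume_cube_ne_zero a hs) (volume_cube_ne_top a hs)
        (hf.integrableOn_of_isBounded (isBounded_cube _ _)), ← hc, sub_self, norm_zero]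
      simp only [ne_eq, OfNat.ofNat_ne_zero, not_false_eq_true, zero_pow, mul_zero]
      positivity
    | succ k =>
      simp only [dyadicEnergy]
      have hW : ∀ k' < k + 1, ∀ (a : Rn n) (s : ℝ), 0 < s →
          dyadicEnergy (fun x => (f x - c) - ⨍ y in cube a s, (f y - c)) k' a s ≤ S * s ^ n := by
        intro k' hk' b t ht
        have := ih k' hk' b t ht
        rw [setAverage_sub_const (volume_cube_ne_zero b ht) (volume_cube_ne_top b ht)
          (hf.integrableOn_of_isBounded (isBounded_cube _ _))]
        simpa only [sub_sub_sub_cancel_right] using this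
      -- With L = 4K the bound S comes back as (2S/4K)·K = S/2. The value of S solves S = 16K² +
      -- 8·4ⁿK² + S/2.
      have hterm := dyadicEnergy_stopping hg (L := 4 * K) (S := S) (by positivity) hS0 hW k (by lia)
      have hQ := h a s hs
      have hsum := integral_cube_eq_sum_children hg.norm_fun a hs
      calc ∑ ε, dyadicEnergy (fun x => f x - c) k (childCorner a s ε) (s / 2)
          ≤ ∑ ε : Fin n → Bool, ((4 * K) ^ 2 * (s / 2) ^ n +
            (2 * (2 ^ n * (4 * K)) ^ 2 + 2 * S) / (4 * K) *
            ∫ x in cube (childCorner a s ε) (s / 2), ‖f x - c‖) := by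
            refine Finset.sum_le_sum fun ε _ => hterm _ _ (by positivity) ?_
            refine (integral_child_le hg a hs ε).trans (hQ.trans ?_)
            have : 2 ^ n * (4 * K) * (s / 2) ^ n = 4 * (K * s ^ n) := by
              rw [div_pow]; field_simp
            rw [this]
            have : 0 ≤ K * s ^ n := by positivity
            linarith
        _ = (4 * K) ^ 2 * s ^ n + (2 * (2 ^ n * (4 * K)) ^ 2 + 2 * S) / (4 * K) *
            ∫ x in cube a s, ‖f x - c‖ := by
            rw [Finset.sum_add_distrib, ← Finset.mul_sum, ← Finset.mul_sum, sum_children_volume,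
              ← hsum]
        _ ≤ (4 * K) ^ 2 * s ^ n + (2 * (2 ^ n * (4 * K)) ^ 2 + 2 * S) / (4 * K) * (K * s ^ n) := by
            gcongr
        _ = S * s ^ n := by
            have : ((2 : ℝ) ^ n) ^ 2 = 4 ^ n := by rw [← pow_mul, mul_comm, pow_mul]; norm_num
            rw [mul_pow (2 ^ n), this, hS]
            field_simp
            ring

theorem dyadicAverage_eq_zero (f : Rn n → F) (m : ℕ) : ∀ (a : Rn n) (s : ℝ), 0 < s →
    ∀ x ∉ cube a s, dyadicAverage f m a s x = 0 := by
  induction m with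
  | zero => intro a s _ x hx; exact Set.indicator_of_notMem hx _
  | succ m ih =>
    intro a s hs x hx
    refine Finset.sum_eq_zero fun ε _ => ih _ _ (by positivity) x fun h => hx ?_
    rw [← iUnion_children a hs]
    exact Set.mem_iUnion.2 ⟨ε, h⟩

theorem dyadicAverage_succ_eq (f : Rn n → F) (m : ℕ) (a : Rn n) {s : ℝ} (hs : 0 < s)
    {ε : Fin n → Bool} {x : Rn n} (hx : x ∈ cube (childCorner a s ε) (s / 2)) :
    dyadicAverage f (m + 1) a s x = dyadicAverage f m (childCorner a s ε) (s / 2) x := by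
  simp only [dyadicAverage]
  refine Finset.sum_eq_single ε (fun ε' _ h => ?_) (by simp)
  refine dyadicAverage_eq_zero f m _ _ (by positivity) x fun h' => ?_
  exact Set.disjoint_left.1 (pairwise_disjoint_children a s h) h' hx

theorem exists_dyadicAverage_eq (f : Rn n → F) (m : ℕ) : ∀ (a : Rn n) (s : ℝ), 0 < s →
    ∀ x ∈ cube a s, ∃ b, x ∈ cube b (s / 2 ^ m) ∧
      dyadicAverage f m a s x = ⨍ y in cube b (s / 2 ^ m), f y := by
  induction m with
  | zero => intro a s _ x hx; exact ⟨a, by simpa using hx, by simp [dyadicAverage, hx]⟩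
  | succ m ih =>
    intro a s hs x hx
    rw [← iUnion_children a hs] at hx
    obtain ⟨ε, hε⟩ := Set.mem_iUnion.1 hx
    obtain ⟨b, hb1, hb2⟩ := ih _ _ (by positivity) x hε
    have e : s / 2 / 2 ^ m = s / 2 ^ (m + 1) := by rw [pow_succ]; field_simp
    rw [e] at hb1 hb2
    exact ⟨b, hb1, by rw [dyadicAverage_succ_eq f m a hs hε, hb2]⟩

theorem measurable_enorm_dyadicAverage (f : Rn n → F) (m : ℕ) : ∀ (a : Rn n) (s : ℝ),
    StronglyMeasurable (dyadicAverage f m a s) := by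
  induction m with
  | zero => intro a s; exact stronglyMeasurable_const.indicator (measurableSet_cube a s)
  | succ m ih =>
    intro a s
    exact Finset.stronglyMeasurable_fun_sum _ fun ε _ => ih _ _

theorem lintegral_dyadicAverage (f : Rn n → F) (m : ℕ) : ∀ (a : Rn n) (s : ℝ), 0 < s →
    ∫⁻ x in cube a s, ‖dyadicAverage f m a s x‖ₑ ^ 2 = ENNReal.ofReal (dyadicEnergy f m a s) := by
  induction m with
  | zero =>
    intro a s hs
    have h1 : ∫⁻ x in cube a s, ‖dyadicAverage f 0 a s x‖ₑ ^ 2 =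
        ∫⁻ x in cube a s, ‖⨍ y in cube a s, f y‖ₑ ^ 2 :=
      setLIntegral_congr_fun (measurableSet_cube a s) fun x hx => by simp [dyadicAverage, hx]
    rw [h1, setLIntegral_const, volume_cube a hs, dyadicEnergy, mul_comm,
      ENNReal.ofReal_mul (by positivity), ENNReal.ofReal_pow (norm_nonneg _), ofReal_norm]
  | succ m ih =>
    intro a s hs
    rw [← iUnion_children a hs, lintegral_iUnion (fun ε => measurableSet_cube _ _)
      (pairwise_disjoint_children a s), tsum_fintype, dyadicEnergy,
      ENNReal.ofReal_sum_of_nonneg fun ε _ => dyadicEnergy_nonneg f _ _ (by positivity)]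
    refine Finset.sum_congr rfl fun ε _ => ?_
    rw [← ih _ _ (by positivity)]
    exact setLIntegral_congr_fun (measurableSet_cube _ _) fun x hx => by
      simp only [dyadicAverage_succ_eq f m a hs hx]

/-- Lebesgue differentiation. A cube of side t containing x lies in the ball of radius (n+1)t around
x and has comparable volume, so its average converges although x need not be its centre. -/
theorem ae_tendsto_dyadicAverage [CompleteSpace F] {f : Rn n → F} (hf : LocallyIntegrable f)
    (a : Rn n) {s : ℝ} (hs : 0 < s) : ∀ᵐ x, x ∈ cube a s →
      Tendsto (fun m => dyadicAverage f m a s x) atTop (𝓝 (f x)) := by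
  have hL := IsUnifLocDoublingMeasure.ae_tendsto_average_norm_sub (volume : Measure (Rn n)) hf 1
  filter_upwards [hL] with x hx hxa
  have hpos : ∀ m : ℕ, 0 < s / 2 ^ m := fun m => by positivity
  have hδ : Tendsto (fun m : ℕ => (n + 1 : ℝ) * (s / 2 ^ m)) atTop (𝓝[>] 0) := by
    refine tendsto_nhdsWithin_iff.2 ⟨?_, Eventually.of_forall fun m => by
      have := hpos m; simp only [Set.mem_Ioi]; positivity⟩
    have h1 : Tendsto (fun m : ℕ => (n + 1 : ℝ) * s * (1 / 2) ^ m) atTop (𝓝 ((n + 1 : ℝ) * s * 0)) :=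
      (tendsto_pow_atTop_nhds_zero_of_lt_one (by norm_num) (by norm_num)).const_mul _
    rw [mul_zero] at h1
    refine h1.congr fun m => ?_
    rw [div_pow, one_pow]; ring
  have h2 := hx (fun _ : ℕ => x) _ hδ (Eventually.of_forall fun m => by
    refine Metric.mem_closedBall_self ?_
    have := hpos m; positivity)
  have h3 := h2.const_mul (ballVol n * (n + 1) ^ n)
  rw [mul_zero] at h3
  rw [tendsto_iff_norm_sub_tendsto_zero]
  refine squeeze_zero (fun m => norm_nonneg _) (fun m => ?_) h3
  obtain ⟨b, hb1, hb2⟩ := exists_dyadicAverage_eq f m a s hs x hxa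
  have hm := hpos m
  set t := s / 2 ^ m
  have hball : cube b t ⊆ Metric.closedBall x ((n + 1) * t) := fun y hy => by
    rw [mem_closedBall_iff_norm]
    have := norm_sub_le_of_mem_cube hy hb1
    linarith
  rw [hb2, ← setAverage_sub_const (volume_cube_ne_zero b hm) (volume_cube_ne_top b hm)
    (hf.integrableOn_of_isBounded (isBounded_cube _ _)), setAverage_eq, setAverage_eq,
    norm_smul, norm_inv, volume_real_cube b hm, volume_real_closedBall x (by positivity),
    Real.norm_of_nonneg (by positivity), smul_eq_mul]
  have h4 : ballVol n * (n + 1) ^ n * ((ballVol n * ((n + 1) * t) ^ n)⁻¹ *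
      ∫ y in Metric.closedBall x ((n + 1) * t), ‖f y - f x‖) =
      (t ^ n)⁻¹ * ∫ y in Metric.closedBall x ((n + 1) * t), ‖f y - f x‖ := by
    have := ballVol_pos n
    rw [mul_pow]; field_simp
  rw [h4]
  gcongr
  refine (norm_integral_le_integral_norm _).trans (setIntegral_mono_set ?_ ?_ hball.eventuallyLE)
  · exact ((hf.sub (locallyIntegrable_const (f x))).norm_fun).integrableOn_of_isBounded
      Metric.isBounded_closedBall
  · exact Eventually.of_forall fun y => norm_nonneg _

/-- Fatou's lemma: the dyadic averages converge almost everywhere, and their square integrals are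
the energies, bounded uniformly in the generation. -/
theorem lintegral_cube_sq_le [CompleteSpace F] {f : Rn n → F} (hf : LocallyIntegrable f)
    {K : ℝ} (hK : 0 < K) (h : ∀ (a : Rn n) (s : ℝ), 0 < s →
      ∫ x in cube a s, ‖f x - ⨍ y in cube a s, f y‖ ≤ K * s ^ n) (a : Rn n) {s : ℝ} (hs : 0 < s) :
    ∫⁻ x in cube a s, ‖f x - ⨍ y in cube a s, f y‖ₑ ^ 2 ≤
      ENNReal.ofReal ((2 * (16 + 8 * 4 ^ n) * K ^ 2) * s ^ n) := by
  set g : Rn n → F := fun x => f x - ⨍ y in cube a s, f y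
  have hg : LocallyIntegrable g := hf.sub (locallyIntegrable_const _)
  have hlim := ae_tendsto_dyadicAverage hg a hs
  calc ∫⁻ x in cube a s, ‖g x‖ₑ ^ 2
      = ∫⁻ x in cube a s, liminf (fun m => ‖dyadicAverage g m a s x‖ₑ ^ 2) atTop := by
        refine lintegral_congr_ae ?_
        filter_upwards [(ae_restrict_iff' (measurableSet_cube a s)).2 hlim] with x hx
        exact (((((ENNReal.continuous_pow 2).comp continuous_enorm).tendsto _).comp hx).liminf_eq).symm
    _ ≤ liminf (fun m => ∫⁻ x in cube a s, ‖dyadicAverage g m a s x‖ₑ ^ 2) atTop :=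
        lintegral_liminf_le fun m => (measurable_enorm_dyadicAverage g m a s).enorm.pow_const 2
    _ ≤ _ := by
        refine liminf_le_of_frequently_le' (Frequently.of_forall fun m => ?_)
        rw [lintegral_dyadicAverage g m a s hs]
        exact ENNReal.ofReal_le_ofReal (dyadicEnergy_bound hf hK h m a s hs)

/-- Functions of bounded mean oscillation have bounded mean square oscillation. -/
theorem exists_sq_oscillation_bound [CompleteSpace F] {f : Rn n → F} (hf : LocallyIntegrable f)
    {C : ℝ} (hC : ∀ (x : Rn n) (δ : ℝ), 0 < δ →
      ⨍ y in Metric.ball x δ, ‖f y - ⨍ z in Metric.ball x δ, f z‖ ≤ C) :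
    ∃ C' : ℝ, 0 ≤ C' ∧ ∀ (x : Rn n) (r : ℝ), 0 < r → ∃ c : F,
      ∫⁻ y in Metric.ball x r, ‖f y - c‖ₑ ^ 2 ≤ ENNReal.ofReal (C' * r ^ n) := by
  have hω := ballVol_pos n
  -- A cube of side s lies in a ball of radius (n+1)s, which explains the volume factor; the 2 is
  -- the price of replacing the average over the ball by that over the cube. Adding 1 to |C| makes K
  -- positive.
  set K := 2 * (|C| + 1) * (ballVol n * (n + 1) ^ n) with hK
  have hK0 : 0 < K := by positivity
  have hcube : ∀ (a : Rn n) (s : ℝ), 0 < s →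
      ∫ x in cube a s, ‖f x - ⨍ y in cube a s, f y‖ ≤ K * s ^ n := by
    intro a s hs
    have hr : 0 < (n + 1) * s := by positivity
    have hsub : cube a s ⊆ Metric.ball a ((n + 1) * s) := fun y hy => by
      rw [mem_ball_iff_norm]
      have := norm_sub_le_of_mem_cube hy (corner_mem_cube a hs)
      linarith
    refine (integral_norm_sub_average_le (volume_cube_ne_zero a hs) (volume_cube_ne_top a hs)
      (hf.integrableOn_of_isBounded (isBounded_cube _ _))
      (⨍ z in Metric.ball a ((n + 1) * s), f z)).trans ?_
    have h1 := hC a _ hr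
    rw [setAverage_eq, volume_real_ball a hr, smul_eq_mul, inv_mul_le_iff₀ (by positivity)] at h1
    calc 2 * ∫ x in cube a s, ‖f x - ⨍ z in Metric.ball a ((n + 1) * s), f z‖
        ≤ 2 * ∫ x in Metric.ball a ((n + 1) * s), ‖f x - ⨍ z in Metric.ball a ((n + 1) * s), f z‖ := by
          gcongr 2 * ?_
          refine setIntegral_mono_set ?_ (Eventually.of_forall fun y => norm_nonneg _)
            hsub.eventuallyLE
          exact ((hf.sub (locallyIntegrable_const _)).norm_fun).integrableOn_of_isBounded
            Metric.isBounded_ball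
      _ ≤ 2 * (ballVol n * ((n + 1) * s) ^ n * (|C| + 1)) := by
          refine mul_le_mul_of_nonneg_left (h1.trans ?_) zero_le_two
          gcongr
          exact (le_abs_self C).trans (by linarith)
      _ = _ := by rw [hK, mul_pow]; ring
  refine ⟨(2 * (16 + 8 * 4 ^ n) * K ^ 2) * 2 ^ n, by positivity, fun x r hr => ?_⟩
  set a : Rn n := WithLp.toLp 2 fun i => x i - r with ha
  have hsub : Metric.ball x r ⊆ cube a (2 * r) := fun y hy i => by
    rw [mem_ball_iff_norm] at hy
    have h1 := (PiLp.norm_apply_le (y - x) i).trans_lt hy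
    rw [PiLp.sub_apply, Real.norm_eq_abs, abs_lt] at h1
    simp only [ha, Set.mem_Ico]
    constructor <;> linarith
  refine ⟨_, (lintegral_mono_set hsub).trans
    ((lintegral_cube_sq_le hf hK0 hcube a (by positivity)).trans_eq ?_)⟩
  rw [mul_pow]; ring_nf

end

end NashForm

namespace NashForm

/-! ### Mollification -/

section

variable {n : ℕ} {F : Type*} [NormedAddCommGroup F] [NormedSpace ℝ F]

theorem exists_pderiv_cutoffAt_bound (n : ℕ) : ∃ M : ℝ, 0 ≤ M ∧ ∀ (x₀ : Rn n) (R : ℝ), 0 < R →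
    ∀ j x, |pderiv j (cutoffAt x₀ R) x| ≤ M * R⁻¹ := by
  obtain ⟨M, hM0, hM⟩ := exists_pderiv_bound (stdCutoff n)
  refine ⟨M, hM0, fun x₀ R hR j x => ?_⟩
  rw [cutoffAt, pderiv_rescale _ _ hR, smul_eq_mul, abs_mul, abs_of_pos (inv_pos.2 hR), mul_comm]
  gcongr
  exact hM _ _

theorem le_integral_cutoffAt (x₀ : Rn n) {R : ℝ} (hR : 0 < R) :
    ballVol n * R ^ n ≤ ∫ x, cutoffAt x₀ R x := by
  calc ballVol n * R ^ n = ∫ x in Metric.closedBall x₀ R, (1 : ℝ) := by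
        rw [setIntegral_const, volume_real_closedBall _ hR.le]; simp
    _ = ∫ x in Metric.closedBall x₀ R, cutoffAt x₀ R x := by
        refine setIntegral_congr_fun measurableSet_closedBall fun x hx => ?_
        exact (cutoffAt_eq_one hR (mem_closedBall_iff_norm.1 hx)).symm
    _ ≤ _ := setIntegral_le_integral (test_integrable _)
        (Eventually.of_forall fun x => cutoffAt_nonneg hR)

/-- The standard mollifier at scale `δ`. -/
noncomputable def mollifier (n : ℕ) (δ : ℝ) : 𝓓(whole n, ℝ) :=
  (∫ x, cutoffAt (0 : Rn n) δ x)⁻¹ • cutoffAt (0 : Rn n) δ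

theorem mollifier_apply (δ : ℝ) (x : Rn n) :
    mollifier n δ x = (∫ x, cutoffAt (0 : Rn n) δ x)⁻¹ * cutoffAt (0 : Rn n) δ x := rfl

theorem integral_cutoffAt_pos {δ : ℝ} (hδ : 0 < δ) : 0 < ∫ x, cutoffAt (0 : Rn n) δ x :=
  (mul_pos (ballVol_pos n) (pow_pos hδ n)).trans_le (le_integral_cutoffAt 0 hδ)

theorem integral_mollifier {δ : ℝ} (hδ : 0 < δ) : ∫ x, mollifier n δ x = 1 := by
  simp_rw [mollifier_apply]
  rw [integral_const_mul, inv_mul_cancel₀ (integral_cutoffAt_pos hδ).ne']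

theorem mollifier_nonneg {δ : ℝ} (hδ : 0 < δ) (x : Rn n) : 0 ≤ mollifier n δ x :=
  mul_nonneg (inv_nonneg.2 (integral_cutoffAt_pos hδ).le) (cutoffAt_nonneg hδ)

theorem abs_mollifier_le {δ : ℝ} (hδ : 0 < δ) (x : Rn n) :
    |mollifier n δ x| ≤ (ballVol n * δ ^ n)⁻¹ := by
  rw [abs_of_nonneg (mollifier_nonneg hδ x), mollifier_apply]
  have h1 := le_integral_cutoffAt (0 : Rn n) hδ
  have h2 : 0 < ballVol n * δ ^ n := mul_pos (ballVol_pos n) (pow_pos hδ n)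
  calc _ ≤ (ballVol n * δ ^ n)⁻¹ * 1 := by
        gcongr
        · exact cutoffAt_nonneg hδ
        · exact cutoffAt_le_one hδ
    _ = _ := mul_one _

theorem exists_pderiv_mollifier_bound (n : ℕ) : ∃ M : ℝ, 0 ≤ M ∧ ∀ δ : ℝ, 0 < δ →
    ∀ (j : Fin n) x, |pderiv j (mollifier n δ) x| ≤ M * δ⁻¹ * (ballVol n * δ ^ n)⁻¹ := by
  obtain ⟨M, hM0, hM⟩ := exists_pderiv_cutoffAt_bound n
  refine ⟨M, hM0, fun δ hδ j x => ?_⟩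
  have h1 := le_integral_cutoffAt (0 : Rn n) hδ
  have h2 : 0 < ballVol n * δ ^ n := mul_pos (ballVol_pos n) (pow_pos hδ n)
  have h3 : pderiv j (mollifier n δ) x =
      (∫ x, cutoffAt (0 : Rn n) δ x)⁻¹ * pderiv j (cutoffAt (0 : Rn n) δ) x :=
    pderiv_const_mul j _ (test_differentiable _ x)
  rw [h3, abs_mul, abs_of_nonneg (inv_nonneg.2 (integral_cutoffAt_pos hδ).le), mul_comm]
  exact mul_le_mul (hM 0 δ hδ j x) (inv_anti₀ h2 h1)
    (inv_nonneg.2 (integral_cutoffAt_pos hδ).le) (by positivity)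

theorem mollifier_eq_zero {δ : ℝ} (hδ : 0 < δ) {x : Rn n} (hx : 2 * δ < ‖x‖) :
    mollifier n δ x = 0 := by
  have h0 : cutoffAt (0 : Rn n) δ x = 0 := image_eq_zero_of_notMem_tsupport fun h => by
    have := tsupport_cutoffAt hδ h
    rw [mem_closedBall_zero_iff] at this
    linarith
  rw [mollifier_apply, h0, mul_zero]

theorem pderiv_mollifier_eq_zero {δ : ℝ} (hδ : 0 < δ) (j : Fin n) {x : Rn n} (hx : 2 * δ < ‖x‖) :
    pderiv j (mollifier n δ) x = 0 := by
  have h3 : pderiv j (mollifier n δ) x =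
      (∫ x, cutoffAt (0 : Rn n) δ x)⁻¹ * pderiv j (cutoffAt (0 : Rn n) δ) x :=
    pderiv_const_mul j _ (test_differentiable _ x)
  rw [h3, pderiv_eq_zero_of_notMem, mul_zero]
  intro h
  have := tsupport_cutoffAt hδ h
  rw [mem_closedBall_zero_iff] at this
  linarith

/-- The mollification of a vector valued function. -/
noncomputable def mollify (Γ : Rn n → F) (δ : ℝ) : Rn n → F :=
  convolution Γ (mollifier n δ) (ContinuousLinearMap.lsmul ℝ ℝ).flip volume

theorem mollify_apply (Γ : Rn n → F) (δ : ℝ) (x : Rn n) :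
    mollify Γ δ x = ∫ y, mollifier n δ (x - y) • Γ y := rfl

theorem contDiff_mollify {Γ : Rn n → F} (hΓ : LocallyIntegrable Γ) (δ : ℝ) :
    ContDiff ℝ 1 (mollify Γ δ) :=
  (mollifier n δ).hasCompactSupport.contDiff_convolution_right _ hΓ
    ((mollifier n δ).contDiff.of_le (by simp))

theorem pderiv_mollify {Γ : Rn n → F} (hΓ : LocallyIntegrable Γ) (δ : ℝ) (j : Fin n) (x : Rn n) :
    pderiv j (mollify Γ δ) x = ∫ y, pderiv j (mollifier n δ) (x - y) • Γ y := by
  have h := (mollifier n δ).hasCompactSupport.hasFDerivAt_convolution_right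
    (ContinuousLinearMap.lsmul ℝ ℝ : ℝ →L[ℝ] F →L[ℝ] F).flip hΓ
    ((mollifier n δ).contDiff.of_le (by simp)) x
  unfold pderiv mollify
  rw [h.fderiv]
  rw [convolution_precompR_apply _ hΓ ((mollifier n δ).hasCompactSupport.fderiv ℝ)
    ((mollifier n δ).contDiff.continuous_fderiv (by simp))]
  rfl

theorem integrable_comp_sub_smul {Γ : Rn n → F} (hΓ : LocallyIntegrable Γ) (ρ : 𝓓(whole n, ℝ))
    (x : Rn n) : Integrable fun y => ρ (x - y) • Γ y := by
  refine hΓ.integrable_smul_left_of_hasCompactSupport (by fun_prop) ?_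
  exact ρ.hasCompactSupport.comp_homeomorph (Homeomorph.subLeft x)

theorem integral_comp_const_sub (ρ : Rn n → ℝ) (x : Rn n) : ∫ y, ρ (x - y) = ∫ y, ρ y :=
  integral_sub_left_eq_self ρ volume x

theorem norm_integral_smul_le {ρ : Rn n → ℝ} {Γ : Rn n → F} {B r : ℝ} {x : Rn n}
    (hρ : ∀ z, |ρ z| ≤ B) (hρ0 : ∀ z, r < ‖z‖ → ρ z = 0) (hΓ : LocallyIntegrable Γ) :
    ‖∫ y, ρ (x - y) • Γ y‖ ≤ B * ∫ y in Metric.closedBall x r, ‖Γ y‖ := by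
  have h0 : ∀ y, y ∉ Metric.closedBall x r → ρ (x - y) • Γ y = 0 := fun y hy => by
    rw [hρ0, zero_smul]
    rw [mem_closedBall_iff_norm, not_le, norm_sub_rev] at hy
    exact hy
  rw [← setIntegral_eq_integral_of_forall_compl_eq_zero h0, ← integral_const_mul]
  refine norm_integral_le_of_norm_le ?_ (Eventually.of_forall fun y => ?_)
  · exact (hΓ.norm_fun.integrableOn_of_isBounded Metric.isBounded_closedBall).const_mul B
  · rw [norm_smul]
    gcongr
    exact hρ _

variable [CompleteSpace F]

/-- The mollifier has mass one, so any constant c can be moved inside the integral. -/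
theorem norm_mollify_sub_le {Γ : Rn n → F} (hΓ : LocallyIntegrable Γ) {δ : ℝ} (hδ : 0 < δ)
    (x : Rn n) (c : F) :
    ‖mollify Γ δ x - c‖ ≤
      (ballVol n * δ ^ n)⁻¹ * ∫ y in Metric.closedBall x (2 * δ), ‖Γ y - c‖ := by
  have h1 : mollify Γ δ x - c = ∫ y, mollifier n δ (x - y) • (Γ y - c) := by
    simp_rw [smul_sub]
    rw [integral_sub (integrable_comp_sub_smul hΓ _ _)
      (integrable_comp_sub_smul (locallyIntegrable_const c) _ _), integral_smul_const,
      integral_comp_const_sub, integral_mollifier hδ, one_smul, mollify_apply]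
  rw [h1]
  exact norm_integral_smul_le (abs_mollifier_le hδ) (fun z hz => mollifier_eq_zero hδ hz)
    (hΓ.sub (locallyIntegrable_const c))

/-- The derivative of the mollifier has mean zero, so an arbitrary constant may be subtracted from
Γ: the derivatives of the mollification are governed by the oscillation of Γ at scale δ, not by its
size. -/
theorem exists_norm_pderiv_mollify_le (n : ℕ) (F : Type*) [NormedAddCommGroup F] [NormedSpace ℝ F]
    [CompleteSpace F] : ∃ M : ℝ, 0 ≤ M ∧ ∀ {Γ : Rn n → F}, LocallyIntegrable Γ →
      ∀ (δ : ℝ), 0 < δ → ∀ (j : Fin n) (x : Rn n) (c : F), ‖pderiv j (mollify Γ δ) x‖ ≤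
        M * δ⁻¹ * (ballVol n * δ ^ n)⁻¹ * ∫ y in Metric.closedBall x (2 * δ), ‖Γ y - c‖ := by
  obtain ⟨M, hM0, hM⟩ := exists_pderiv_mollifier_bound n
  refine ⟨M, hM0, fun {Γ} hΓ δ hδ j x c => ?_⟩
  have h2 : ∫ y, pderiv j (mollifier n δ) (x - y) = 0 := by
    rw [integral_comp_const_sub]
    exact integral_pderiv_eq_zero j ((mollifier n δ).contDiff.of_le (by simp))
      (mollifier n δ).hasCompactSupport
  have h1 : pderiv j (mollify Γ δ) x = ∫ y, pderiv j (mollifier n δ) (x - y) • (Γ y - c) := by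
    have h3 : Integrable fun y => pderiv j (mollifier n δ) (x - y) • Γ y :=
      integrable_comp_sub_smul hΓ (testPderiv j (mollifier n δ)) x
    have h4 : Integrable fun y => pderiv j (mollifier n δ) (x - y) • c :=
      integrable_comp_sub_smul (locallyIntegrable_const c) (testPderiv j (mollifier n δ)) x
    simp_rw [smul_sub]
    rw [integral_sub h3 h4, integral_smul_const, h2, zero_smul, sub_zero, pderiv_mollify hΓ]
  rw [h1]
  exact norm_integral_smul_le (hM δ hδ j) (fun z hz => pderiv_mollifier_eq_zero hδ j hz)
    (hΓ.sub (locallyIntegrable_const c))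

end

section

variable {n : ℕ}

theorem integral_smul_pderiv {F : Type*} [NormedAddCommGroup F] [NormedSpace ℝ F]
    [CompleteSpace F] {G : Rn n → F} (hG : ContDiff ℝ 1 G) (v : 𝓓(whole n, ℝ)) (j : Fin n) :
    ∫ x, pderiv j v x • G x = -∫ x, v x • pderiv j G x := by
  have hv : ContDiff ℝ 1 v := v.contDiff.of_le (by simp)
  have h := integral_bilinear_hasLineDerivAt_right_eq_neg_left_of_integrable (μ := volume)
    (f := v) (f' := pderiv j v) (g := G) (g' := pderiv j G) (v := EuclideanSpace.single j 1)
    (B := (ContinuousLinearMap.lsmul ℝ ℝ : ℝ →L[ℝ] F →L[ℝ] F)) ?_ ?_ ?_ ?_ ?_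
  · rw [eq_neg_iff_add_eq_zero, add_comm, ← eq_neg_iff_add_eq_zero]; exact h
  · exact ((continuous_pderiv j hv).smul hG.continuous).integrable_of_hasCompactSupport
      (hasCompactSupport_pderiv j v.hasCompactSupport).smul_right
  · exact (hv.continuous.smul (continuous_pderiv j hG)).integrable_of_hasCompactSupport
      v.hasCompactSupport.smul_right
  · exact (hv.continuous.smul hG.continuous).integrable_of_hasCompactSupport
      v.hasCompactSupport.smul_right
  · exact fun x _ => (test_differentiable v x).hasFDerivAt.hasLineDerivAt _
  · exact fun x _ => ((hG.differentiable (by simp)) x).hasFDerivAt.hasLineDerivAt _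

/-- The pairing with a gradient of a field with bounded derivatives. -/
theorem norm_pairing_le_of_pderiv_bound {G : VectorField n} (hG : ContDiff ℝ 1 G) {M : ℝ}
    (hM : ∀ j x, ‖pderiv j G x‖ ≤ M) (v : 𝓓(whole n, ℝ)) :
    ‖∫ x, ∑ j, pderiv j v x • G x j‖ ≤ n * M * ∫ x, |v x| := by
  have hGi : LocallyIntegrable G := hG.continuous.locallyIntegrable
  rw [integral_finsetSum _ fun j _ => integrable_pderiv_smul hGi v j]
  refine (norm_sum_le _ _).trans ?_
  have h1 : ∀ j : Fin n, ‖∫ x, pderiv j v x • G x j‖ ≤ M * ∫ x, |v x| := by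
    intro j
    have hint : Integrable fun x => pderiv j v x • G x :=
      hGi.integrable_smul_left_of_hasCompactSupport
        (testPderiv j v).continuous (testPderiv j v).hasCompactSupport
    have h2 : ∫ x, pderiv j v x • G x j = (∫ x, pderiv j v x • G x) j := by
      have := ((EuclideanSpace.proj j : EuclideanSpace ℂ (Fin n) →L[ℂ] ℂ).integral_comp_comm hint)
      exact this
    rw [h2, integral_smul_pderiv hG]
    refine (PiLp.norm_apply_le _ j).trans ?_
    rw [norm_neg, mul_comm, ← integral_mul_const]
    refine norm_integral_le_of_norm_le ((test_integrable v).abs.mul_const M)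
      (Eventually.of_forall fun x => ?_)
    rw [norm_smul, Real.norm_eq_abs]
    gcongr
    exact hM j x
  calc _ ≤ ∑ j : Fin n, M * ∫ x, |v x| := Finset.sum_le_sum fun j _ => h1 j
    _ = _ := by simp; ring

/-! ### The three sufficient conditions -/

/-- Here e = 2α and Γ₂ = 0: the Morrey condition is already a growth condition at all scales, and e
> -2 amounts to p < 1. -/
theorem nashInequality_of_memMorrey {Q : Distr n} {Γ : VectorField n} {p : ℝ}
    (hp0 : 0 < p) (hp1 : p < 1)
    (hΓ : MemMorrey (3 * n + 2 - 2 * p * (n + 2)) Γ) (hQ : IsDivergence Q Γ) :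
    NashInequality Q p := by
  obtain ⟨-, C, hC⟩ := hΓ
  have hn : (0 : ℝ) < n + 2 := by positivity
  refine nashInequality_of_splitting (e := 2 * (n + 1 - p * (n + 2))) (A := C) (B := 0) hp0 hp1
    (by nlinarith) C.2 le_rfl hQ fun δ hδ => ⟨Γ, 0, by simp, hQ.1, locallyIntegrable_const 0, ?_, ?_⟩
  · intro x r hr _
    refine (hC x r hr).trans_eq ?_
    rw [sub_self, Real.rpow_zero, mul_one, ENNReal.ofReal_mul (NNReal.coe_nonneg C),
      ENNReal.ofReal_coe_nnreal]
    congr 3; ring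
  · intro v
    simp

theorem MemLip.continuous {α : ℝ} (hα : 0 < α) {Γ : VectorField n} (h : MemLip α Γ) :
    Continuous Γ := by
  obtain ⟨C, hC⟩ := h
  rw [continuous_iff_continuousAt]
  intro x
  rw [ContinuousAt, tendsto_iff_norm_sub_tendsto_zero]
  have h1 : Continuous fun y : Rn n => C * ‖y - x‖ ^ α :=
    continuous_const.mul ((continuous_norm.comp (continuous_id.sub continuous_const)).rpow_const
      fun y => Or.inr hα.le)
  have h2 := h1.tendsto x
  simp only [sub_self, norm_zero, Real.zero_rpow hα.ne', mul_zero] at h2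
  exact squeeze_zero (fun y => norm_nonneg _) (fun y => hC y x) h2

/-- The remainder Γ - `mollify Γ δ` is O(δ^α) pointwise, so its square has growth exponent n (e =
0), while the mollification has derivatives O(δ^{α-1}). -/
theorem nashInequality_of_memLip {Q : Distr n} {Γ : VectorField n} {p : ℝ}
    (hp0 : 0 < p) (hp1 : p < 1) (hα : 0 < n + 1 - p * (n + 2))
    (hΓ : MemLip (n + 1 - p * (n + 2)) Γ) (hQ : IsDivergence Q Γ) :
    NashInequality Q p := by
  set α := (n : ℝ) + 1 - p * (n + 2) with hαdef
  have hcont := hΓ.continuous hα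
  obtain ⟨C, hC⟩ := hΓ
  obtain ⟨M, hM0, hM⟩ := exists_norm_pderiv_mollify_le n (EuclideanSpace ℂ (Fin n))
  have hω := ballVol_pos n
  set K := |C| * 2 ^ α * 2 ^ n with hK
  have hK0 : 0 ≤ K := by positivity
  have hosc : ∀ (x : Rn n) (δ : ℝ), 0 < δ →
      (ballVol n * δ ^ n)⁻¹ * ∫ y in Metric.closedBall x (2 * δ), ‖Γ y - Γ x‖ ≤ K * δ ^ α := by
    intro x δ hδ
    rw [inv_mul_le_iff₀ (by positivity)]
    calc ∫ y in Metric.closedBall x (2 * δ), ‖Γ y - Γ x‖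
        ≤ ∫ y in Metric.closedBall x (2 * δ), |C| * (2 * δ) ^ α := by
          refine setIntegral_mono_on ?_ (integrableOn_const measure_closedBall_lt_top.ne)
            measurableSet_closedBall fun y hy => (hC y x).trans ?_
          · exact ((hQ.1.sub (locallyIntegrable_const _)).norm_fun).integrableOn_of_isBounded
              Metric.isBounded_closedBall
          · rw [mem_closedBall_iff_norm] at hy
            gcongr
            exact le_abs_self C
      _ = ballVol n * δ ^ n * (K * δ ^ α) := by
          rw [setIntegral_const, volume_real_closedBall _ (by positivity), smul_eq_mul, hK,
            Real.mul_rpow zero_le_two hδ.le, mul_pow]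
          ring
  refine nashInequality_of_splitting (e := 0) (A := K ^ 2 * ballVol n) (B := n * (M * K)) hp0 hp1
    (by norm_num) (by positivity) (by positivity) hQ fun δ hδ =>
    ⟨fun x => Γ x - mollify Γ δ x, mollify Γ δ, by simp, ?_, ?_, ?_, ?_⟩
  · exact (hcont.sub (contDiff_mollify hQ.1 δ).continuous).locallyIntegrable
  · exact (contDiff_mollify hQ.1 δ).continuous.locallyIntegrable
  · intro x r hr _
    calc ∫⁻ y in Metric.ball x r, ‖Γ y - mollify Γ δ y‖ₑ ^ 2
        ≤ ∫⁻ y in Metric.ball x r, ENNReal.ofReal ((K * δ ^ α) ^ 2) := by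
          refine lintegral_mono fun y => ?_
          rw [← ofReal_norm, ← ENNReal.ofReal_pow (norm_nonneg _), norm_sub_rev]
          refine ENNReal.ofReal_le_ofReal ?_
          gcongr
          exact (norm_mollify_sub_le hQ.1 hδ y (Γ y)).trans (hosc y δ hδ)
      _ = _ := by
          rw [setLIntegral_const, ← ENNReal.ofReal_toReal (measure_ball_lt_top (x := x) (r := r)).ne,
            ← ENNReal.ofReal_mul (by positivity)]
          have := volume_real_ball x hr
          rw [Measure.real] at this
          rw [this, sub_zero, add_zero, Real.rpow_natCast, mul_pow, ← Real.rpow_natCast (δ ^ α),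
            ← Real.rpow_mul hδ.le]
          congr 1
          push_cast
          rw [mul_comm α 2]
          ring
  · intro v
    have h1 : ∀ j x, ‖pderiv j (mollify Γ δ) x‖ ≤ M * K * δ ^ (α - 1) := by
      intro j x
      refine (hM hQ.1 δ hδ j x (Γ x)).trans ?_
      calc _ = M * δ⁻¹ * ((ballVol n * δ ^ n)⁻¹ *
            ∫ y in Metric.closedBall x (2 * δ), ‖Γ y - Γ x‖) := by ring
        _ ≤ M * δ⁻¹ * (K * δ ^ α) := mul_le_mul_of_nonneg_left (hosc x δ hδ) (by positivity)
        _ = _ := by rw [Real.rpow_sub_one hδ.ne', div_eq_mul_inv]; ring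
    refine (norm_pairing_le_of_pderiv_bound (contDiff_mollify hQ.1 δ) h1 v).trans_eq ?_
    ring

end

end NashForm

/-! ### Oscillation centres and the sufficiency of BMO -/

namespace NashForm

section

variable {n : ℕ} {F : Type*} [NormedAddCommGroup F]

theorem setIntegral_norm_le_sqrt {f : Rn n → F} {s : Set (Rn n)} (hf : IntegrableOn f s)
    (hs : volume s ≠ ∞) {A : ℝ} (hA : ∫⁻ x in s, ‖f x‖ₑ ^ 2 ≤ ENNReal.ofReal A) :
    ∫ x in s, ‖f x‖ ≤ √(volume.real s * A) := by
  rcases lt_or_ge A 0 with h0 | h0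
  · have h1 := sq_lintegral_le_measure_univ_mul (μ := volume.restrict s) hf.1.enorm
    rw [ENNReal.ofReal_of_nonpos h0.le, nonpos_iff_eq_zero] at hA
    rw [hA, mul_zero, nonpos_iff_eq_zero, pow_eq_zero_iff two_ne_zero] at h1
    rw [integral_norm_eq_lintegral_enorm hf.1, h1, ENNReal.toReal_zero]
    exact Real.sqrt_nonneg _
  refine Real.le_sqrt_of_sq_le ?_
  have h1 := sq_lintegral_le_measure_univ_mul (μ := volume.restrict s) hf.1.enorm
  rw [integral_norm_eq_lintegral_enorm hf.1, ← ENNReal.toReal_pow]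
  refine (ENNReal.toReal_mono ?_ (h1.trans (mul_le_mul_right hA _))).trans_eq ?_
  · rw [Measure.restrict_apply_univ]
    exact ENNReal.mul_ne_top hs ENNReal.ofReal_ne_top
  · rw [Measure.restrict_apply_univ, ENNReal.toReal_mul, ENNReal.toReal_ofReal h0, Measure.real]

/-- Integrate |a-b| ≤ |f-a| + |f-b| over the smaller ball. This compares the constants approximating
f on two nested balls. -/
theorem volume_mul_norm_sub_le {f : Rn n → F} (hf : LocallyIntegrable f) {x y : Rn n} {r s : ℝ}
    (hr : 0 < r) (h : Metric.ball x r ⊆ Metric.ball y s) (a b : F) :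
    ballVol n * r ^ n * ‖a - b‖ ≤
      (∫ z in Metric.ball x r, ‖f z - a‖) + ∫ z in Metric.ball y s, ‖f z - b‖ := by
  have hi : ∀ (c : F) (x : Rn n) (r : ℝ), IntegrableOn (fun z => ‖f z - c‖) (Metric.ball x r) :=
    fun c x r => (hf.sub (locallyIntegrable_const c)).norm_fun.integrableOn_of_isBounded
      Metric.isBounded_ball
  calc ballVol n * r ^ n * ‖a - b‖ = ∫ z in Metric.ball x r, ‖a - b‖ := by
        rw [setIntegral_const, volume_real_ball x hr, smul_eq_mul]
    _ ≤ ∫ z in Metric.ball x r, (‖f z - a‖ + ‖f z - b‖) := by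
        refine integral_mono (integrableOn_const measure_ball_lt_top.ne) ((hi a x r).add (hi b x r)) fun z => ?_
        have := norm_sub_le_norm_sub_add_norm_sub a (f z) b
        rwa [norm_sub_rev a (f z)] at this
    _ = (∫ z in Metric.ball x r, ‖f z - a‖) + ∫ z in Metric.ball x r, ‖f z - b‖ :=
        integral_add (hi a x r) (hi b x r)
    _ ≤ _ := by
        gcongr 1
        exact setIntegral_mono_set (hi b y s) (Eventually.of_forall fun _ => norm_nonneg _)
          (LE.le.eventuallyLE h)

/-- Centres are chosen once for all balls, and Cauchy–Schwarz adds the L¹ version of the bound,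
which is the one needed to compare centres. -/
theorem exists_oscillation_center {f : Rn n → F} (hf : LocallyIntegrable f) {C α : ℝ}
    (h : ∀ (x : Rn n) (r : ℝ), 0 < r → ∃ c : F,
      ∫⁻ y in Metric.ball x r, ‖f y - c‖ₑ ^ 2 ≤ ENNReal.ofReal (C * r ^ (n + 2 * α))) :
    ∃ (D : ℝ) (c : Rn n → ℝ → F), 0 ≤ D ∧
      (∀ x r, 0 < r →
        ∫⁻ y in Metric.ball x r, ‖f y - c x r‖ₑ ^ 2 ≤ ENNReal.ofReal (C * r ^ (n + 2 * α))) ∧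
      ∀ x r, 0 < r → ∫ y in Metric.ball x r, ‖f y - c x r‖ ≤ D * r ^ (n + α) := by
  choose! c hc using h
  have hω := ballVol_pos n
  refine ⟨√(ballVol n * C), c, Real.sqrt_nonneg _, hc, fun x r hr => ?_⟩
  refine (setIntegral_norm_le_sqrt ((hf.sub (locallyIntegrable_const _)).integrableOn_of_isBounded
      Metric.isBounded_ball) measure_ball_lt_top.ne (hc x r hr)).trans_eq ?_
  rw [volume_real_ball x hr, mul_mul_mul_comm, Real.sqrt_mul' _ (by positivity)]
  congr 1
  rw [← Real.rpow_natCast r n, ← Real.rpow_add hr,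
    show (n : ℝ) + (n + 2 * α) = (n + α) * 2 by ring, Real.rpow_mul hr.le, Real.rpow_two,
    Real.sqrt_sq (by positivity)]

/-- With 2^N of order δ/r, this bounds the square of a logarithm of δ/r by a multiple of δ/r itself.
-/
theorem add_one_sq_le_four_mul_two_pow (N : ℕ) : ((N : ℝ) + 1) ^ 2 ≤ 4 * 2 ^ N := by
  have : (N + 1) ^ 2 ≤ 4 * 2 ^ N := by
    rcases lt_or_ge N 3 with h | h
    · interval_cases N <;> norm_num
    · induction N, h using Nat.le_induction with
      | base => norm_num
      | succ k hk ih => rw [pow_succ 2 k]; nlinarith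
  exact_mod_cast this

/-- Each doubling of the radius moves the centre by at most D, so the growth is logarithmic in s/r.
-/
theorem norm_center_sub_le {c : ℝ → F} {D : ℝ}
    (h : ∀ r s, 0 < r → r ≤ s → s ≤ 2 * r → ‖c r - c s‖ ≤ D) (N : ℕ) {r s : ℝ} (hr : 0 < r)
    (hrs : r ≤ s) (hsr : s ≤ 2 ^ N * r) : ‖c r - c s‖ ≤ N * D := by
  induction N generalizing s with
  | zero =>
    have : r = s := le_antisymm hrs (by simpa using hsr)
    simp [this]
  | succ N ih =>
    have h1 : ‖c r - c (max r (s / 2))‖ ≤ N * D := by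
      refine ih (le_max_left _ _) (max_le (le_mul_of_one_le_left hr.le (one_le_pow₀ one_le_two)) ?_)
      rw [pow_succ] at hsr
      linarith
    have h2 : ‖c (max r (s / 2)) - c s‖ ≤ D := by
      refine h _ _ (lt_max_of_lt_left hr) (max_le hrs (by linarith)) ?_
      linarith [le_max_right r (s / 2)]
    have h3 := norm_sub_le_norm_sub_add_norm_sub (c r) (c (max r (s / 2))) (c s)
    push_cast
    linarith

end

theorem enorm_add_add_sq_le {F : Type*} [NormedAddCommGroup F] (a b c : F) :
    ‖a + b + c‖ₑ ^ 2 ≤ 3 * ‖a‖ₑ ^ 2 + ENNReal.ofReal (3 * ‖b‖ ^ 2 + 3 * ‖c‖ ^ 2) := by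
  rw [← ofReal_norm a, ← ofReal_norm (a + b + c), ← ENNReal.ofReal_pow (norm_nonneg _),
    ← ENNReal.ofReal_pow (norm_nonneg _), show (3 : ℝ≥0∞) = ENNReal.ofReal 3 by simp,
    ← ENNReal.ofReal_mul (by norm_num), ← ENNReal.ofReal_add (by positivity) (by positivity)]
  refine ENNReal.ofReal_le_ofReal ?_
  have h := norm_add₃_le (a := a) (b := b) (c := c)
  have h0 := norm_nonneg (a + b + c)
  nlinarith [sq_nonneg (‖a‖ - ‖b‖), sq_nonneg (‖a‖ - ‖c‖), sq_nonneg (‖b‖ - ‖c‖)]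

/-- Here α = 0. On B(x,r) with r ≤ δ, write Γ - `mollify Γ δ` as (Γ - c_r) + (c_r - c_{4δ}) +
(c_{4δ} - `mollify Γ δ`). The outer terms are bounded in mean square, the middle one by log(δ/r).
The squared logarithm is dominated by δ/r, a loss that e = -1 can afford because the trace
inequality allows every e > -2. -/
theorem nashInequality_of_memBMO {n : ℕ} {Q : Distr n} {Γ : VectorField n} {p : ℝ}
    (hp0 : 0 < p) (hp1 : p < 1) (hp : p = (n + 1) / (n + 2))
    (hΓ : MemBMO Γ) (hQ : IsDivergence Q Γ) : NashInequality Q p := by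
  obtain ⟨hloc, C, hC⟩ := hΓ
  obtain ⟨C', hC'0, hosc⟩ := exists_sq_oscillation_bound hloc hC
  obtain ⟨D, c, hD0, hc2, hc1⟩ := exists_oscillation_center (C := C') (α := 0) hloc
    (by simpa using hosc)
  simp only [mul_zero, add_zero, Real.rpow_natCast] at hc1 hc2
  have hω := ballVol_pos n
  obtain ⟨M, hM0, hM⟩ := exists_norm_pderiv_mollify_le n (EuclideanSpace ℂ (Fin n))
  set C₁ := D * (1 + 2 ^ n) / ballVol n with hC₁
  set C₂ := D * 4 ^ n / ballVol n with hC₂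
  have hC₁0 : 0 ≤ C₁ := by positivity
  have hC₂0 : 0 ≤ C₂ := by positivity
  have hcc : ∀ x r s, 0 < r → r ≤ s → s ≤ 2 * r → ‖c x r - c x s‖ ≤ C₁ := by
    intro x r s hr hrs hsr
    rw [hC₁, le_div_iff₀ hω]
    have h1 := volume_mul_norm_sub_le hloc hr (Metric.ball_subset_ball (x := x) hrs) (c x r) (c x s)
    have h2 := hc1 x r hr
    have h3 := hc1 x s (hr.trans_le hrs)
    have h4 : D * s ^ n ≤ D * (2 ^ n * r ^ n) := by
      have := hr.trans_le hrs
      rw [← mul_pow]; gcongr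
    have h5 : 0 < r ^ n := by positivity
    refine le_of_mul_le_mul_right ?_ h5
    linarith
  -- For |y-x| ≤ δ the closed ball of radius 2δ around y lies in B(x,4δ); this is why 4δ is the
  -- reference radius.
  have hm : ∀ x y δ, 0 < δ → ‖y - x‖ ≤ δ → (ballVol n * δ ^ n)⁻¹ *
      ∫ z in Metric.closedBall y (2 * δ), ‖Γ z - c x (4 * δ)‖ ≤ C₂ := by
    intro x y δ hδ hy
    rw [inv_mul_le_iff₀ (by positivity)]
    calc _ ≤ ∫ z in Metric.ball x (4 * δ), ‖Γ z - c x (4 * δ)‖ := by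
          refine setIntegral_mono_set ?_ (Eventually.of_forall fun _ => norm_nonneg _)
            (LE.le.eventuallyLE fun z hz => ?_)
          · exact (hloc.sub (locallyIntegrable_const _)).norm_fun.integrableOn_of_isBounded
              Metric.isBounded_ball
          · rw [mem_closedBall_iff_norm] at hz
            rw [mem_ball_iff_norm]
            have := norm_sub_le_norm_sub_add_norm_sub z y x
            linarith
      _ ≤ _ := hc1 x _ (by positivity)
      _ = _ := by rw [hC₂, mul_pow]; field_simp
  have hα : (n : ℝ) + 1 - p * (n + 2) = 0 := by
    rw [hp, div_mul_cancel₀ _ (by positivity)]; ring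
  refine nashInequality_of_splitting (e := -1)
    (A := 3 * C' + 3 * ballVol n * C₂ ^ 2 + 48 * ballVol n * C₁ ^ 2)
    (B := n * (M * C₂)) hp0 hp1
    (by norm_num) (by positivity) (by positivity) hQ fun δ hδ =>
    ⟨fun x => Γ x - mollify Γ δ x, mollify Γ δ, by simp, ?_, ?_, ?_, ?_⟩
  · exact hloc.sub (contDiff_mollify hloc δ).continuous.locallyIntegrable
  · exact (contDiff_mollify hloc δ).continuous.locallyIntegrable
  · intro x r hr hrδ
    obtain ⟨N, hN1, hN2⟩ := exists_nat_pow_near (x := 4 * δ / r) (y := (2 : ℝ))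
      (by rw [le_div_iff₀ hr]; linarith) one_lt_two
    rw [le_div_iff₀ hr] at hN1
    rw [div_lt_iff₀ hr] at hN2
    have h1 : ‖c x r - c x (4 * δ)‖ ≤ (N + 1) * C₁ := by
      exact_mod_cast norm_center_sub_le (hcc x) (N + 1) hr (by linarith) hN2.le
    -- Since 2^N ≤ 4δ/r, the factor (N+1)² is at most 4·2^N ≤ 16 δ/r.
    have h2 : ‖c x r - c x (4 * δ)‖ ^ 2 ≤ 16 * C₁ ^ 2 * (δ / r) := by
      calc _ ≤ ((N + 1) * C₁) ^ 2 := by gcongr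
        _ = ((N : ℝ) + 1) ^ 2 * C₁ ^ 2 := by ring
        _ ≤ 4 * (4 * δ / r) * C₁ ^ 2 := by
            gcongr
            refine (add_one_sq_le_four_mul_two_pow N).trans ?_
            gcongr
            rwa [le_div_iff₀ hr]
        _ = _ := by ring
    have h3 : 1 ≤ δ / r := by rwa [one_le_div hr]
    have h4 : ∀ y ∈ Metric.ball x r, ‖Γ y - mollify Γ δ y‖ₑ ^ 2 ≤ 3 * ‖Γ y - c x r‖ₑ ^ 2 +
        ENNReal.ofReal (3 * (16 * C₁ ^ 2 * (δ / r)) + 3 * C₂ ^ 2) := by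
      intro y hy
      have h5 : ‖c x (4 * δ) - mollify Γ δ y‖ ≤ C₂ := by
        rw [norm_sub_rev]
        refine (norm_mollify_sub_le hloc hδ y _).trans (hm x y δ hδ ?_)
        rw [mem_ball_iff_norm] at hy
        linarith
      have h6 := enorm_add_add_sq_le (Γ y - c x r) (c x r - c x (4 * δ))
        (c x (4 * δ) - mollify Γ δ y)
      rw [sub_add_sub_cancel, sub_add_sub_cancel] at h6
      refine h6.trans ?_
      gcongr
    refine (setLIntegral_mono' measurableSet_ball h4).trans ?_
    rw [lintegral_add_right _ measurable_const, setLIntegral_const,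
      lintegral_const_mul' _ _ (by simp),
      ← ENNReal.ofReal_toReal (measure_ball_lt_top (x := x) (r := r)).ne,
      ← ENNReal.ofReal_mul (by positivity)]
    have hv := volume_real_ball x hr
    rw [Measure.real] at hv
    rw [hv]
    have h7 : 3 * ∫⁻ y in Metric.ball x r, ‖Γ y - c x r‖ₑ ^ 2 ≤ ENNReal.ofReal (3 * (C' * r ^ n)) := by
      rw [ENNReal.ofReal_mul (by norm_num)]
      simp only [ENNReal.ofReal_ofNat]
      gcongr
      exact hc2 x r hr
    refine (add_le_add_left h7 _).trans ?_
    rw [← ENNReal.ofReal_add (by positivity) (by positivity)]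
    refine ENNReal.ofReal_le_ofReal ?_
    have h8 : δ ^ (2 * ((n : ℝ) + 1 - p * (n + 2)) - -1) = δ := by rw [hα]; simp
    have h9 : r ^ ((n : ℝ) + -1) = r ^ n / r := by
      rw [← sub_eq_add_neg, Real.rpow_sub_one hr.ne', Real.rpow_natCast]
    rw [h8, h9]
    have h10 : 3 * (C' * r ^ n) + 3 * C₂ ^ 2 * (ballVol n * r ^ n) ≤
        (3 * (C' * r ^ n) + 3 * C₂ ^ 2 * (ballVol n * r ^ n)) * (δ / r) :=
      le_mul_of_one_le_right (by positivity) h3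
    calc _ = (3 * (C' * r ^ n) + 3 * C₂ ^ 2 * (ballVol n * r ^ n)) +
          3 * (16 * C₁ ^ 2 * (δ / r)) * (ballVol n * r ^ n) := by ring
      _ ≤ (3 * (C' * r ^ n) + 3 * C₂ ^ 2 * (ballVol n * r ^ n)) * (δ / r) +
          3 * (16 * C₁ ^ 2 * (δ / r)) * (ballVol n * r ^ n) := by gcongr
      _ = _ := by ring
  · intro v
    have h1 : ∀ j x, ‖pderiv j (mollify Γ δ) x‖ ≤ M * C₂ * δ⁻¹ := by
      intro j x
      refine (hM hloc δ hδ j x (c x (4 * δ))).trans ?_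
      calc _ = M * δ⁻¹ * ((ballVol n * δ ^ n)⁻¹ *
            ∫ y in Metric.closedBall x (2 * δ), ‖Γ y - c x (4 * δ)‖) := by ring
        _ ≤ M * δ⁻¹ * C₂ :=
            mul_le_mul_of_nonneg_left (hm x x δ hδ (by simpa using hδ.le)) (by positivity)
        _ = _ := by ring
    refine (norm_pairing_le_of_pderiv_bound (contDiff_mollify hloc δ) h1 v).trans_eq ?_
    rw [hα, zero_sub, Real.rpow_neg_one]
    ring

end NashForm

namespace NashForm

/-! ### The fundamental solution -/

section

variable {n : ℕ}

theorem integral_eq_integral_sphere (hn : n ≠ 0) {f : Rn n → ℝ} (hf : Integrable f) :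
    ∫ x, f x = ∫ θ : Metric.sphere (0 : Rn n) 1,
      (∫ r in Set.Ioi (0 : ℝ), r ^ (n - 1) * f (r • (θ : Rn n)))
        ∂(volume : Measure (Rn n)).toSphere := by
  have : Nonempty (Fin n) := ⟨⟨0, Nat.pos_of_ne_zero hn⟩⟩
  have hmp := (volume : Measure (Rn n)).measurePreserving_homeomorphUnitSphereProd
  have hemb := (homeomorphUnitSphereProd (Rn n)).measurableEmbedding
  set g : Metric.sphere (0 : Rn n) 1 × Set.Ioi (0 : ℝ) → ℝ :=
    fun q => f ((q.2 : ℝ) • (q.1 : Rn n)) with hg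
  have hgf : ∀ x : ({0}ᶜ : Set (Rn n)), g (homeomorphUnitSphereProd (Rn n) x) = f x := by
    intro x
    have hx : ‖(x : Rn n)‖ ≠ 0 := norm_ne_zero_iff.2 x.2
    simp [hg, smul_smul, hx]
  have hint : Integrable g ((volume : Measure (Rn n)).toSphere.prod
      (.volumeIoiPow (Module.finrank ℝ (Rn n) - 1))) := by
    rw [← hmp.integrable_comp_emb hemb]
    have : Integrable (fun x : ({0}ᶜ : Set (Rn n)) => f x)
        ((volume : Measure (Rn n)).comap Subtype.val) := by
      have := hf.integrableOn (s := ({0}ᶜ : Set (Rn n)))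
      rwa [integrableOn_iff_comap_subtypeVal (by measurability)] at this
    exact this.congr (Eventually.of_forall fun x => (hgf x).symm)
  calc ∫ x, f x = ∫ x : ({(0)}ᶜ : Set (Rn n)), f x.1 ∂(volume.comap Subtype.val) := by
        rw [integral_subtype_comap (measurableSet_singleton _).compl f,
          restrict_compl_singleton]
    _ = ∫ x : ({(0)}ᶜ : Set (Rn n)), g (homeomorphUnitSphereProd (Rn n) x)
          ∂(volume.comap Subtype.val) := by simp_rw [hgf]
    _ = ∫ q, g q ∂((volume : Measure (Rn n)).toSphere.prod
          (.volumeIoiPow (Module.finrank ℝ (Rn n) - 1))) := hmp.integral_comp hemb g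
    _ = _ := by
        rw [integral_prod _ hint]
        refine integral_congr_ae (Eventually.of_forall fun θ => ?_)
        simp only [Measure.volumeIoiPow, ENNReal.ofReal, hg, finrank_euclideanSpace_fin]
        rw [integral_withDensity_eq_integral_smul]
        · rw [integral_subtype_comap measurableSet_Ioi
            fun a : ℝ => Real.toNNReal (a ^ (n - 1)) • f (a • (θ : Rn n))]
          refine setIntegral_congr_fun measurableSet_Ioi fun r hr => ?_
          have hr' : (0 : ℝ) ≤ r := (Set.mem_Ioi.1 hr).le
          simp only [NNReal.smul_def, smul_eq_mul]
          rw [Real.coe_toNNReal _ (pow_nonneg hr' _)]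
        · exact (measurable_subtype_coe.pow_const _).real_toNNReal

theorem fderiv_eq_sum_pderiv (v : Rn n → ℝ) (x y : Rn n) :
    fderiv ℝ v x y = ∑ j, y j * pderiv j v x := by
  conv_lhs => rw [← (EuclideanSpace.basisFun (Fin n) ℝ).sum_repr y]
  simp [pderiv]

theorem kernel_integrable_mul {j : Fin n} {v : Rn n → ℝ} (hv : Continuous v)
    (hc : HasCompactSupport v) : Integrable fun x => kernel j x * v x := by
  have := (locallyIntegrable_kernel j).integrable_smul_right_of_hasCompactSupport hv hc
  simpa [mul_comm] using this

theorem ballVol_eq (n : ℕ) : volume.real (Metric.ball (0 : Rn n) 1) = ballVol n := rfl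

/-- This is ΔE = δ₀. In polar coordinates r^{n-1} cancels the singularity and the integrand becomes
(n|B₁|)⁻¹ times the radial derivative of v. Each ray contributes -(n|B₁|)⁻¹v(0), and the sphere has
measure n|B₁|. -/
theorem sum_integral_kernel_mul_pderiv (hn : n ≠ 0) {v : Rn n → ℝ} (hv : ContDiff ℝ 1 v)
    (hc : HasCompactSupport v) : ∑ j, ∫ x, kernel j x * pderiv j v x = -v 0 := by
  have : Nonempty (Fin n) := ⟨⟨0, Nat.pos_of_ne_zero hn⟩⟩
  have hω := ballVol_pos n
  have hn0 : (n : ℝ) ≠ 0 := Nat.cast_ne_zero.2 hn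
  have hi : ∀ j ∈ Finset.univ, Integrable fun x => kernel j x * pderiv j v x := fun j _ =>
    kernel_integrable_mul (continuous_pderiv j hv) (hasCompactSupport_pderiv j hc)
  rw [← integral_finsetSum _ hi, integral_eq_integral_sphere hn (integrable_finsetSum _ hi)]
  have key : ∀ θ : Metric.sphere (0 : Rn n) 1,
      ∫ r in Set.Ioi (0 : ℝ), r ^ (n - 1) * ∑ j, kernel j (r • (θ : Rn n)) *
        pderiv j v (r • (θ : Rn n)) = -(n * ballVol n)⁻¹ * v 0 := by
    intro θ
    have hθ : ‖(θ : Rn n)‖ = 1 := by simp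
    have h1 : ∀ r ∈ Set.Ioi (0 : ℝ), r ^ (n - 1) * ∑ j, kernel j (r • (θ : Rn n)) *
        pderiv j v (r • (θ : Rn n)) =
        (n * ballVol n)⁻¹ * fderiv ℝ v (r • (θ : Rn n)) θ := by
      intro r hr
      have hr' : (0 : ℝ) < r := hr
      rw [fderiv_eq_sum_pderiv, Finset.mul_sum, Finset.mul_sum]
      refine Finset.sum_congr rfl fun j _ => ?_
      rw [kernel, norm_smul, hθ, mul_one, Real.norm_of_nonneg hr'.le, PiLp.smul_apply, smul_eq_mul,
        ballVol_eq]
      have hpow : r ^ n = r ^ (n - 1) * r := by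
        rw [← pow_succ, Nat.sub_add_cancel (Nat.one_le_iff_ne_zero.2 hn)]
      rw [hpow]
      field_simp
    rw [setIntegral_congr_fun measurableSet_Ioi h1, integral_const_mul]
    have hd : ∀ r : ℝ, HasDerivAt (fun r : ℝ => v (r • (θ : Rn n)))
        (fderiv ℝ v (r • (θ : Rn n)) θ) r := by
      intro r
      have h2 : HasDerivAt (fun r : ℝ => r • (θ : Rn n)) (θ : Rn n) r := by
        simpa using (hasDerivAt_id r).smul_const (θ : Rn n)
      exact ((hv.differentiable (by simp)) (r • (θ : Rn n))).hasFDerivAt.comp_hasDerivAt r h2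
    have hcont : Continuous fun r : ℝ => fderiv ℝ v (r • (θ : Rn n)) θ :=
      ((hv.continuous_fderiv (by simp)).comp (by fun_prop)).clm_apply continuous_const
    obtain ⟨ρ, hρ⟩ := hc.isCompact.isBounded.subset_closedBall (0 : Rn n)
    have hzero : ∀ r : ℝ, max ρ 0 < r → (r • (θ : Rn n)) ∉ tsupport v := by
      intro r hr h
      have := hρ h
      rw [mem_closedBall_zero_iff, norm_smul, hθ, mul_one, Real.norm_eq_abs] at this
      linarith [le_max_left ρ 0, le_abs_self r]
    have hcs : HasCompactSupport fun r : ℝ => fderiv ℝ v (r • (θ : Rn n)) θ := by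
      refine HasCompactSupport.intro (isCompact_Icc (a := -(max ρ 0)) (b := max ρ 0))
        fun r hr => ?_
      have h3 : (r • (θ : Rn n)) ∉ tsupport v := by
        intro h
        have := hρ h
        rw [mem_closedBall_zero_iff, norm_smul, hθ, mul_one, Real.norm_eq_abs] at this
        exact hr (abs_le.1 (this.trans (le_max_left ρ 0)))
      rw [image_eq_zero_of_notMem_tsupport fun h => h3 (tsupport_fderiv_subset ℝ h)]
      rfl
    rw [integral_Ioi_of_hasDerivAt_of_tendsto (f := fun r : ℝ => v (r • (θ : Rn n))) (m := 0)
      (hd 0).continuousAt.continuousWithinAt (fun r _ => hd r)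
      (hcont.integrable_of_hasCompactSupport hcs).integrableOn]
    · rw [zero_smul]; ring
    · refine tendsto_const_nhds.congr' ?_
      filter_upwards [eventually_gt_atTop (max ρ 0)] with r hr
      exact (image_eq_zero_of_notMem_tsupport (hzero r hr)).symm
  simp_rw [key]
  rw [integral_const, (volume : Measure (Rn n)).toSphere_real_apply_univ,
    finrank_euclideanSpace_fin, ballVol_eq, smul_eq_mul]
  field_simp

/-- A smooth approximation of `n |B₁| ∂ⱼE`. -/
noncomputable def regKernel (ε : ℝ) (j : Fin n) (x : Rn n) : ℝ :=
  x j * (‖x‖ ^ 2 + ε) ^ (-(n / 2 : ℝ))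

theorem contDiff_regKernel {ε : ℝ} (hε : 0 < ε) (j : Fin n) : ContDiff ℝ 1 (regKernel ε j) := by
  have h1 : ContDiff ℝ 1 fun x : Rn n => x j :=
    (EuclideanSpace.proj j : Rn n →L[ℝ] ℝ).contDiff
  refine h1.mul (ContDiff.rpow_const_of_ne ((contDiff_norm_sq ℝ).add contDiff_const) fun x => ?_)
  positivity

theorem pderiv_regKernel {ε : ℝ} (hε : 0 < ε) (i j : Fin n) (x : Rn n) :
    pderiv i (regKernel ε j) x = (if i = j then 1 else 0) * (‖x‖ ^ 2 + ε) ^ (-(n / 2 : ℝ)) +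
      x j * x i * (-n * (‖x‖ ^ 2 + ε) ^ (-(n / 2 : ℝ) - 1)) := by
  have hpos : 0 < ‖x‖ ^ 2 + ε := by positivity
  have h1 : HasFDerivAt (fun x : Rn n => x j) (EuclideanSpace.proj j : Rn n →L[ℝ] ℝ) x :=
    (EuclideanSpace.proj j : Rn n →L[ℝ] ℝ).hasFDerivAt
  have h2 : HasFDerivAt (fun x : Rn n => ‖x‖ ^ 2 + ε) (2 • innerSL ℝ x) x :=
    ((hasStrictFDerivAt_norm_sq x).hasFDerivAt).add_const ε
  have h3 := h2.rpow_const (p := -(n / 2 : ℝ)) (Or.inl hpos.ne')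
  have h4 := h1.mul h3
  have h5 : fderiv ℝ (regKernel ε j) x = _ := h4.fderiv
  unfold pderiv
  rw [h5]
  simp [EuclideanSpace.inner_single_right, eq_comm]
  ring

/-- The regularised kernels have a symmetric Jacobian, visible in `pderiv_regKernel`. -/
theorem integral_regKernel_mul_pderiv {ε : ℝ} (hε : 0 < ε) (i j : Fin n) {v : Rn n → ℝ}
    (hv : ContDiff ℝ 1 v) (hc : HasCompactSupport v) :
    ∫ x, regKernel ε j x * pderiv i v x = ∫ x, regKernel ε i x * pderiv j v x := by
  rw [integral_mul_pderiv i (contDiff_regKernel hε j) hv hc,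
    integral_mul_pderiv j (contDiff_regKernel hε i) hv hc]
  congr 2
  ext x
  rw [pderiv_regKernel hε, pderiv_regKernel hε]
  simp only [eq_comm (a := i)]
  ring

/-- Adding ε to ‖x‖² only lowers a nonpositive power, so the singular kernel itself is an integrable
majorant. -/
theorem tendsto_integral_regKernel (j : Fin n) {v : Rn n → ℝ}
    (hv : Continuous v) (hc : HasCompactSupport v) :
    Tendsto (fun k : ℕ => ∫ x, regKernel (1 / ((k : ℝ) + 1)) j x * v x) atTop
      (𝓝 (n * ballVol n * ∫ x, kernel j x * v x)) := by
  have hn : n ≠ 0 := by rintro rfl; exact j.elim0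
  have : Nonempty (Fin n) := ⟨j⟩
  have hn0 : (n : ℝ) ≠ 0 := Nat.cast_ne_zero.2 hn
  have hω := ballVol_pos n
  rw [← integral_const_mul]
  have hlim : ∀ x : Rn n, x ≠ 0 → (n * ballVol n) * kernel j x = x j * (‖x‖ ^ 2) ^ (-(n / 2 : ℝ)) := by
    intro x hx
    have hx' : 0 < ‖x‖ := norm_pos_iff.2 hx
    rw [kernel, ballVol_eq, ← Real.rpow_natCast ‖x‖ 2, ← Real.rpow_mul hx'.le]
    rw [show ((2 : ℕ) : ℝ) * -(n / 2 : ℝ) = -n by push_cast; ring, Real.rpow_neg hx'.le,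
      Real.rpow_natCast]
    field_simp
  have h0 : ∀ᵐ x : Rn n, x ≠ 0 := by
    simp [ae_iff]
  refine tendsto_integral_of_dominated_convergence
    (fun x => n * ballVol n * ‖kernel j x * v x‖) (fun k => ?_) ?_ (fun k => ?_) ?_
  · exact ((contDiff_regKernel (by positivity) j).continuous.mul hv).aestronglyMeasurable
  · exact ((kernel_integrable_mul hv hc).norm).const_mul _
  · filter_upwards [h0] with x hx
    have hx' : 0 < ‖x‖ := norm_pos_iff.2 hx
    rw [norm_mul, norm_mul, ← mul_assoc]
    gcongr
    have h1 : n * ballVol n * ‖kernel j x‖ = ‖x j * (‖x‖ ^ 2) ^ (-(n / 2 : ℝ))‖ := by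
      rw [← hlim x hx, norm_mul, Real.norm_of_nonneg (by positivity : 0 ≤ n * ballVol n)]
    rw [h1, regKernel, norm_mul, norm_mul]
    gcongr
    rw [Real.norm_of_nonneg (by positivity), Real.norm_of_nonneg (by positivity)]
    refine Real.rpow_le_rpow_of_nonpos (by positivity) ?_ ?_
    · have : 0 < 1 / ((k : ℝ) + 1) := by positivity
      linarith
    · rw [neg_nonpos]; positivity
  · filter_upwards [h0] with x hx
    have hx' : 0 < ‖x‖ := norm_pos_iff.2 hx
    rw [← mul_assoc, hlim x hx]
    unfold regKernel
    refine Tendsto.mul_const _ (Tendsto.const_mul _ ?_)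
    have h1 : Tendsto (fun k : ℕ => ‖x‖ ^ 2 + 1 / ((k : ℝ) + 1)) atTop (𝓝 (‖x‖ ^ 2 + 0)) :=
      tendsto_const_nhds.add tendsto_one_div_add_atTop_nhds_zero_nat
    rw [add_zero] at h1
    exact h1.rpow_const (Or.inl (by positivity))

/-- Symmetry of ∂ᵢ∂ⱼE as a distribution. These second derivatives are not locally integrable, so the
symmetry is obtained as a limit of smooth kernels. -/
theorem integral_kernel_mul_pderiv_comm (i j : Fin n) {v : Rn n → ℝ} (hv : ContDiff ℝ 1 v)
    (hc : HasCompactSupport v) :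
    ∫ x, kernel j x * pderiv i v x = ∫ x, kernel i x * pderiv j v x := by
  have hn : n ≠ 0 := by rintro rfl; exact j.elim0
  have hω := ballVol_pos n
  have hn0 : (n : ℝ) ≠ 0 := Nat.cast_ne_zero.2 hn
  have h1 := tendsto_integral_regKernel j (continuous_pderiv i hv) (hasCompactSupport_pderiv i hc)
  have h2 := tendsto_integral_regKernel i (continuous_pderiv j hv) (hasCompactSupport_pderiv j hc)
  have h3 : ∀ k : ℕ, ∫ x, regKernel (1 / ((k : ℝ) + 1)) j x * pderiv i v x =
      ∫ x, regKernel (1 / ((k : ℝ) + 1)) i x * pderiv j v x := fun k =>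
    integral_regKernel_mul_pderiv (by positivity) i j hv hc
  simp_rw [h3] at h1
  exact mul_left_cancel₀ (by positivity) (tendsto_nhds_unique h1 h2)

/-! ### The function `Δ⁻¹ ∂ⱼψ` -/

theorem invLaplacianDeriv_apply (j : Fin n) (ψ : 𝓓(whole n, ℝ)) (x : Rn n) :
    invLaplacianDeriv j ψ x = ∫ y, kernel j y * ψ (x - y) := rfl

theorem invLaplacianDeriv_apply' (j : Fin n) (ψ : 𝓓(whole n, ℝ)) (x : Rn n) :
    invLaplacianDeriv j ψ x = ∫ y, kernel j (x - y) * ψ y := by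
  rw [invLaplacianDeriv_apply, ← integral_sub_left_eq_self _ volume x]
  simp

theorem contDiff_comp_const_sub {v : Rn n → ℝ} (hv : ContDiff ℝ 1 v) (x : Rn n) :
    ContDiff ℝ 1 fun y => v (x - y) := hv.comp (contDiff_const.sub contDiff_id)

theorem hasCompactSupport_comp_const_sub {v : Rn n → ℝ} (hv : HasCompactSupport v) (x : Rn n) :
    HasCompactSupport fun y => v (x - y) := hv.comp_homeomorph (Homeomorph.subLeft x)

theorem invLaplacianDeriv_testPderiv_comm (i j : Fin n) (ψ : 𝓓(whole n, ℝ)) (x : Rn n) :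
    invLaplacianDeriv j (testPderiv i ψ) x = invLaplacianDeriv i (testPderiv j ψ) x := by
  have hψ : ContDiff ℝ 1 ψ := ψ.contDiff.of_le (by simp)
  have h := integral_kernel_mul_pderiv_comm i j (contDiff_comp_const_sub hψ x)
    (hasCompactSupport_comp_const_sub ψ.hasCompactSupport x)
  have hd : ∀ i y, pderiv i (fun y => ψ (x - y)) y = -pderiv i ψ (x - y) := fun i y =>
    pderiv_comp_const_sub i _ (test_differentiable ψ)
  simp_rw [hd, mul_neg, integral_neg, neg_inj] at h
  exact h

theorem sum_invLaplacianDeriv_testPderiv (hn : n ≠ 0) (ψ : 𝓓(whole n, ℝ)) (x : Rn n) :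
    ∑ j, invLaplacianDeriv j (testPderiv j ψ) x = ψ x := by
  have hψ : ContDiff ℝ 1 ψ := ψ.contDiff.of_le (by simp)
  have h := sum_integral_kernel_mul_pderiv hn (contDiff_comp_const_sub hψ x)
    (hasCompactSupport_comp_const_sub ψ.hasCompactSupport x)
  have hd : ∀ i y, pderiv i (fun y => ψ (x - y)) y = -pderiv i ψ (x - y) := fun i y =>
    pderiv_comp_const_sub i _ (test_differentiable ψ)
  simp_rw [hd, mul_neg, integral_neg, Finset.sum_neg_distrib, neg_inj, sub_zero] at h
  exact h

theorem pderiv_invLaplacianDeriv (i j : Fin n) (ψ : 𝓓(whole n, ℝ)) (x : Rn n) :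
    pderiv i (invLaplacianDeriv j ψ) x = invLaplacianDeriv j (testPderiv i ψ) x := by
  have h := ψ.hasCompactSupport.hasFDerivAt_convolution_right
    (ContinuousLinearMap.mul ℝ ℝ) (locallyIntegrable_kernel j)
    (ψ.contDiff.of_le (by simp)) x
  unfold pderiv invLaplacianDeriv
  rw [h.fderiv]
  rw [convolution_precompR_apply _ (locallyIntegrable_kernel j) (ψ.hasCompactSupport.fderiv ℝ)
    (ψ.contDiff.continuous_fderiv (by simp))]
  rfl

theorem invLaplacianDeriv_add (j : Fin n) (φ ψ : 𝓓(whole n, ℝ)) (x : Rn n) :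
    invLaplacianDeriv j (φ + ψ) x = invLaplacianDeriv j φ x + invLaplacianDeriv j ψ x := by
  have hi : ∀ ψ : 𝓓(whole n, ℝ), Integrable fun y => kernel j y * ψ (x - y) := fun ψ =>
    kernel_integrable_mul (by fun_prop) (hasCompactSupport_comp_const_sub ψ.hasCompactSupport x)
  simp_rw [invLaplacianDeriv_apply]
  rw [← integral_add (hi φ) (hi ψ)]
  simp [mul_add]

theorem invLaplacianDeriv_smul (j : Fin n) (c : ℝ) (ψ : 𝓓(whole n, ℝ)) (x : Rn n) :
    invLaplacianDeriv j (c • ψ) x = c * invLaplacianDeriv j ψ x := by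
  simp_rw [invLaplacianDeriv_apply]
  rw [← integral_const_mul]
  congr 1
  ext y
  simp
  ring

/-- `Δ (Δ⁻¹ ∂ⱼψ) = ∂ⱼψ`. -/
theorem sum_pderiv_pderiv_invLaplacianDeriv (j : Fin n) (ψ : 𝓓(whole n, ℝ)) (x : Rn n) :
    ∑ i, pderiv i (pderiv i (invLaplacianDeriv j ψ)) x = pderiv j ψ x := by
  have hn : n ≠ 0 := by rintro rfl; exact j.elim0
  have h1 : ∀ i : Fin n, pderiv i (invLaplacianDeriv j ψ) =
      invLaplacianDeriv i (testPderiv j ψ) := fun i => by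
    ext x
    rw [pderiv_invLaplacianDeriv, invLaplacianDeriv_testPderiv_comm]
  simp_rw [h1, pderiv_invLaplacianDeriv]
  exact sum_invLaplacianDeriv_testPderiv hn (testPderiv j ψ) x

end

end NashForm

namespace NashForm

/-! ### Decay and energy estimates for `Δ⁻¹ ∂ⱼψ` -/

section

variable {n : ℕ}

theorem abs_kernel_le (j : Fin n) {y z : Rn n} (hz : z ≠ 0) (h : ‖y - z‖ ≤ ‖z‖ / 2) :
    |kernel j y| ≤ 2 ^ n * 2 / (n * ballVol n) * (‖z‖ / ‖z‖ ^ n) := by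
  have hn : n ≠ 0 := by rintro rfl; exact j.elim0
  have hω := ballVol_pos n
  have hz' : 0 < ‖z‖ := norm_pos_iff.2 hz
  have h1 : ‖z‖ / 2 ≤ ‖y‖ := by have := norm_sub_norm_le z y; rw [norm_sub_rev] at this; linarith
  have h2 : ‖y‖ ≤ 2 * ‖z‖ := by have := norm_sub_norm_le y z; linarith
  have hn0 : (0 : ℝ) < n := Nat.cast_pos.2 (Nat.pos_of_ne_zero hn)
  rw [kernel, ballVol_eq, abs_div, abs_of_nonneg (show 0 ≤ n * ballVol n * ‖y‖ ^ n by positivity)]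
  calc |y j| / (n * ballVol n * ‖y‖ ^ n) ≤ (2 * ‖z‖) / (n * ballVol n * (‖z‖ / 2) ^ n) := by
        gcongr
        exact (PiLp.norm_apply_le y j).trans h2
    _ = _ := by rw [div_pow]; field_simp

/-- The increment is split algebraically into those of the numerator and of ‖·‖ⁿ. The hypothesis
keeps ‖y‖ between ‖z‖/2 and 2‖z‖. -/
theorem abs_kernel_sub_kernel_le (j : Fin n) {y z : Rn n} (hz : z ≠ 0) (h : ‖y - z‖ ≤ ‖z‖ / 2) :
    |kernel j y - kernel j z| ≤
      2 ^ n * (1 + n * 2 ^ (n - 1)) / (n * ballVol n) * (‖y - z‖ / ‖z‖ ^ n) := by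
  have hn : n ≠ 0 := by rintro rfl; exact j.elim0
  have hω := ballVol_pos n
  have hz' : 0 < ‖z‖ := norm_pos_iff.2 hz
  have h1 : ‖z‖ / 2 ≤ ‖y‖ := by have := norm_sub_norm_le z y; rw [norm_sub_rev] at this; linarith
  have h2 : ‖y‖ ≤ 2 * ‖z‖ := by have := norm_sub_norm_le y z; linarith
  have hy' : 0 < ‖y‖ := by linarith
  have hn0 : (0 : ℝ) < n := Nat.cast_pos.2 (Nat.pos_of_ne_zero hn)
  have key : kernel j y - kernel j z = (n * ballVol n)⁻¹ * ((y j - z j) * (‖y‖ ^ n)⁻¹ +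
      z j * (‖z‖ ^ n - ‖y‖ ^ n) * ((‖y‖ ^ n)⁻¹ * (‖z‖ ^ n)⁻¹)) := by
    rw [kernel, kernel, ballVol_eq]
    field_simp
    ring
  have h3 : |‖z‖ ^ n - ‖y‖ ^ n| ≤ ‖y - z‖ * n * (2 * ‖z‖) ^ (n - 1) := by
    refine (abs_pow_sub_pow_le _ _ n).trans ?_
    gcongr
    · rw [norm_sub_rev]; exact abs_norm_sub_norm_le z y
    · rw [abs_norm, abs_norm]; exact max_le (by linarith) h2
  have h4 : (‖y‖ ^ n)⁻¹ ≤ 2 ^ n * (‖z‖ ^ n)⁻¹ := by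
    calc (‖y‖ ^ n)⁻¹ ≤ ((‖z‖ / 2) ^ n)⁻¹ := by gcongr
      _ = _ := by rw [div_pow, inv_div, div_eq_mul_inv]
  have h5 : |y j - z j| ≤ ‖y - z‖ := PiLp.norm_apply_le (y - z) j
  have h6 : |z j| ≤ ‖z‖ := PiLp.norm_apply_le z j
  rw [key, abs_mul, abs_of_pos (inv_pos.2 (mul_pos hn0 hω))]
  have hpow : ‖z‖ ^ n = ‖z‖ ^ (n - 1) * ‖z‖ := by
    rw [← pow_succ, Nat.sub_add_cancel (Nat.one_le_iff_ne_zero.2 hn)]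
  calc _ ≤ (n * ballVol n)⁻¹ * (‖y - z‖ * (2 ^ n * (‖z‖ ^ n)⁻¹) +
        ‖z‖ * (‖y - z‖ * n * (2 * ‖z‖) ^ (n - 1)) * ((2 ^ n * (‖z‖ ^ n)⁻¹) * (‖z‖ ^ n)⁻¹)) := by
        refine mul_le_mul_of_nonneg_left ((abs_add_le _ _).trans ?_) (by positivity)
        rw [abs_mul, abs_mul, abs_mul, abs_of_pos (inv_pos.2 (pow_pos hy' n)),
          abs_of_pos (show 0 < (‖y‖ ^ n)⁻¹ * (‖z‖ ^ n)⁻¹ by positivity)]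
        gcongr
    _ = _ := by
        rw [hpow, mul_pow]
        field_simp

/-- Here m counts vanishing moments. For m = 0 the size of the kernel gives the decay ρ^{1-n},
written ρ/ρⁿ. For m = 1 the value of the kernel at x - x₀ may be subtracted, which gains δ/ρ. -/
theorem exists_decay_bound (n m : ℕ) : ∃ C : ℝ, 0 ≤ C ∧ ∀ (x₀ : Rn n) (δ : ℝ) (ψ : 𝓓(whole n, ℝ)),
    0 < δ → tsupport ψ ⊆ Metric.closedBall x₀ δ → (m = 0 ∨ m = 1 ∧ ∫ x, ψ x = 0) →
    ∀ (j : Fin n) (x : Rn n), 2 * δ ≤ ‖x - x₀‖ → |invLaplacianDeriv j ψ x| ≤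
      C * (δ / ‖x - x₀‖) ^ m * (‖x - x₀‖ / ‖x - x₀‖ ^ n) * ∫ y, |ψ y| := by
  have hω := ballVol_pos n
  refine ⟨max (2 ^ n * 2 / (n * ballVol n)) (2 ^ n * (1 + n * 2 ^ (n - 1)) / (n * ballVol n)),
    le_max_of_le_left (by positivity), fun x₀ δ ψ hδ hψ hm j x hx => ?_⟩
  have hz0 : 0 < ‖x - x₀‖ := by linarith
  have hz : x - x₀ ≠ 0 := norm_pos_iff.1 hz0
  have hI : Integrable (fun y => ψ y) := test_integrable ψ
  have hclose : ∀ y, ψ y ≠ 0 → ‖(x - y) - (x - x₀)‖ ≤ δ := by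
    intro y hy
    have := hψ (subset_tsupport (⇑ψ) hy)
    rw [mem_closedBall_iff_norm] at this
    rwa [sub_sub_sub_cancel_left, norm_sub_rev]
  rcases hm with rfl | ⟨rfl, h0⟩
  · rw [invLaplacianDeriv_apply', pow_zero, mul_one, ← integral_const_mul, ← Real.norm_eq_abs]
    refine (norm_integral_le_of_norm_le (hI.abs.const_mul _) (Eventually.of_forall fun y => ?_))
    rw [norm_mul, Real.norm_eq_abs, Real.norm_eq_abs]
    by_cases hy : ψ y = 0
    · simp [hy]
    · gcongr
      refine (abs_kernel_le j hz (y := x - y) ((hclose y hy).trans (by linarith))).trans ?_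
      gcongr
      exact le_max_left _ _
  · have h1 : invLaplacianDeriv j ψ x = ∫ y, (kernel j (x - y) - kernel j (x - x₀)) * ψ y := by
      have hK : Integrable fun y => kernel j (x - y) * ψ y := by
        have h2 : Integrable fun y => kernel j y * ψ (x - y) :=
          kernel_integrable_mul (by fun_prop)
            (hasCompactSupport_comp_const_sub ψ.hasCompactSupport x)
        simpa using h2.comp_sub_left x
      simp_rw [sub_mul]
      rw [integral_sub hK (hI.const_mul _), integral_const_mul, h0, mul_zero, sub_zero,
        invLaplacianDeriv_apply']
    rw [h1, ← integral_const_mul, ← Real.norm_eq_abs]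
    refine (norm_integral_le_of_norm_le (hI.abs.const_mul _) (Eventually.of_forall fun y => ?_))
    rw [norm_mul, Real.norm_eq_abs, Real.norm_eq_abs]
    by_cases hy : ψ y = 0
    · simp [hy]
    · gcongr
      refine (abs_kernel_sub_kernel_le j hz (y := x - y)
        ((hclose y hy).trans (by linarith))).trans ?_
      rw [mul_assoc]
      have h3 : (δ / ‖x - x₀‖) ^ 1 * (‖x - x₀‖ / ‖x - x₀‖ ^ n) = δ / ‖x - x₀‖ ^ n := by
        field_simp
      rw [h3]
      gcongr
      · exact le_max_right _ _
      · exact hclose y hy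

/-- The test function `χ Δ⁻¹ ∂ⱼψ`. -/
noncomputable def localized (χ : 𝓓(whole n, ℝ)) (j : Fin n) (ψ : 𝓓(whole n, ℝ)) : 𝓓(whole n, ℝ) :=
  testOf (fun x => χ x * invLaplacianDeriv j ψ x)
    (χ.contDiff.mul (contDiff_invLaplacianDeriv j ψ)) χ.hasCompactSupport.mul_right

theorem localized_apply (χ : 𝓓(whole n, ℝ)) (j : Fin n) (ψ : 𝓓(whole n, ℝ)) (x : Rn n) :
    localized χ j ψ x = χ x * invLaplacianDeriv j ψ x := rfl

theorem tsupport_localized_subset (χ : 𝓓(whole n, ℝ)) (j : Fin n) (ψ : 𝓓(whole n, ℝ)) :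
    tsupport (localized χ j ψ) ⊆ tsupport χ :=
  closure_mono (Function.support_mul_subset_left _ _)

/-- The difference of the two sides of the hypothesis factors as (X-a-b)(X+a). -/
theorem le_add_of_sq_le {X a b : ℝ} (ha : 0 ≤ a) (hb : 0 ≤ b)
    (h : X ^ 2 ≤ a ^ 2 + b * (a + X)) : X ≤ a + b := by
  by_contra! hc
  nlinarith [mul_nonneg ha hb]

/-- A Caccioppoli estimate. For w = Δ⁻¹∂ⱼψ one has ∫|∇(χw)|² = ∫|∇χ|²w² + ∫∇w·∇(χ²w), and Δw = ∂ⱼψ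
turns the last integral into ∫ψ ∂ⱼ(χ²w). After absorption only w on the support of ∇χ and ψ on the
support of χ matter; no bound on ∇w is required. -/
theorem sqrt_gradSq_localized_le (χ : 𝓓(whole n, ℝ)) (j : Fin n) (ψ : 𝓓(whole n, ℝ)) :
    √(gradSq (localized χ j ψ)) ≤
      √(∫ x, (∑ i, pderiv i χ x ^ 2) * invLaplacianDeriv j ψ x ^ 2) +
        √(∫ x, (χ x * ψ x) ^ 2) := by
  set w := invLaplacianDeriv j ψ with hw
  set h := localized χ j ψ with hh
  have hwC := contDiff_invLaplacianDeriv j ψ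
  have hwd : Differentiable ℝ w := hwC.differentiable (by simp)
  have hχd := test_differentiable χ
  have hhd := test_differentiable h
  set g := testMul χ h with hg
  have hg1 : ContDiff ℝ 1 g := g.contDiff.of_le (by simp)
  have hdh : ∀ i x, pderiv i h x = χ x * pderiv i w x + w x * pderiv i χ x := fun i x =>
    pderiv_mul i (hχd x) (hwd x)
  have hdg : ∀ i x, pderiv i g x = χ x * pderiv i h x + h x * pderiv i χ x := fun i x =>
    pderiv_mul i (hχd x) (hhd x)
  have hdχ : ∀ i, Continuous (pderiv i χ) := fun i => (testPderiv i χ).continuous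
  have hdw : ∀ i, ContDiff ℝ 1 (pderiv i w) := fun i => (contDiff_pderiv i hwC).of_le (by simp)
  have hdχc : ∀ i, HasCompactSupport (pderiv i χ) := fun i => (testPderiv i χ).hasCompactSupport
  have hu : ∀ i, MemLp (fun x => pderiv i χ x * w x) 2 := fun i =>
    ((hdχ i).mul hwC.continuous).memLp_of_hasCompactSupport (hdχc i).mul_right
  have hχψ : MemLp (fun x => χ x * ψ x) 2 := test_memLp (testMul χ ψ)
  set a := √(∫ x, (∑ i, pderiv i χ x ^ 2) * w x ^ 2) with ha
  set b := √(∫ x, (χ x * ψ x) ^ 2) with hb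
  have hsum : ∀ x, (∑ i, pderiv i χ x ^ 2) * w x ^ 2 = ∑ i, (pderiv i χ x * w x) ^ 2 := fun x => by
    rw [Finset.sum_mul]; simp_rw [mul_pow]
  have hai : Integrable fun x => (∑ i, pderiv i χ x ^ 2) * w x ^ 2 := by
    simp_rw [hsum]
    exact integrable_finsetSum _ fun i _ => (hu i).integrable_sq
  have hi2 : ∀ i, Integrable fun x => pderiv i w x * pderiv i g x := fun i =>
    (((hdw i).continuous.mul (testPderiv i g).continuous)).integrable_of_hasCompactSupport
      (testPderiv i g).hasCompactSupport.mul_left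
  have h1 : gradSq h = a ^ 2 + ∑ i, ∫ x, pderiv i w x * pderiv i g x := by
    rw [ha, Real.sq_sqrt (integral_nonneg fun x => by positivity),
      ← integral_finsetSum _ fun i _ => hi2 i, ← integral_add hai
        (integrable_finsetSum _ fun i _ => hi2 i), gradSq]
    refine integral_congr_ae (Eventually.of_forall fun x => ?_)
    simp only
    rw [Finset.sum_mul, ← Finset.sum_add_distrib]
    refine Finset.sum_congr rfl fun i _ => ?_
    rw [hdg, hdh, show h x = χ x * w x from rfl]
    ring
  have hi3 : ∀ i ∈ Finset.univ, Integrable fun x => pderiv i (pderiv i w) x * g x := fun i _ =>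
    ((continuous_pderiv i (hdw i)).mul g.continuous).integrable_of_hasCompactSupport
      g.hasCompactSupport.mul_left
  have hψ1 : ContDiff ℝ 1 ψ := ψ.contDiff.of_le (by simp)
  have h2 : ∑ i, ∫ x, pderiv i w x * pderiv i g x = ∫ x, ψ x * pderiv j g x := by
    rw [integral_mul_pderiv j hψ1 hg1 g.hasCompactSupport,
      Finset.sum_congr rfl fun i _ => integral_mul_pderiv i (hdw i) hg1 g.hasCompactSupport,
      Finset.sum_neg_distrib, ← integral_finsetSum _ hi3]
    congr 2
    ext x
    rw [← Finset.sum_mul, sum_pderiv_pderiv_invLaplacianDeriv]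
  have hψh : MemLp (pderiv j h) 2 := test_memLp (testPderiv j h)
  have h3 : ∫ x, ψ x * pderiv j g x =
      (∫ x, (χ x * ψ x) * (pderiv j χ x * w x)) + ∫ x, (χ x * ψ x) * pderiv j h x := by
    refine Eq.trans ?_ (integral_add (hχψ.integrable_mul (hu j)) (hχψ.integrable_mul hψh))
    refine integral_congr_ae (Eventually.of_forall fun x => ?_)
    change ψ x * pderiv j g x = χ x * ψ x * (pderiv j χ x * w x) + χ x * ψ x * pderiv j h x
    rw [hdg, show h x = χ x * w x from rfl]
    ring
  have h4 : ∫ x, (χ x * ψ x) * (pderiv j χ x * w x) ≤ b * a := by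
    refine (le_abs_self _).trans ((abs_integral_mul_le_sqrt hχψ (hu j)).trans ?_)
    refine mul_le_mul_of_nonneg_left (Real.sqrt_le_sqrt ?_) (Real.sqrt_nonneg _)
    refine integral_mono (hu j).integrable_sq hai fun x => ?_
    rw [hsum]
    exact Finset.single_le_sum (f := fun i => (pderiv i χ x * w x) ^ 2)
      (fun i _ => sq_nonneg _) (Finset.mem_univ j)
  have h5 : ∫ x, (χ x * ψ x) * pderiv j h x ≤ b * √(gradSq h) := by
    refine (le_abs_self _).trans ((abs_integral_mul_le_sqrt hχψ hψh).trans ?_)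
    exact mul_le_mul_of_nonneg_left (Real.sqrt_le_sqrt (integral_pderiv_sq_le_gradSq j h))
      (Real.sqrt_nonneg _)
  refine le_add_of_sq_le (Real.sqrt_nonneg _) (Real.sqrt_nonneg _) ?_
  rw [Real.sq_sqrt (gradSq_nonneg h), mul_add]
  linarith

end

end NashForm

namespace NashForm

/-! ### Existence of the limit defining `∇ Δ⁻¹ Q` -/

section

variable {n : ℕ} {Q : Distr n} {K lam : ℝ}

theorem sq_integral_abs_le {x₀ : Rn n} {δ : ℝ} (hδ : 0 < δ) (ψ : 𝓓(whole n, ℝ))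
    (hψ : tsupport ψ ⊆ Metric.closedBall x₀ δ) :
    (∫ x, |ψ x|) ^ 2 ≤ ballVol n * δ ^ n * ∫ x, ψ x ^ 2 := by
  have hω := ballVol_pos n
  have h3 : 0 ≤ ∫ x, ψ x ^ 2 := integral_nonneg fun x => sq_nonneg _
  have h5 : 0 ≤ ∫ x, |ψ x| := integral_nonneg fun x => abs_nonneg _
  calc _ ≤ (√(ballVol n * δ ^ n) * √(∫ x, ψ x ^ 2)) ^ 2 := by
        gcongr
        exact integral_abs_le_of_tsupport ψ hδ.le hψ
    _ = _ := by rw [mul_pow, Real.sq_sqrt (by positivity), Real.sq_sqrt h3]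

theorem div_pow_self_le (hn : n ≠ 0) {r ρ : ℝ} (hr : 0 < r) (h : r ≤ ρ) :
    ρ / ρ ^ n ≤ r / r ^ n := by
  obtain ⟨k, rfl⟩ := Nat.exists_eq_succ_of_ne_zero hn
  have hρ := hr.trans_le h
  have e : ∀ s : ℝ, 0 < s → s / s ^ (k + 1) = (s ^ k)⁻¹ := fun s hs => by
    rw [pow_succ]; field_simp
  rw [Nat.succ_eq_add_one, e r hr, e ρ hρ]
  gcongr

/-- The Caccioppoli estimate combined with the decay of Δ⁻¹∂ⱼψ beyond radius r. The term with A
comes from ∇χ, that with B from χ on the support of ψ. For a difference of two cutoffs that are both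
1 there, B = 0. -/
theorem exists_annulus_bound (n m : ℕ) : ∃ C : ℝ, 0 ≤ C ∧
    ∀ (x₀ : Rn n) (δ : ℝ) (ψ : 𝓓(whole n, ℝ)),
    0 < δ → tsupport ψ ⊆ Metric.closedBall x₀ δ → (m = 0 ∨ m = 1 ∧ ∫ x, ψ x = 0) →
    ∀ (j : Fin n) (χ : 𝓓(whole n, ℝ)) (r κ A B : ℝ), 2 * δ ≤ r → 0 < κ → 0 ≤ A → 0 ≤ B →
      tsupport χ ⊆ Metric.closedBall x₀ (κ * r) →
      (∀ i x, ‖x - x₀‖ < r → pderiv i χ x = 0) → (∀ i x, |pderiv i χ x| ≤ A / r) →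
      (∀ x ∈ Metric.closedBall x₀ δ, |χ x| ≤ B) →
      √(gradSq (localized χ j ψ)) ≤
        (C * A * √(κ ^ n) * √((δ / r) ^ (n + 2 * m)) + B) * √(∫ x, ψ x ^ 2) := by
  obtain ⟨C, hC0, hC⟩ := exists_decay_bound n m
  have hω := ballVol_pos n
  refine ⟨√n * C * ballVol n, by positivity,
    fun x₀ δ ψ hδ hψ hm j χ r κ A B hr hκ hA hB hχ hχ0 hχA hχB => ?_⟩
  have hn : n ≠ 0 := by rintro rfl; exact j.elim0
  have hr0 : 0 < r := by linarith
  set S := ∫ x, ψ x ^ 2 with hS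
  have hS0 : 0 ≤ S := integral_nonneg fun x => sq_nonneg _
  refine (sqrt_gradSq_localized_le χ j ψ).trans ?_
  rw [add_mul]
  refine add_le_add ?_ ?_
  · set I := ∫ x, |ψ x| with hI
    have hI0 : 0 ≤ I := integral_nonneg fun x => abs_nonneg _
    have hpt : ∀ x, (∑ i, pderiv i χ x ^ 2) * invLaplacianDeriv j ψ x ^ 2 ≤
        (n * (A / r) ^ 2) * (C * (δ / r) ^ m * (r / r ^ n) * I) ^ 2 := by
      intro x
      rcases lt_or_ge ‖x - x₀‖ r with h | h
      · simp only [hχ0 _ x h]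
        simp only [ne_eq, OfNat.ofNat_ne_zero, not_false_eq_true, zero_pow, Finset.sum_const_zero,
          zero_mul]
        positivity
      · have hx := hr0.trans_le h
        have h1 : ∑ i, pderiv i χ x ^ 2 ≤ n * (A / r) ^ 2 := by
          calc ∑ i, pderiv i χ x ^ 2 ≤ ∑ _i : Fin n, (A / r) ^ 2 :=
                Finset.sum_le_sum fun i _ => by
                  rw [← sq_abs]; exact pow_le_pow_left₀ (abs_nonneg _) (hχA i x) 2
            _ = _ := by simp
        have h2 : |invLaplacianDeriv j ψ x| ≤ C * (δ / r) ^ m * (r / r ^ n) * I := by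
          refine (hC x₀ δ ψ hδ hψ hm j x (hr.trans h)).trans ?_
          have := div_pow_self_le hn hr0 h
          gcongr
        rw [← sq_abs (invLaplacianDeriv j ψ x)]
        gcongr
    have h0 : ∀ x, x ∉ Metric.closedBall x₀ (κ * r) →
        (∑ i, pderiv i χ x ^ 2) * invLaplacianDeriv j ψ x ^ 2 = 0 := fun x hx => by
      simp [pderiv_eq_zero_of_notMem _ fun h => hx (hχ h)]
    have hint : Integrable fun x => (∑ i, pderiv i χ x ^ 2) * invLaplacianDeriv j ψ x ^ 2 := by
      refine Continuous.integrable_of_hasCompactSupport ?_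
        (HasCompactSupport.intro (isCompact_closedBall x₀ (κ * r)) h0)
      have : ∀ i, Continuous (pderiv i χ) := fun i => (testPderiv i χ).continuous
      exact (continuous_finsetSum _ fun i _ => (this i).pow 2).mul
        ((contDiff_invLaplacianDeriv j ψ).continuous.pow 2)
    have h3 := integral_le_of_support_closedBall (by positivity) hpt h0 hint
    have h4 := sq_integral_abs_le hδ ψ hψ
    have h5 : ∫ x, (∑ i, pderiv i χ x ^ 2) * invLaplacianDeriv j ψ x ^ 2 ≤
        (√n * C * ballVol n * A) ^ 2 * κ ^ n * (δ / r) ^ (n + 2 * m) * S := by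
      refine h3.trans ?_
      calc _ = n * (A / r) ^ 2 * (C * (δ / r) ^ m * (r / r ^ n)) ^ 2 * (ballVol n * (κ * r) ^ n) *
            I ^ 2 := by ring
        _ ≤ n * (A / r) ^ 2 * (C * (δ / r) ^ m * (r / r ^ n)) ^ 2 * (ballVol n * (κ * r) ^ n) *
            (ballVol n * δ ^ n * S) := by gcongr
        _ = _ := by
            rw [show (√n * C * ballVol n * A) ^ 2 = √n ^ 2 * (C * ballVol n * A) ^ 2 by ring,
              Real.sq_sqrt (Nat.cast_nonneg n), pow_add, pow_mul', mul_pow κ, div_pow δ r n]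
            field_simp
    refine (Real.sqrt_le_sqrt h5).trans_eq ?_
    rw [Real.sqrt_mul (by positivity), Real.sqrt_mul (by positivity), Real.sqrt_mul (by positivity),
      Real.sqrt_sq (by positivity)]
  · rw [show B * √S = √(B ^ 2 * S) by rw [Real.sqrt_mul (by positivity), Real.sqrt_sq hB]]
    refine Real.sqrt_le_sqrt ?_
    rw [hS, ← integral_const_mul]
    refine integral_mono (test_memLp (testMul χ ψ)).integrable_sq
      ((test_memLp ψ).integrable_sq.const_mul _) fun x => ?_
    simp only
    by_cases hx : ψ x = 0
    · simp [hx]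
    · rw [mul_pow, ← sq_abs (χ x)]
      have := hχB x (hψ (subset_tsupport (⇑ψ) hx))
      gcongr

/-- At radius tδ the local bound loses t^{lam/2}, while the energy of the annulus gains
t^{-(n+2m)/2}. The net exponent is negative exactly when lam < n+2m. -/
theorem LocalBound.exists_annulus_bound (hQ : LocalBound Q K lam) (m : ℕ) : ∃ C : ℝ, 0 ≤ C ∧
    ∀ (x₀ : Rn n) (δ : ℝ) (ψ : 𝓓(whole n, ℝ)),
    0 < δ → tsupport ψ ⊆ Metric.closedBall x₀ δ → (m = 0 ∨ m = 1 ∧ ∫ x, ψ x = 0) →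
    ∀ (j : Fin n) (χ : 𝓓(whole n, ℝ)) (t κ A B : ℝ), 2 ≤ t → 0 < κ → 0 ≤ A → 0 ≤ B →
      tsupport χ ⊆ Metric.closedBall x₀ (κ * (t * δ)) →
      (∀ i x, ‖x - x₀‖ < t * δ → pderiv i χ x = 0) → (∀ i x, |pderiv i χ x| ≤ A / (t * δ)) →
      (∀ x ∈ Metric.closedBall x₀ δ, |χ x| ≤ B) →
      ‖Q (localized χ j ψ)‖ ≤
        K * κ ^ (lam / 2) * (C * A * √(κ ^ n) * t ^ (-((n + 2 * m - lam) / 2)) +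
          B * t ^ (lam / 2)) * (δ ^ (lam / 2) * √(∫ x, ψ x ^ 2)) := by
  obtain ⟨C, hC0, hC⟩ := NashForm.exists_annulus_bound n m
  refine ⟨C, hC0, fun x₀ δ ψ hδ hψ hm j χ t κ A B ht hκ hA hB hχ hχ0 hχA hχB => ?_⟩
  have ht0 : 0 < t := by linarith
  have h1 := hC x₀ δ ψ hδ hψ hm j χ (t * δ) κ A B (by gcongr) hκ hA hB hχ hχ0 hχA hχB
  have h2 := hQ.2 x₀ (κ * (t * δ)) (by positivity) (localized χ j ψ)
    ((tsupport_localized_subset χ j ψ).trans hχ)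
  have hK := hQ.1
  refine h2.trans ((mul_le_mul_of_nonneg_left h1 (by positivity)).trans_eq ?_)
  have h3 : δ / (t * δ) = t⁻¹ := by field_simp
  have h4 : √((t⁻¹) ^ (n + 2 * m)) = t ^ (-((n + 2 * m : ℝ) / 2)) := by
    rw [Real.sqrt_eq_rpow, ← Real.rpow_natCast, ← Real.rpow_mul (by positivity),
      Real.inv_rpow ht0.le, ← Real.rpow_neg ht0.le]
    congr 1
    push_cast
    ring
  have h5 : t ^ (-((n + 2 * m - lam) / 2)) = t ^ (lam / 2) * t ^ (-((n + 2 * m : ℝ) / 2)) := by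
    rw [← Real.rpow_add ht0]; congr 1; ring
  rw [h3, h4, h5, Real.mul_rpow hκ.le (by positivity), Real.mul_rpow ht0.le hδ.le]
  ring

theorem localized_sub (χ χ' : 𝓓(whole n, ℝ)) (j : Fin n) (ψ : 𝓓(whole n, ℝ)) :
    localized (χ - χ') j ψ = localized χ j ψ - localized χ' j ψ := by
  ext x
  simp [localized_apply, sub_mul]

theorem truncated_eq_localized (η : 𝓓(whole n, ℝ)) {R : ℝ} (hR : 0 < R) (j : Fin n)
    (ψ : 𝓓(whole n, ℝ)) : truncated η R j ψ = localized (rescale η 0 R) j ψ := by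
  ext x
  rw [localized_apply, rescale_apply _ _ hR, sub_zero, truncated, dif_neg hR.ne']
  rfl

theorem pderiv_test_sub (χ χ' : 𝓓(whole n, ℝ)) (i : Fin n) (x : Rn n) :
    pderiv i (χ - χ') x = pderiv i χ x - pderiv i χ' x :=
  pderiv_sub i (test_differentiable χ x) (test_differentiable χ' x)

theorem pderiv_eq_zero_of_eqOn_ball {χ : Rn n → ℝ} {x₀ : Rn n} {r c : ℝ}
    (h : ∀ x, ‖x - x₀‖ < r → χ x = c) (i : Fin n) {x : Rn n} (hx : ‖x - x₀‖ < r) :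
    pderiv i χ x = 0 := by
  refine pderiv_eq_zero_of_eventually (c := c) i ?_
  have : Metric.ball x₀ r ∈ 𝓝 x := Metric.isOpen_ball.mem_nhds (mem_ball_iff_norm.2 hx)
  filter_upwards [this] with y hy
  exact h y (mem_ball_iff_norm.1 hy)

/-- The dyadic cutoffs of `Δ⁻¹ ∂ⱼψ` converge, geometrically fast. -/
theorem LocalBound.exists_dyadic_bound (hQ : LocalBound Q K lam) (m : ℕ) (hlam : lam < n + 2 * m) :
    ∃ C : ℝ, 0 ≤ C ∧ ∀ (x₀ : Rn n) (δ : ℝ) (ψ : 𝓓(whole n, ℝ)),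
    0 < δ → tsupport ψ ⊆ Metric.closedBall x₀ δ → (m = 0 ∨ m = 1 ∧ ∫ x, ψ x = 0) →
    ∀ j : Fin n, ∃ ℓ : ℂ, ‖ℓ‖ ≤ C * (δ ^ (lam / 2) * √(∫ x, ψ x ^ 2)) ∧
      Tendsto (fun k : ℕ => Q (localized (cutoffAt x₀ (2 ^ (k + 1) * δ)) j ψ)) atTop (𝓝 ℓ) := by
  obtain ⟨C, hC0, hC⟩ := hQ.exists_annulus_bound m
  obtain ⟨M, hM0, hM⟩ := exists_pderiv_cutoffAt_bound n
  -- The hypothesis lam < n+2m says γ > 0, that is, the ratio q = 2^{-γ} of the series is less than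
  -- 1.
  set γ := (n + 2 * m - lam) / 2 with hγ
  have hγ0 : 0 < γ := by rw [hγ]; linarith
  set q : ℝ := 2 ^ (-γ) with hq
  have hq0 : 0 < q := by positivity
  have hq1 : q < 1 := Real.rpow_lt_one_of_one_lt_of_neg one_lt_two (by linarith)
  have hK := hQ.1
  set E₀ := K * 2 ^ (lam / 2) * (C * M * √(2 ^ n) * 2 ^ (-γ) + 1 * 2 ^ (lam / 2)) with hE₀
  set E₁ := K * 4 ^ (lam / 2) * (C * (2 * M) * √(4 ^ n)) with hE₁
  have hE₀0 : 0 ≤ E₀ := by positivity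
  have hE₁0 : 0 ≤ E₁ := by positivity
  have h1q : 0 < 1 - q := by linarith
  refine ⟨E₀ + E₁ / (1 - q), by positivity, fun x₀ δ ψ hδ hψ hm j => ?_⟩
  set S := δ ^ (lam / 2) * √(∫ x, ψ x ^ 2) with hS
  have hS0 : 0 ≤ S := by positivity
  set a : ℕ → ℂ := fun k => Q (localized (cutoffAt x₀ (2 ^ (k + 1) * δ)) j ψ) with ha
  have hr : ∀ k : ℕ, 0 < 2 ^ (k + 1) * δ := fun k => by positivity
  have hc : ∀ (k : ℕ) x, ‖x - x₀‖ < 2 ^ (k + 1) * δ → cutoffAt x₀ (2 ^ (k + 1) * δ) x = 1 :=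
    fun k x hx => cutoffAt_eq_one (hr k) hx.le
  have ha0 : ‖a 0‖ ≤ E₀ * S := by
    refine hC x₀ δ ψ hδ hψ hm j _ 2 2 M 1 le_rfl two_pos hM0 zero_le_one ?_ ?_ ?_ ?_
    · simpa using tsupport_cutoffAt (hr 0)
    · intro i x hx
      exact pderiv_eq_zero_of_eqOn_ball (hc 0) i (by simpa using hx)
    · intro i x
      simpa [div_eq_mul_inv] using hM x₀ _ (hr 0) i x
    · intro x _
      rw [abs_of_nonneg (cutoffAt_nonneg (hr 0))]
      exact cutoffAt_le_one (hr 0)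
  -- The difference of consecutive cutoffs vanishes where both are 1, in particular on the support
  -- of ψ; hence B = 0. Its support has radius 4 times the inner radius of the annulus.
  have hstep : ∀ k, dist (a k) (a (k + 1)) ≤ E₁ * S * q ^ k := by
    intro k
    have hmono : 2 ^ (k + 1) * δ ≤ 2 ^ (k + 1 + 1) * δ := by
      gcongr
      · norm_num
      · omega
    rw [dist_eq_norm, norm_sub_rev]
    have h1 : a (k + 1) - a k = Q (localized (cutoffAt x₀ (2 ^ (k + 1 + 1) * δ) -
        cutoffAt x₀ (2 ^ (k + 1) * δ)) j ψ) := by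
      rw [localized_sub, map_sub]
    have hone : ∀ x, ‖x - x₀‖ < 2 ^ (k + 1) * δ → (cutoffAt x₀ (2 ^ (k + 1 + 1) * δ) -
        cutoffAt x₀ (2 ^ (k + 1) * δ)) x = 0 := fun x hx => by
      change cutoffAt x₀ (2 ^ (k + 1 + 1) * δ) x - cutoffAt x₀ (2 ^ (k + 1) * δ) x = 0
      rw [hc k x hx, hc (k + 1) x (hx.trans_le hmono), sub_self]
    rw [h1]
    have h2k : (2 : ℝ) ≤ 2 ^ (k + 1) := by
      rw [pow_succ]; linarith [one_le_pow₀ (n := k) one_le_two (M₀ := ℝ)]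
    refine (hC x₀ δ ψ hδ hψ hm j _ (2 ^ (k + 1)) 4 (2 * M) 0 h2k
      four_pos (by positivity) le_rfl ?_ ?_ ?_ ?_).trans ?_
    · refine (tsupport_sub _ _).trans (Set.union_subset ?_ ?_)
      · refine (tsupport_cutoffAt (hr (k + 1))).trans (Metric.closedBall_subset_closedBall ?_)
        rw [pow_succ 2 (k + 1)]
        linarith
      · refine (tsupport_cutoffAt (hr k)).trans (Metric.closedBall_subset_closedBall ?_)
        linarith [hr k]
    · intro i x hx
      exact pderiv_eq_zero_of_eqOn_ball hone i hx
    · intro i x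
      rw [pderiv_test_sub]
      refine (abs_sub _ _).trans ?_
      have h3 := hM x₀ _ (hr k) i x
      have h4 := hM x₀ _ (hr (k + 1)) i x
      have h5 : M * (2 ^ (k + 1 + 1) * δ)⁻¹ ≤ M * (2 ^ (k + 1) * δ)⁻¹ := by
        have := hr k
        gcongr
      rw [div_eq_mul_inv]
      linarith
    · intro x hx
      rw [hone x, abs_zero]
      rw [mem_closedBall_iff_norm] at hx
      refine hx.trans_lt ?_
      nlinarith
    · rw [zero_mul, add_zero]
      have h6 : ((2 : ℝ) ^ (k + 1)) ^ (-γ) = q ^ (k + 1) := by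
        rw [hq, ← Real.rpow_natCast, ← Real.rpow_mul zero_le_two, mul_comm, Real.rpow_mul zero_le_two,
          Real.rpow_natCast]
      rw [h6]
      have h7 : q ^ (k + 1) ≤ q ^ k := pow_le_pow_of_le_one hq0.le hq1.le (Nat.le_succ k)
      calc _ = E₁ * S * q ^ (k + 1) := by rw [hE₁, hS]; ring
        _ ≤ _ := by gcongr
  obtain ⟨ℓ, hℓ⟩ := cauchySeq_tendsto_of_complete (cauchySeq_of_le_geometric q _ hq1 hstep)
  refine ⟨ℓ, ?_, hℓ⟩
  have h1 := dist_le_of_le_geometric_of_tendsto₀ q _ hq1 hstep hℓ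
  rw [dist_eq_norm] at h1
  have h2 : ‖ℓ‖ ≤ ‖a 0‖ + ‖a 0 - ℓ‖ := by
    have := norm_sub_norm_le ℓ (a 0)
    rw [norm_sub_rev] at this
    linarith
  calc ‖ℓ‖ ≤ E₀ * S + E₁ * S / (1 - q) := by linarith
    _ = _ := by ring

/-- All the cutoffs lead to the same limit. -/
theorem LocalBound.tendsto_truncated (hQ : LocalBound Q K lam) {m : ℕ} (hlam : lam < n + 2 * m)
    {x₀ : Rn n} {δ : ℝ} {ψ : 𝓓(whole n, ℝ)} (hδ : 0 < δ)
    (hψ : tsupport ψ ⊆ Metric.closedBall x₀ δ) (hm : m = 0 ∨ m = 1 ∧ ∫ x, ψ x = 0) {j : Fin n}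
    {ℓ : ℂ} (hℓ : Tendsto (fun k : ℕ => Q (localized (cutoffAt x₀ (2 ^ (k + 1) * δ)) j ψ))
      atTop (𝓝 ℓ)) {η : 𝓓(whole n, ℝ)} (hη : ∀ᶠ x in 𝓝 (0 : Rn n), η x = 1) :
    Tendsto (fun R : ℝ => Q (truncated η R j ψ)) atTop (𝓝 ℓ) := by
  obtain ⟨C, hC0, hC⟩ := hQ.exists_annulus_bound m
  obtain ⟨M, hM0, hM⟩ := exists_pderiv_cutoffAt_bound n
  obtain ⟨M', hM'0, hM'⟩ := exists_pderiv_bound η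
  obtain ⟨ε, hε, hηε⟩ := Metric.eventually_nhds_iff_ball.1 hη
  obtain ⟨ρ, hρ0, hρ⟩ := η.hasCompactSupport.isCompact.isBounded.subset_closedBall_lt 0 (0 : Rn n)
  set γ := (n + 2 * m - lam) / 2 with hγ
  have hγ0 : 0 < γ := by rw [hγ]; linarith
  set q : ℝ := 2 ^ (-γ) with hq
  have hq0 : 0 < q := by positivity
  have hq1 : q < 1 := Real.rpow_lt_one_of_one_lt_of_neg one_lt_two (by linarith)
  -- N(R) selects the dyadic cutoff whose inner radius r lies between εR/4 and εR/2. As η(·/R) = 1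
  -- on |x| < εR, this leaves room for the shift by x₀ once |x₀| ≤ εR/4, and the two cutoffs agree
  -- on |x-x₀| < r.
  have hN : ∀ R : ℝ, ∃ N : ℕ, 8 * δ / ε ≤ R →
      2 ^ (N + 1) * δ ≤ ε * R / 2 ∧ ε * R / 2 < 2 ^ (N + 2) * δ := by
    intro R
    by_cases hR : 8 * δ / ε ≤ R
    · rw [div_le_iff₀ hε] at hR
      obtain ⟨N, h1, h2⟩ := exists_nat_pow_near (x := ε * R / (4 * δ)) (y := (2 : ℝ))
        (by rw [le_div_iff₀ (by positivity)]; linarith) one_lt_two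
      rw [le_div_iff₀ (by positivity)] at h1
      rw [div_lt_iff₀ (by positivity)] at h2
      refine ⟨N, fun _ => ⟨?_, ?_⟩⟩
      · rw [pow_succ]; linarith
      · rw [pow_succ]; linarith
    · exact ⟨0, fun h => absurd h hR⟩
  choose N hN using hN
  have hNtop : Tendsto N atTop atTop := by
    refine tendsto_atTop.2 fun b => ?_
    filter_upwards [eventually_ge_atTop (8 * δ / ε), eventually_ge_atTop (2 ^ (b + 2) * δ * 2 / ε)]
      with R h1 h2
    rw [div_le_iff₀ hε] at h2
    have h3 := (hN R h1).2
    have h4 : (2 : ℝ) ^ (b + 2) < 2 ^ (N R + 2) := by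
      refine lt_of_mul_lt_mul_right (lt_of_le_of_lt ?_ h3) hδ.le
      linarith
    have := (pow_lt_pow_iff_right₀ one_lt_two).1 h4
    omega
  refine tendsto_of_tendsto_of_dist (hℓ.comp hNtop) ?_
  -- From r ≥ εR/4 follow ρR ≤ (4ρ/ε)r and |x₀| ≤ r, and the dyadic cutoff lives on radius 2r; so κr
  -- bounds both supports, seen from x₀.
  set κ := 4 * ρ / ε + 2 with hκ
  have hκ0 : 0 < κ := by positivity
  set D := K * κ ^ (lam / 2) * (C * (M' * ε + M) * √(κ ^ n)) * (δ ^ (lam / 2) * √(∫ x, ψ x ^ 2))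
    with hD
  have hlim : Tendsto (fun R => D * q ^ (N R + 1)) atTop (𝓝 0) := by
    have h1 : Tendsto (fun k : ℕ => q ^ k) atTop (𝓝 0) :=
      tendsto_pow_atTop_nhds_zero_of_lt_one hq0.le hq1
    have h2 := ((tendsto_add_atTop_iff_nat 1).2 h1).comp hNtop
    simpa using h2.const_mul D
  refine squeeze_zero' (Eventually.of_forall fun R => dist_nonneg) ?_ hlim
  filter_upwards [eventually_ge_atTop (8 * δ / ε), eventually_ge_atTop (4 * ‖x₀‖ / ε),
    eventually_gt_atTop 0] with R h1 h2 hR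
  obtain ⟨hr1, hr2⟩ := hN R h1
  rw [div_le_iff₀ hε] at h2
  set r := 2 ^ (N R + 1) * δ with hr
  have hr0 : 0 < r := by positivity
  have hr3 : ε * R / 4 ≤ r := by rw [pow_succ] at hr2; rw [hr]; linarith
  have h2k : (2 : ℝ) ≤ 2 ^ (N R + 1) := by
    rw [pow_succ]; linarith [one_le_pow₀ (n := N R) one_le_two (M₀ := ℝ)]
  rw [dist_comm, dist_eq_norm, Function.comp, truncated_eq_localized η hR, ← map_sub,
    ← localized_sub]
  have hone : ∀ x, ‖x - x₀‖ < r → (rescale η 0 R - cutoffAt x₀ r) x = 0 := fun x hx => by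
    change rescale η 0 R x - cutoffAt x₀ r x = 0
    rw [cutoffAt_eq_one hr0 hx.le, rescale_apply _ _ hR, hηε, sub_self]
    rw [sub_zero, mem_ball_zero_iff, norm_smul, norm_inv, Real.norm_of_nonneg hR.le,
      inv_mul_lt_iff₀ hR]
    have := norm_sub_norm_le x x₀
    nlinarith
  refine (hC x₀ δ ψ hδ hψ hm j _ (2 ^ (N R + 1)) κ (M' * ε + M) 0 h2k
      hκ0 (by positivity) le_rfl ?_ ?_ ?_ ?_).trans_eq ?_
  · refine (tsupport_sub _ _).trans (Set.union_subset ?_ ?_)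
    · refine (tsupport_rescale_subset η 0 hR hρ).trans (Metric.closedBall_subset_closedBall' ?_)
      rw [dist_eq_norm, zero_sub, norm_neg]
      have h3 : ρ * R ≤ 4 * ρ / ε * r := by
        rw [div_mul_eq_mul_div, le_div_iff₀ hε]
        nlinarith
      rw [hκ, ← hr]
      linarith
    · refine (tsupport_cutoffAt hr0).trans (Metric.closedBall_subset_closedBall ?_)
      rw [hκ, ← hr]
      have : 0 ≤ 4 * ρ / ε := by positivity
      gcongr
      linarith
  · intro i x hx
    exact pderiv_eq_zero_of_eqOn_ball hone i hx
  · intro i x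
    rw [pderiv_test_sub]
    refine (abs_sub _ _).trans ?_
    have h3 := hM x₀ _ hr0 i x
    have h4 : |pderiv i (rescale η 0 R) x| ≤ M' * ε * r⁻¹ := by
      rw [pderiv_rescale _ _ hR, smul_eq_mul, abs_mul, abs_of_pos (inv_pos.2 hR)]
      have h5 : R⁻¹ ≤ ε * r⁻¹ := by
        rw [← div_eq_mul_inv, inv_eq_one_div, div_le_div_iff₀ hR hr0]
        nlinarith
      calc R⁻¹ * |pderiv i η (R⁻¹ • (x - 0))| ≤ (ε * r⁻¹) * M' := by
            gcongr
            exact hM' i _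
        _ = _ := by ring
    rw [← hr, div_eq_mul_inv]
    linarith
  · intro x hx
    rw [hone x, abs_zero]
    rw [mem_closedBall_iff_norm] at hx
    refine hx.trans_lt ?_
    rw [hr]
    nlinarith
  · have h6 : ((2 : ℝ) ^ (N R + 1)) ^ (-γ) = q ^ (N R + 1) := by
      rw [hq, ← Real.rpow_natCast, ← Real.rpow_mul zero_le_two, mul_comm, Real.rpow_mul zero_le_two,
        Real.rpow_natCast]
    rw [zero_mul, add_zero, h6, hD]
    ring

theorem LocalBound.exists_pairing_limit (hQ : LocalBound Q K lam) (m : ℕ)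
    (hlam : lam < n + 2 * m) :
    ∃ C : ℝ, 0 ≤ C ∧ ∀ (x₀ : Rn n) (δ : ℝ) (ψ : 𝓓(whole n, ℝ)),
    0 < δ → tsupport ψ ⊆ Metric.closedBall x₀ δ → (m = 0 ∨ m = 1 ∧ ∫ x, ψ x = 0) →
    ∀ j : Fin n, ∃ ℓ : ℂ, ‖ℓ‖ ≤ C * (δ ^ (lam / 2) * √(∫ x, ψ x ^ 2)) ∧
      ∀ η : 𝓓(whole n, ℝ), (∀ᶠ x in 𝓝 (0 : Rn n), η x = 1) →
        Tendsto (fun R : ℝ => truncatedPairing Q η R j ψ) atTop (𝓝 ℓ) := by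
  obtain ⟨C, hC0, hC⟩ := hQ.exists_dyadic_bound m hlam
  refine ⟨C, hC0, fun x₀ δ ψ hδ hψ hm j => ?_⟩
  obtain ⟨ℓ, h1, h2⟩ := hC x₀ δ ψ hδ hψ hm j
  exact ⟨-ℓ, by rwa [norm_neg], fun η hη => (hQ.tendsto_truncated hlam hδ hψ hm h2 hη).neg⟩

end

end NashForm

namespace NashForm

/-! ### Representation of functionals that are bounded in `L²` -/

/-- The bound forces T to vanish on the kernel of ι, so T descends to a bounded functional on the
range. The range need not be closed: Hahn–Banach extends the functional with the same norm before
Riesz represents it. -/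
theorem exists_riesz_of_le {V H : Type*} [AddCommGroup V] [Module ℝ V] [NormedAddCommGroup H]
    [InnerProductSpace ℝ H] [CompleteSpace H] (ι : V →ₗ[ℝ] H) (T : V →ₗ[ℝ] ℝ) {K : ℝ} (hK : 0 ≤ K)
    (hT : ∀ v, |T v| ≤ K * ‖ι v‖) : ∃ y : H, ‖y‖ ≤ K ∧ ∀ v, T v = inner ℝ y (ι v) := by
  obtain ⟨g, hg⟩ := ι.rangeRestrict.exists_rightInverse_of_surjective ι.range_rangeRestrict
  have hg' : ∀ y : ι.range, ι (g y) = y := fun y => by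
    have := congrArg Subtype.val (LinearMap.congr_fun hg y)
    exact this
  set f : StrongDual ℝ ι.range := (T ∘ₗ g).mkContinuous K fun y => by
    have := hT (g y)
    rwa [hg'] at this with hf
  obtain ⟨F, hF1, hF2⟩ := exists_extension_norm_eq ι.range f
  refine ⟨(InnerProductSpace.toDual ℝ H).symm F, ?_, fun v => ?_⟩
  · rw [LinearIsometryEquiv.norm_map, hF2]
    exact LinearMap.mkContinuous_norm_le _ hK _
  · rw [InnerProductSpace.toDual_symm_apply]
    have h1 := hF1 ⟨ι v, v, rfl⟩
    rw [h1]
    change T v = T (g _)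
    have h2 := hT (v - g ⟨ι v, v, rfl⟩)
    rw [map_sub, map_sub, hg', sub_self, norm_zero, mul_zero, abs_nonpos_iff, sub_eq_zero] at h2
    exact h2

theorem lintegral_enorm_sq_Lp {α E : Type*} [MeasurableSpace α] {μ : Measure α}
    [NormedAddCommGroup E] [InnerProductSpace ℝ E] (y : Lp E 2 μ) :
    ∫⁻ x, ‖y x‖ₑ ^ 2 ∂μ = ENNReal.ofReal (‖y‖ ^ 2) := by
  rw [← real_inner_self_eq_norm_sq, L2.inner_def,
    ofReal_integral_eq_lintegral_ofReal (L2.integrable_inner y y)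
      (Eventually.of_forall fun x => real_inner_self_nonneg)]
  congr 1
  ext x
  rw [real_inner_self_eq_norm_sq, ENNReal.ofReal_pow (norm_nonneg _), ofReal_norm]

section

variable {n : ℕ}

theorem isClosed_tsupport_subset {s : Set (Rn n)} (hs : IsClosed s) {u : Rn n → ℝ}
    (h : ∀ x, x ∉ s → u x = 0) : tsupport u ⊆ s :=
  closure_minimal (fun x hx => by by_contra hc; exact hx (h x hc)) hs

/-- The inclusion of the test functions into `L²`. -/
noncomputable def testToL2 (n : ℕ) : 𝓓(whole n, ℝ) →ₗ[ℝ] Lp ℝ 2 (volume : Measure (Rn n)) where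
  toFun ψ := (test_memLp ψ).toLp
  map_add' φ ψ := (test_memLp φ).toLp_add (test_memLp ψ)
  map_smul' c ψ := (test_memLp ψ).toLp_const_smul c

theorem inner_testToL2 (y : Lp ℝ 2 (volume : Measure (Rn n))) (ψ : 𝓓(whole n, ℝ)) :
    inner ℝ y (testToL2 n ψ) = ∫ x, ψ x * y x := by
  rw [L2.inner_def]
  refine integral_congr_ae ?_
  filter_upwards [(test_memLp ψ).coeFn_toLp] with x hx
  have : (testToL2 n ψ : Rn n → ℝ) x = ψ x := hx
  rw [this]
  simp

theorem norm_testToL2 (ψ : 𝓓(whole n, ℝ)) : ‖testToL2 n ψ‖ = √(∫ x, ψ x ^ 2) := by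
  rw [← Real.sqrt_sq (norm_nonneg (testToL2 n ψ)), ← real_inner_self_eq_norm_sq, inner_testToL2]
  congr 1
  refine integral_congr_ae ?_
  filter_upwards [(test_memLp ψ).coeFn_toLp] with x hx
  have : (testToL2 n ψ : Rn n → ℝ) x = ψ x := hx
  rw [this, sq]

theorem integrable_test_smul {F : Type*} [NormedAddCommGroup F] [NormedSpace ℝ F] {f : Rn n → F}
    (hf : LocallyIntegrable f) (ψ : 𝓓(whole n, ℝ)) : Integrable fun x => ψ x • f x :=
  hf.integrable_smul_left_of_hasCompactSupport ψ.continuous ψ.hasCompactSupport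

/-- Real and imaginary parts are represented separately, each with norm at most K; hence 2K². -/
theorem exists_L2_representation (T : 𝓓(whole n, ℝ) →ₗ[ℝ] ℂ) (V : Submodule ℝ 𝓓(whole n, ℝ))
    {K : ℝ} (hK : 0 ≤ K) (hT : ∀ ψ ∈ V, ‖T ψ‖ ≤ K * √(∫ x, ψ x ^ 2)) :
    ∃ g : Rn n → ℂ, MemLp g 2 ∧ ∫⁻ x, ‖g x‖ₑ ^ 2 ≤ ENNReal.ofReal (2 * K ^ 2) ∧
      ∀ ψ ∈ V, T ψ = ∫ x, ψ x • g x := by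
  obtain ⟨y, hy, hyT⟩ := exists_riesz_of_le ((testToL2 n).domRestrict V)
    ((Complex.reLm ∘ₗ T).domRestrict V) hK fun ψ => by
      rw [LinearMap.domRestrict_apply, LinearMap.domRestrict_apply, norm_testToL2]
      exact (Complex.abs_re_le_norm _).trans (hT ψ ψ.2)
  obtain ⟨z, hz, hzT⟩ := exists_riesz_of_le ((testToL2 n).domRestrict V)
    ((Complex.imLm ∘ₗ T).domRestrict V) hK fun ψ => by
      rw [LinearMap.domRestrict_apply, LinearMap.domRestrict_apply, norm_testToL2]
      exact (Complex.abs_im_le_norm _).trans (hT ψ ψ.2)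
  have hyL := Lp.memLp y
  have hzL := Lp.memLp z
  have hg1 : MemLp (fun x => ((y x : ℝ) : ℂ)) 2 volume := hyL.ofReal
  have hg2 : MemLp (fun x => ((z x : ℝ) : ℂ) * Complex.I) 2 volume := hzL.ofReal.mul_const _
  refine ⟨fun x => (y x : ℂ) + z x * Complex.I, hg1.add hg2, ?_, fun ψ hψ => ?_⟩
  · calc ∫⁻ x, ‖(y x : ℂ) + z x * Complex.I‖ₑ ^ 2
        = ∫⁻ x, (‖y x‖ₑ ^ 2 + ‖z x‖ₑ ^ 2) := by
          refine lintegral_congr fun x => ?_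
          rw [← ofReal_norm, ← ofReal_norm (y x), ← ofReal_norm (z x),
            ← ENNReal.ofReal_pow (norm_nonneg _), ← ENNReal.ofReal_pow (norm_nonneg _),
            ← ENNReal.ofReal_pow (norm_nonneg _), ← ENNReal.ofReal_add (by positivity)
            (by positivity), Complex.sq_norm, Complex.normSq_add_mul_I]
          simp
      _ = ENNReal.ofReal (‖y‖ ^ 2) + ENNReal.ofReal (‖z‖ ^ 2) := by
          rw [lintegral_add_left' (hyL.1.enorm.pow_const 2), lintegral_enorm_sq_Lp,
            lintegral_enorm_sq_Lp]
      _ ≤ _ := by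
          rw [← ENNReal.ofReal_add (by positivity) (by positivity)]
          refine ENNReal.ofReal_le_ofReal ?_
          have h1 : ‖y‖ ^ 2 ≤ K ^ 2 := by gcongr
          have h2 : ‖z‖ ^ 2 ≤ K ^ 2 := by gcongr
          linarith
  · have h1 : (T ψ).re = ∫ x, ψ x * y x := by
      rw [← inner_testToL2]; exact hyT ⟨ψ, hψ⟩
    have h2 : (T ψ).im = ∫ x, ψ x * z x := by
      rw [← inner_testToL2]; exact hzT ⟨ψ, hψ⟩
    rw [← Complex.re_add_im (T ψ), h1, h2, ← integral_complex_ofReal, ← integral_complex_ofReal,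
      ← integral_mul_const, ← integral_add]
    · refine integral_congr_ae (Eventually.of_forall fun x => ?_)
      simp only [Complex.real_smul]
      push_cast
      ring
    · exact ((test_memLp ψ).integrable_mul hyL).ofReal
    · exact ((test_memLp ψ).integrable_mul hzL).ofReal.mul_const _

/-- Test functions supported in a given set. -/
def supportedIn (s : Set (Rn n)) : Submodule ℝ 𝓓(whole n, ℝ) where
  carrier := {ψ | ∀ x, x ∉ s → ψ x = 0}
  add_mem' {φ ψ} hφ hψ x hx := by
    change φ x + ψ x = 0
    rw [hφ x hx, hψ x hx, add_zero]
  zero_mem' _ _ := rfl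
  smul_mem' c ψ hψ x hx := by
    change c * ψ x = 0
    rw [hψ x hx, mul_zero]

theorem mem_supportedIn {s : Set (Rn n)} {ψ : 𝓓(whole n, ℝ)} :
    ψ ∈ supportedIn s ↔ ∀ x, x ∉ s → ψ x = 0 := Iff.rfl

theorem mem_supportedIn_of_tsupport {s : Set (Rn n)} {ψ : 𝓓(whole n, ℝ)} (h : tsupport ψ ⊆ s) :
    ψ ∈ supportedIn s := fun _ hx => image_eq_zero_of_notMem_tsupport fun hc => hx (h hc)

/-- The integral as a linear functional. -/
noncomputable def testIntegral (n : ℕ) : 𝓓(whole n, ℝ) →ₗ[ℝ] ℝ where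
  toFun ψ := ∫ x, ψ x
  map_add' φ ψ := integral_add (test_integrable φ) (test_integrable ψ)
  map_smul' c ψ := integral_const_mul c (ψ : Rn n → ℝ)

theorem testIntegral_apply (ψ : 𝓓(whole n, ℝ)) : testIntegral n ψ = ∫ x, ψ x := rfl

theorem ae_eq_on_ball_of_integral_eq {F : Type*} [NormedAddCommGroup F] [NormedSpace ℝ F]
    [CompleteSpace F] {f g : Rn n → F} (hf : LocallyIntegrable f) (hg : LocallyIntegrable g)
    {x₀ : Rn n} {δ : ℝ} (h : ∀ ψ : 𝓓(whole n, ℝ), tsupport ψ ⊆ Metric.ball x₀ δ →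
      ∫ x, ψ x • f x = ∫ x, ψ x • g x) : ∀ᵐ x, x ∈ Metric.ball x₀ δ → f x = g x := by
  have h1 := Metric.isOpen_ball.ae_eq_zero_of_integral_contDiff_smul_eq_zero
    (U := Metric.ball x₀ δ) (μ := volume) (f := fun x => f x - g x)
    ((hf.sub hg).locallyIntegrableOn _) fun ψ hψ hc hs => by
      have h2 := h (testOf ψ hψ hc) hs
      rw [coe_testOf] at h2
      simp_rw [smul_sub]
      refine (integral_sub (integrable_test_smul hf (testOf ψ hψ hc))
        (integrable_test_smul hg (testOf ψ hψ hc))).trans ?_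
      rw [coe_testOf, h2, sub_self]
  filter_upwards [h1] with x hx hxU
  exact sub_eq_zero.1 (hx hxU)

/-- Subtracting (∫ψ)ρ, with ρ a bump of mass one inside the ball, makes any ψ admissible. The
constant is the pairing of f - g with ρ. -/
theorem exists_ae_eq_const_on_ball {F : Type*} [NormedAddCommGroup F] [NormedSpace ℝ F]
    [CompleteSpace F] {f g : Rn n → F} (hf : LocallyIntegrable f) (hg : LocallyIntegrable g)
    {x₀ : Rn n} {δ : ℝ} (hδ : 0 < δ) (h : ∀ ψ : 𝓓(whole n, ℝ), tsupport ψ ⊆ Metric.ball x₀ δ →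
      ∫ x, ψ x = 0 → ∫ x, ψ x • f x = ∫ x, ψ x • g x) :
    ∃ c, ∀ᵐ x, x ∈ Metric.ball x₀ δ → f x - c = g x := by
  set ρ₀ := cutoffAt x₀ (δ / 4) with hρ₀
  have hδ4 : 0 < δ / 4 := by positivity
  have hpos : 0 < ∫ x, ρ₀ x :=
    (mul_pos (ballVol_pos n) (pow_pos hδ4 n)).trans_le (le_integral_cutoffAt x₀ hδ4)
  set ρ := (∫ x, ρ₀ x)⁻¹ • ρ₀ with hρ
  have hρ1 : ∫ x, ρ x = 1 := by
    rw [← testIntegral_apply, hρ, map_smul, testIntegral_apply, smul_eq_mul,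
      inv_mul_cancel₀ hpos.ne']
  have hρs : ρ ∈ supportedIn (Metric.closedBall x₀ (2 * (δ / 4))) :=
    Submodule.smul_mem _ _ (mem_supportedIn_of_tsupport (tsupport_cutoffAt hδ4))
  refine ⟨∫ x, ρ x • (f x - g x), ?_⟩
  set c := ∫ x, ρ x • (f x - g x) with hc
  have hloc : LocallyIntegrable fun x => f x - c := hf.sub (locallyIntegrable_const c)
  refine ae_eq_on_ball_of_integral_eq hloc hg fun ψ hψ => ?_
  have hψ' : tsupport (ψ - (∫ x, ψ x) • ρ) ⊆ Metric.ball x₀ δ := by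
    refine (tsupport_sub _ _).trans (Set.union_subset hψ ?_)
    refine (isClosed_tsupport_subset Metric.isClosed_closedBall
      (mem_supportedIn.1 (Submodule.smul_mem _ _ hρs))).trans ?_
    exact Metric.closedBall_subset_ball (by linarith)
  have h0 : ∫ x, (ψ - (∫ x, ψ x) • ρ) x = 0 := by
    rw [← testIntegral_apply, map_sub, map_smul, testIntegral_apply, testIntegral_apply, hρ1]
    simp
  have h1 := h _ hψ' h0
  have h2 : ∀ f : Rn n → F, LocallyIntegrable f → ∫ x, (ψ - (∫ x, ψ x) • ρ) x • f x =
      (∫ x, ψ x • f x) - (∫ x, ψ x) • ∫ x, ρ x • f x := by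
    intro f hf
    rw [← integral_smul]
    refine Eq.trans ?_ (integral_sub (integrable_test_smul hf ψ)
      ((integrable_test_smul hf ρ).smul (∫ x, ψ x)))
    refine integral_congr_ae (Eventually.of_forall fun x => ?_)
    change (ψ x - (∫ x, ψ x) * ρ x) • f x = ψ x • f x - (∫ x, ψ x) • ρ x • f x
    rw [sub_smul, mul_smul]
  rw [h2 f hf, h2 g hg, sub_eq_sub_iff_sub_eq_sub, ← smul_sub, ← integral_sub
    (integrable_test_smul hf ρ) (integrable_test_smul hg ρ)] at h1
  simp_rw [← smul_sub] at h1
  rw [← hc] at h1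
  simp_rw [smul_sub]
  rw [integral_sub (integrable_test_smul hf ψ)
    (integrable_test_smul (locallyIntegrable_const c) ψ), integral_smul_const, ← h1]
  abel

/-- The L² representatives on the balls of radius N+1 agree almost everywhere on overlaps. Choosing
the index ⌊‖x‖⌋ at each point glues them with no further choice. -/
theorem exists_locallyIntegrable_representation (T : 𝓓(whole n, ℝ) →ₗ[ℝ] ℂ)
    (hT : ∀ ρ : ℝ, 0 < ρ → ∃ K : ℝ, 0 ≤ K ∧ ∀ ψ : 𝓓(whole n, ℝ),
      tsupport ψ ⊆ Metric.closedBall 0 ρ → ‖T ψ‖ ≤ K * √(∫ x, ψ x ^ 2)) :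
    ∃ f : Rn n → ℂ, LocallyIntegrable f ∧ ∀ ψ, T ψ = ∫ x, ψ x • f x := by
  have h1 : ∀ N : ℕ, ∃ g : Rn n → ℂ, MemLp g 2 ∧
      ∀ ψ ∈ supportedIn (Metric.closedBall (0 : Rn n) (N + 1)), T ψ = ∫ x, ψ x • g x := by
    intro N
    obtain ⟨K, hK, hKT⟩ := hT (N + 1) (by positivity)
    obtain ⟨g, hg1, -, hg2⟩ := exists_L2_representation T
      (supportedIn (Metric.closedBall (0 : Rn n) (N + 1))) hK fun ψ hψ =>
      hKT ψ (isClosed_tsupport_subset Metric.isClosed_closedBall hψ)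
    exact ⟨g, hg1, hg2⟩
  choose g hg1 hg2 using h1
  have hgl : ∀ N, LocallyIntegrable (g N) := fun N => (hg1 N).locallyIntegrable one_le_two
  have hagree : ∀ N M : ℕ, N ≤ M → ∀ᵐ x, x ∈ Metric.ball (0 : Rn n) (N + 1) → g N x = g M x := by
    intro N M hNM
    have hNM' : (N : ℝ) ≤ M := Nat.cast_le.2 hNM
    refine ae_eq_on_ball_of_integral_eq (hgl N) (hgl M) fun ψ hψ => ?_
    rw [← hg2 N ψ (mem_supportedIn_of_tsupport (hψ.trans Metric.ball_subset_closedBall)),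
      ← hg2 M ψ (mem_supportedIn_of_tsupport (hψ.trans (Metric.ball_subset_closedBall.trans
        (Metric.closedBall_subset_closedBall (by linarith)))))]
  set f : Rn n → ℂ := fun x => g ⌊‖x‖⌋₊ x with hf
  have hfg : ∀ M : ℕ, ∀ᵐ x, x ∈ Metric.ball (0 : Rn n) (M + 1) → f x = g M x := by
    intro M
    have h2 : ∀ᵐ x : Rn n, ∀ N : ℕ, N ≤ M → x ∈ Metric.ball (0 : Rn n) (N + 1) → g N x = g M x := by
      rw [ae_all_iff]
      intro N
      by_cases hNM : N ≤ M
      · filter_upwards [hagree N M hNM] with x hx _ using hx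
      · exact Eventually.of_forall fun x h => absurd h hNM
    filter_upwards [h2] with x hx hxM
    rw [mem_ball_zero_iff] at hxM
    refine hx _ ?_ ?_
    · rw [← Nat.lt_succ_iff, Nat.floor_lt (norm_nonneg _)]
      push_cast
      exact hxM
    · rw [mem_ball_zero_iff]
      exact Nat.lt_floor_add_one _
  refine ⟨f, fun x => ?_, fun ψ => ?_⟩
  · have hx : Metric.ball (0 : Rn n) ((⌊‖x‖⌋₊ : ℝ) + 1) ∈ 𝓝 x :=
      Metric.isOpen_ball.mem_nhds (mem_ball_zero_iff.2 (Nat.lt_floor_add_one _))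
    refine ⟨_, hx, ?_⟩
    refine ((hgl ⌊‖x‖⌋₊).integrableOn_of_isBounded Metric.isBounded_ball).congr ?_
    rw [EventuallyEq, ae_restrict_iff' measurableSet_ball]
    filter_upwards [hfg ⌊‖x‖⌋₊] with y hy hyb using (hy hyb).symm
  · obtain ⟨r, hr⟩ := ψ.hasCompactSupport.isCompact.isBounded.subset_ball (0 : Rn n)
    obtain ⟨M, hM⟩ := exists_nat_ge r
    have hψ : tsupport ψ ⊆ Metric.ball (0 : Rn n) (M + 1) :=
      hr.trans (Metric.ball_subset_ball (by linarith))
    rw [hg2 M ψ (mem_supportedIn_of_tsupport (hψ.trans Metric.ball_subset_closedBall))]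
    refine integral_congr_ae ?_
    filter_upwards [hfg M] with x hx
    by_cases h0 : ψ x = 0
    · simp [h0]
    · rw [hx (hψ (subset_tsupport (⇑ψ) h0))]

end

end NashForm

namespace NashForm

/-! ### `∇ Δ⁻¹ Q` as a function -/

section

variable {n : ℕ} {Q : Distr n} {K lam : ℝ}

theorem truncated_apply (η : 𝓓(whole n, ℝ)) {R : ℝ} (hR : R ≠ 0) (j : Fin n) (ψ : 𝓓(whole n, ℝ))
    (x : Rn n) : truncated η R j ψ x = η (R⁻¹ • x) * invLaplacianDeriv j ψ x := by
  rw [truncated, dif_neg hR]; rfl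

theorem truncated_zero (η : 𝓓(whole n, ℝ)) (j : Fin n) (ψ : 𝓓(whole n, ℝ)) :
    truncated η 0 j ψ = 0 := by
  rw [truncated, dif_pos rfl]

theorem truncatedPairing_add (η : 𝓓(whole n, ℝ)) (R : ℝ) (j : Fin n) (φ ψ : 𝓓(whole n, ℝ)) :
    truncatedPairing Q η R j (φ + ψ) = truncatedPairing Q η R j φ + truncatedPairing Q η R j ψ := by
  have : truncated η R j (φ + ψ) = truncated η R j φ + truncated η R j ψ := by
    rcases eq_or_ne R 0 with rfl | hR
    · simp [truncated_zero]
    · ext x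
      change _ = truncated η R j φ x + truncated η R j ψ x
      rw [truncated_apply _ hR, truncated_apply _ hR, truncated_apply _ hR,
        invLaplacianDeriv_add, mul_add]
  rw [truncatedPairing, this, map_add, neg_add]; rfl

theorem truncatedPairing_smul (η : 𝓓(whole n, ℝ)) (R : ℝ) (j : Fin n) (c : ℝ)
    (ψ : 𝓓(whole n, ℝ)) : truncatedPairing Q η R j (c • ψ) = c • truncatedPairing Q η R j ψ := by
  have : truncated η R j (c • ψ) = c • truncated η R j ψ := by
    rcases eq_or_ne R 0 with rfl | hR
    · simp [truncated_zero]
    · ext x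
      change _ = c * truncated η R j ψ x
      rw [truncated_apply _ hR, truncated_apply _ hR, invLaplacianDeriv_smul]
      ring
  rw [truncatedPairing, this, map_smul, ← smul_neg]; rfl

theorem eventually_stdCutoff (n : ℕ) : ∀ᶠ x in 𝓝 (0 : Rn n), stdCutoff n x = 1 := by
  filter_upwards [Metric.closedBall_mem_nhds (0 : Rn n) one_pos] with x hx
  exact stdCutoff_eq_one (mem_closedBall_zero_iff.1 hx)

theorem tsupport_mollifier_subset {δ : ℝ} (hδ : 0 < δ) :
    tsupport (mollifier n δ) ⊆ Metric.closedBall 0 (2 * δ) :=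
  isClosed_tsupport_subset Metric.isClosed_closedBall fun x hx =>
    mollifier_eq_zero hδ (by simpa using hx)

/-- The projection onto the test functions of mean zero (for `m = 1`). -/
noncomputable def meanProj (n m : ℕ) : 𝓓(whole n, ℝ) →ₗ[ℝ] 𝓓(whole n, ℝ) :=
  LinearMap.id - (m : ℝ) • (testIntegral n).smulRight (mollifier n 1)

theorem meanProj_apply (m : ℕ) (ψ : 𝓓(whole n, ℝ)) :
    meanProj n m ψ = ψ - (m : ℝ) • (∫ x, ψ x) • mollifier n 1 := rfl

theorem meanProj_eq_self {m : ℕ} {ψ : 𝓓(whole n, ℝ)} (h : m = 0 ∨ m = 1 ∧ ∫ x, ψ x = 0) :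
    meanProj n m ψ = ψ := by
  rcases h with rfl | ⟨-, h⟩
  · simp [meanProj_apply]
  · simp [meanProj_apply, h]

theorem integral_meanProj {m : ℕ} (hm : m ≤ 1) (ψ : 𝓓(whole n, ℝ)) :
    m = 0 ∨ m = 1 ∧ ∫ x, meanProj n m ψ x = 0 := by
  interval_cases m
  · exact Or.inl rfl
  · refine Or.inr ⟨rfl, ?_⟩
    rw [← testIntegral_apply, meanProj_apply, map_sub, map_smul, map_smul, testIntegral_apply,
      testIntegral_apply, integral_mollifier one_pos]
    simp

theorem tsupport_meanProj_subset (m : ℕ) {ψ : 𝓓(whole n, ℝ)} {ρ : ℝ}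
    (hψ : tsupport ψ ⊆ Metric.closedBall 0 ρ) :
    tsupport (meanProj n m ψ) ⊆ Metric.closedBall 0 (max ρ 2) := by
  rw [meanProj_apply]
  refine isClosed_tsupport_subset Metric.isClosed_closedBall (mem_supportedIn.1
    (Submodule.sub_mem _ ?_ (Submodule.smul_mem _ _ (Submodule.smul_mem _ _ ?_))))
  · exact mem_supportedIn_of_tsupport
      (hψ.trans (Metric.closedBall_subset_closedBall (le_max_left _ _)))
  · refine mem_supportedIn_of_tsupport ((tsupport_mollifier_subset one_pos).trans
      (Metric.closedBall_subset_closedBall ?_))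
    rw [mul_one]
    exact le_max_right _ _

theorem sqrt_integral_meanProj_sq_le {m : ℕ} (hm : m ≤ 1) {ψ : 𝓓(whole n, ℝ)} {ρ : ℝ} (hρ : 0 < ρ)
    (hψ : tsupport ψ ⊆ Metric.closedBall 0 ρ) :
    √(∫ x, meanProj n m ψ x ^ 2) ≤
      √(2 + 2 * (ballVol n * ρ ^ n) * ∫ x, mollifier n 1 x ^ 2) * √(∫ x, ψ x ^ 2) := by
  have hω := ballVol_pos n
  set B := ∫ x, mollifier n 1 x ^ 2 with hB
  have hB0 : 0 ≤ B := integral_nonneg fun x => sq_nonneg _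
  rw [← Real.sqrt_mul (by positivity)]
  refine Real.sqrt_le_sqrt ?_
  set I := ∫ x, ψ x with hI
  have h1 : I ^ 2 ≤ ballVol n * ρ ^ n * ∫ x, ψ x ^ 2 := by
    refine le_trans ?_ (sq_integral_abs_le hρ ψ hψ)
    rw [← sq_abs I]
    gcongr
    exact abs_integral_le_integral_abs
  have hm1 : (m : ℝ) ^ 2 ≤ 1 := pow_le_one₀ (by positivity) (by exact_mod_cast hm)
  have h2 : ∀ x, meanProj n m ψ x ^ 2 ≤ 2 * ψ x ^ 2 + 2 * I ^ 2 * mollifier n 1 x ^ 2 := by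
    intro x
    change (ψ x - m * (I * mollifier n 1 x)) ^ 2 ≤ _
    have h3 : (m * (I * mollifier n 1 x)) ^ 2 ≤ I ^ 2 * mollifier n 1 x ^ 2 := by
      rw [mul_pow, mul_pow]
      exact mul_le_of_le_one_left (by positivity) hm1
    nlinarith [sq_nonneg (ψ x + m * (I * mollifier n 1 x))]
  calc ∫ x, meanProj n m ψ x ^ 2
      ≤ ∫ x, (2 * ψ x ^ 2 + 2 * I ^ 2 * mollifier n 1 x ^ 2) :=
        integral_mono (test_memLp _).integrable_sq
          (((test_memLp ψ).integrable_sq.const_mul _).add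
            ((test_memLp (mollifier n 1)).integrable_sq.const_mul _)) h2
    _ = 2 * (∫ x, ψ x ^ 2) + 2 * I ^ 2 * B := by
        rw [integral_add ((test_memLp ψ).integrable_sq.const_mul _)
          ((test_memLp (mollifier n 1)).integrable_sq.const_mul _), integral_const_mul,
          integral_const_mul]
    _ ≤ 2 * (∫ x, ψ x ^ 2) + 2 * (ballVol n * ρ ^ n * ∫ x, ψ x ^ 2) * B := by gcongr
    _ = _ := by ring

/-- For m = 1 the limit is only known on functions of mean zero; composing with `meanProj` extends
it to a functional on all test functions, which amounts to choosing a representative modulo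
constants. The scale-invariant estimate is claimed where `meanProj` acts as the identity; the last,
cruder one on all functions provides a locally integrable density. -/
theorem LocalBound.exists_functional (hQ : LocalBound Q K lam) {m : ℕ} (hm : m ≤ 1)
    (hlam : lam < n + 2 * m) : ∃ (T : Fin n → 𝓓(whole n, ℝ) →ₗ[ℝ] ℂ) (C : ℝ), 0 ≤ C ∧
      (∀ j (ψ : 𝓓(whole n, ℝ)), (m = 0 ∨ m = 1 ∧ ∫ x, ψ x = 0) → ∀ η : 𝓓(whole n, ℝ),
        (∀ᶠ x in 𝓝 (0 : Rn n), η x = 1) →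
        Tendsto (fun R : ℝ => truncatedPairing Q η R j ψ) atTop (𝓝 (T j ψ))) ∧
      (∀ j (x₀ : Rn n) (δ : ℝ) (ψ : 𝓓(whole n, ℝ)), 0 < δ → tsupport ψ ⊆ Metric.closedBall x₀ δ →
        (m = 0 ∨ m = 1 ∧ ∫ x, ψ x = 0) →
        ‖T j ψ‖ ≤ C * δ ^ (lam / 2) * √(∫ x, ψ x ^ 2)) ∧
      ∀ j (ρ : ℝ), 0 < ρ → ∃ K' : ℝ, 0 ≤ K' ∧ ∀ ψ : 𝓓(whole n, ℝ),
        tsupport ψ ⊆ Metric.closedBall 0 ρ → ‖T j ψ‖ ≤ K' * √(∫ x, ψ x ^ 2) := by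
  obtain ⟨C, hC0, hC⟩ := hQ.exists_pairing_limit m hlam
  have hlim : ∀ (j : Fin n) (ψ : 𝓓(whole n, ℝ)), ∃ ℓ : ℂ, ∀ η : 𝓓(whole n, ℝ),
      (∀ᶠ x in 𝓝 (0 : Rn n), η x = 1) →
      Tendsto (fun R : ℝ => truncatedPairing Q η R j (meanProj n m ψ)) atTop (𝓝 ℓ) := by
    intro j ψ
    obtain ⟨ρ, -, hρ⟩ := ψ.hasCompactSupport.isCompact.isBounded.subset_closedBall_lt 0 (0 : Rn n)
    obtain ⟨ℓ, -, hℓ⟩ := hC 0 (max ρ 2) (meanProj n m ψ) (lt_max_of_lt_right two_pos)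
      (tsupport_meanProj_subset m hρ) (integral_meanProj hm ψ) j
    exact ⟨ℓ, hℓ⟩
  choose ℓ hℓ using hlim
  have hstd := eventually_stdCutoff n
  set T : Fin n → 𝓓(whole n, ℝ) →ₗ[ℝ] ℂ := fun j =>
    { toFun := ℓ j
      map_add' := fun φ ψ => by
        refine tendsto_nhds_unique (hℓ j (φ + ψ) _ hstd) ?_
        simp_rw [map_add, truncatedPairing_add]
        exact (hℓ j φ _ hstd).add (hℓ j ψ _ hstd)
      map_smul' := fun c ψ => by
        refine tendsto_nhds_unique (hℓ j (c • ψ) _ hstd) ?_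
        simp_rw [map_smul, truncatedPairing_smul]
        exact (hℓ j ψ _ hstd).const_smul c } with hT
  have hbound : ∀ j (x₀ : Rn n) (δ : ℝ) (ψ : 𝓓(whole n, ℝ)), 0 < δ →
      tsupport (meanProj n m ψ) ⊆ Metric.closedBall x₀ δ →
      ‖T j ψ‖ ≤ C * δ ^ (lam / 2) * √(∫ x, meanProj n m ψ x ^ 2) := by
    intro j x₀ δ ψ hδ hψ
    obtain ⟨ℓ', h1, h2⟩ := hC x₀ δ (meanProj n m ψ) hδ hψ (integral_meanProj hm ψ) j
    have h3 : T j ψ = ℓ' := tendsto_nhds_unique (hℓ j ψ _ hstd) (h2 _ hstd)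
    rw [h3, mul_assoc]
    exact h1
  refine ⟨T, C, hC0, fun j ψ hψ η hη => ?_, fun j x₀ δ ψ hδ hψ h0 => ?_, fun j ρ hρ => ?_⟩
  · have := hℓ j ψ η hη
    rwa [meanProj_eq_self hψ] at this
  · have := hbound j x₀ δ ψ hδ (by rwa [meanProj_eq_self h0])
    rwa [meanProj_eq_self h0] at this
  · refine ⟨C * max ρ 2 ^ (lam / 2) *
      √(2 + 2 * (ballVol n * ρ ^ n) * ∫ x, mollifier n 1 x ^ 2), by positivity, fun ψ hψ => ?_⟩
    refine (hbound j 0 (max ρ 2) ψ (lt_max_of_lt_right two_pos)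
      (tsupport_meanProj_subset m hψ)).trans ?_
    rw [mul_assoc _ _ (√(∫ x, ψ x ^ 2))]
    exact mul_le_mul_of_nonneg_left (sqrt_integral_meanProj_sq_le hm hρ hψ) (by positivity)

theorem locallyIntegrable_toLp {f : Fin n → Rn n → ℂ} (hf : ∀ j, LocallyIntegrable (f j)) :
    LocallyIntegrable (fun x => (WithLp.toLp 2 fun j => f j x : EuclideanSpace ℂ (Fin n))) := by
  intro x
  choose s hs hsi using fun j => hf j x
  refine ⟨⋂ j, s j, Filter.iInter_mem.2 hs, ?_⟩
  have h1 : ∀ j, IntegrableOn (f j) (⋂ j, s j) := fun j =>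
    (hsi j).mono_set (Set.iInter_subset _ j)
  have h2 : IntegrableOn (fun x => ∑ j, f j x • (EuclideanSpace.single j (1 : ℂ)))
      (⋂ j, s j) := integrable_finsetSum _ fun j _ => (h1 j).smul_const _
  refine h2.congr (Eventually.of_forall fun x => ?_)
  ext i
  simp [Pi.single_apply]

/-- Two representations are compared on each ball: the global density of the functional, and an L²
function with the sharp norm that represents it on the admissible test functions of that ball. They
agree up to a constant c, which is 0 when no mean condition is imposed. -/
theorem LocalBound.exists_field (hQ : LocalBound Q K lam) {m : ℕ} (hm : m ≤ 1)
    (hlam : lam < n + 2 * m) : ∃ (Γ : VectorField n) (C : ℝ), 0 ≤ C ∧ LocallyIntegrable Γ ∧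
      (∀ η : 𝓓(whole n, ℝ), (∀ᶠ x in 𝓝 (0 : Rn n), η x = 1) →
        ∀ j (ψ : 𝓓(whole n, ℝ)), (m = 0 ∨ m = 1 ∧ ∫ x, ψ x = 0) →
        Tendsto (fun R : ℝ => truncatedPairing Q η R j ψ) atTop (𝓝 (∫ x, ψ x • Γ x j))) ∧
      ∀ (x₀ : Rn n) (δ : ℝ), 0 < δ → ∃ c, (m = 0 → c = 0) ∧
        ∫⁻ x in Metric.ball x₀ δ, ‖Γ x - c‖ₑ ^ 2 ≤ ENNReal.ofReal (C * δ ^ lam) := by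
  obtain ⟨T, C, hC0, hT1, hT2, hT3⟩ := hQ.exists_functional hm hlam
  choose f hf1 hf2 using fun j => exists_locallyIntegrable_representation (T j) (hT3 j)
  refine ⟨fun x => WithLp.toLp 2 fun j => f j x, n * (2 * C ^ 2), by positivity,
    locallyIntegrable_toLp hf1, fun η hη j ψ hψ => ?_, fun x₀ δ hδ => ?_⟩
  · have := hT1 j ψ hψ η hη
    rwa [hf2] at this
  · have hV : ∀ j : Fin n, ∃ c : ℂ, (m = 0 → c = 0) ∧
        ∫⁻ x in Metric.ball x₀ δ, ‖f j x - c‖ₑ ^ 2 ≤ ENNReal.ofReal (2 * C ^ 2 * δ ^ lam) := by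
      intro j
      -- The kernel of m times the integral is the whole space for m = 0 and the mean-zero functions
      -- for m = 1, so both cases are treated at once.
      set V : Submodule ℝ 𝓓(whole n, ℝ) := supportedIn (Metric.closedBall x₀ δ) ⊓
        LinearMap.ker ((m : ℝ) • testIntegral n) with hV
      have hVm : ∀ ψ : 𝓓(whole n, ℝ), ψ ∈ V → m = 0 ∨ m = 1 ∧ ∫ x, ψ x = 0 := by
        rintro ψ ⟨-, h⟩
        rw [SetLike.mem_coe, LinearMap.mem_ker, LinearMap.smul_apply, testIntegral_apply,
          smul_eq_mul, mul_eq_zero] at h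
        rcases h with h | h
        · exact Or.inl (Nat.cast_eq_zero.1 h)
        · interval_cases m
          · exact Or.inl rfl
          · exact Or.inr ⟨rfl, h⟩
      obtain ⟨g, hg1, hg2, hg3⟩ := exists_L2_representation (T j) V
        (K := C * δ ^ (lam / 2)) (by positivity) fun ψ hψ =>
        hT2 j x₀ δ ψ hδ (isClosed_tsupport_subset Metric.isClosed_closedBall hψ.1) (hVm ψ hψ)
      have hK : 2 * (C * δ ^ (lam / 2)) ^ 2 = 2 * C ^ 2 * δ ^ lam := by
        rw [mul_pow, ← Real.rpow_natCast (δ ^ (lam / 2)), ← Real.rpow_mul hδ.le]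
        rw [Nat.cast_ofNat, div_mul_cancel₀ _ two_ne_zero]
        ring
      rw [hK] at hg2
      have hgl : LocallyIntegrable g := hg1.locallyIntegrable one_le_two
      have hfin : ∀ c : ℂ, (∀ᵐ x, x ∈ Metric.ball x₀ δ → f j x - c = g x) →
          ∫⁻ x in Metric.ball x₀ δ, ‖f j x - c‖ₑ ^ 2 ≤ ENNReal.ofReal (2 * C ^ 2 * δ ^ lam) := by
        intro c hc
        calc ∫⁻ x in Metric.ball x₀ δ, ‖f j x - c‖ₑ ^ 2 = ∫⁻ x in Metric.ball x₀ δ, ‖g x‖ₑ ^ 2 := by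
              refine setLIntegral_congr_fun_ae measurableSet_ball ?_
              filter_upwards [hc] with x hx hxB
              rw [hx hxB]
          _ ≤ _ := (setLIntegral_le_lintegral _ _).trans hg2
      have hpair : ∀ ψ : 𝓓(whole n, ℝ), tsupport ψ ⊆ Metric.ball x₀ δ →
          (m = 0 ∨ ∫ x, ψ x = 0) → ∫ x, ψ x • f j x = ∫ x, ψ x • g x := by
        intro ψ hψ h
        rw [← hf2 j ψ]
        refine hg3 ψ ⟨mem_supportedIn_of_tsupport (hψ.trans Metric.ball_subset_closedBall), ?_⟩
        rw [SetLike.mem_coe, LinearMap.mem_ker, LinearMap.smul_apply, testIntegral_apply]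
        rcases h with rfl | h
        · simp
        · simp [h]
      by_cases hm0 : m = 0
      · refine ⟨0, fun _ => rfl, hfin 0 ?_⟩
        have := ae_eq_on_ball_of_integral_eq (hf1 j) hgl fun ψ hψ => hpair ψ hψ (Or.inl hm0)
        filter_upwards [this] with x hx hxB
        rw [sub_zero, hx hxB]
      · obtain ⟨c, hc⟩ := exists_ae_eq_const_on_ball (hf1 j) hgl hδ
          fun ψ hψ h0 => hpair ψ hψ (Or.inr h0)
        exact ⟨c, fun h => absurd h hm0, hfin c hc⟩
    choose c hc0 hc using hV
    refine ⟨WithLp.toLp 2 c, fun h => ?_, ?_⟩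
    · ext j
      simp [hc0 j h]
    · calc ∫⁻ x in Metric.ball x₀ δ, ‖(WithLp.toLp 2 fun j => f j x) - WithLp.toLp 2 c‖ₑ ^ 2
          = ∫⁻ x in Metric.ball x₀ δ, ∑ j, ‖f j x - c j‖ₑ ^ 2 := by
            refine lintegral_congr fun x => ?_
            rw [← ofReal_norm, ← ENNReal.ofReal_pow (norm_nonneg _), EuclideanSpace.norm_sq_eq,
              ENNReal.ofReal_sum_of_nonneg fun i _ => by positivity]
            refine Finset.sum_congr rfl fun j _ => ?_
            rw [ENNReal.ofReal_pow (norm_nonneg _), ofReal_norm]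
            rfl
        _ = ∑ j, ∫⁻ x in Metric.ball x₀ δ, ‖f j x - c j‖ₑ ^ 2 := by
            refine lintegral_finsetSum' _ fun j _ => ?_
            exact (((hf1 j).sub (locallyIntegrable_const _)).aestronglyMeasurable.restrict.enorm).pow_const 2
        _ ≤ ∑ _j : Fin n, ENNReal.ofReal (2 * C ^ 2 * δ ^ lam) := Finset.sum_le_sum fun j _ => hc j
        _ = _ := by
            rw [Finset.sum_const, Finset.card_univ, Fintype.card_fin, nsmul_eq_mul,
              ← ENNReal.ofReal_natCast, ← ENNReal.ofReal_mul (by positivity)]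
            congr 1
            ring

end

end NashForm

/-! ### Divergence of ∇Δ⁻¹Q and its membership in the Morrey, BMO and Hölder spaces -/

namespace NashForm

section

variable {n : ℕ} {Q : Distr n} {K lam : ℝ}

theorem IsGradInvLaplacian.modConst {Γ : VectorField n} (h : IsGradInvLaplacian Q Γ) :
    IsGradInvLaplacianModConst Q Γ := ⟨h.1, fun η hη j ψ _ => h.2 η hη j ψ⟩

/-- The test functions ∂ⱼφ have mean zero, so convergence modulo constants is enough. By ∑ⱼ Δ⁻¹∂ⱼ∂ⱼφ
= φ, the sum of the truncated pairings equals -Q(φ) as soon as the cutoff is 1 on the support of φ.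
-/
theorem IsGradInvLaplacianModConst.isDivergence (hn : n ≠ 0) {Γ : VectorField n}
    (h : IsGradInvLaplacianModConst Q Γ) : IsDivergence Q Γ := by
  refine ⟨h.1, fun φ => ?_⟩
  have h1 : Tendsto (fun R : ℝ => ∑ j, truncatedPairing Q (stdCutoff n) R j (testPderiv j φ)) atTop
      (𝓝 (∑ j, ∫ x, testPderiv j φ x • Γ x j)) :=
    tendsto_finsetSum _ fun j _ => h.2 _ (eventually_stdCutoff n) j _
      (integral_pderiv_eq_zero j (φ.contDiff.of_le (by simp)) φ.hasCompactSupport)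
  have h2 : Tendsto (fun R : ℝ => ∑ j, truncatedPairing Q (stdCutoff n) R j (testPderiv j φ)) atTop
      (𝓝 (-Q φ)) := by
    refine tendsto_const_nhds.congr' ?_
    obtain ⟨ρ, -, hρ⟩ := φ.hasCompactSupport.isCompact.isBounded.subset_closedBall_lt 0 (0 : Rn n)
    filter_upwards [eventually_ge_atTop ρ, eventually_gt_atTop 0] with R hR hR0
    simp only [truncatedPairing, Finset.sum_neg_distrib]
    rw [← map_sum]
    congr 2
    ext x
    have h3 : (∑ j, truncated (stdCutoff n) R j (testPderiv j φ)) x =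
        ∑ j, truncated (stdCutoff n) R j (testPderiv j φ) x := by
      simp
    rw [h3]
    simp_rw [truncated_apply _ hR0.ne']
    rw [← Finset.mul_sum, sum_invLaplacianDeriv_testPderiv hn]
    by_cases h0 : φ x = 0
    · rw [h0, mul_zero]
    · have h4 := hρ (subset_tsupport (⇑φ) h0)
      rw [mem_closedBall_zero_iff] at h4
      rw [stdCutoff_eq_one, one_mul]
      rw [norm_smul, norm_inv, Real.norm_of_nonneg hR0.le, inv_mul_le_iff₀ hR0]
      linarith
  have h3 := tendsto_nhds_unique h2 h1
  rw [← neg_neg (Q φ), h3]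
  rfl

/-- Needed because the Hölder continuous field agrees with the constructed one only almost
everywhere. -/
theorem IsGradInvLaplacianModConst.congr_ae {Γ Γ' : VectorField n}
    (h : IsGradInvLaplacianModConst Q Γ) (he : Γ =ᵐ[volume] Γ') (hl : LocallyIntegrable Γ') :
    IsGradInvLaplacianModConst Q Γ' := by
  refine ⟨hl, fun η hη j ψ h0 => ?_⟩
  have h1 := h.2 η hη j ψ h0
  rwa [integral_congr_ae (g := fun x => ψ x • Γ' x j)] at h1
  filter_upwards [he] with x hx
  rw [hx]

/-- For lam < n no moment condition is needed (m = 0): the limit exists as a distribution, and the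
field is controlled without subtracting constants. -/
theorem LocalBound.exists_memMorrey (hQ : LocalBound Q K lam) (hlam : lam < n) :
    ∃ Γ : VectorField n, MemMorrey lam Γ ∧ IsGradInvLaplacian Q Γ := by
  obtain ⟨Γ, C, hC0, hΓ, h1, h2⟩ := hQ.exists_field (m := 0) zero_le_one (by simpa using hlam)
  refine ⟨Γ, ⟨hΓ.aestronglyMeasurable, ⟨C, hC0⟩, fun x δ hδ => ?_⟩, hΓ, fun η hη j ψ =>
    h1 η hη j ψ (Or.inl rfl)⟩
  obtain ⟨c, hc0, hc⟩ := h2 x δ hδ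
  rw [hc0 rfl] at hc
  simp only [sub_zero] at hc
  refine hc.trans_eq ?_
  rw [ENNReal.ofReal_mul hC0]
  congr 1
  exact ENNReal.ofReal_eq_coe_nnreal hC0

theorem LocalBound.exists_modConst (hQ : LocalBound Q K lam) (hlam : lam < n + 2) :
    ∃ (Γ : VectorField n) (C : ℝ), 0 ≤ C ∧ IsGradInvLaplacianModConst Q Γ ∧
      ∀ (x₀ : Rn n) (δ : ℝ), 0 < δ → ∃ c,
        ∫⁻ x in Metric.ball x₀ δ, ‖Γ x - c‖ₑ ^ 2 ≤ ENNReal.ofReal (C * δ ^ lam) := by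
  obtain ⟨Γ, C, hC0, hΓ, h1, h2⟩ := hQ.exists_field (m := 1) le_rfl (by simpa using hlam)
  refine ⟨Γ, C, hC0, ⟨hΓ, fun η hη j ψ h0 => h1 η hη j ψ (Or.inr ⟨rfl, h0⟩)⟩, fun x δ hδ => ?_⟩
  obtain ⟨c, -, hc⟩ := h2 x δ hδ
  exact ⟨c, hc⟩

theorem LocalBound.exists_memBMO (hQ : LocalBound Q K n) :
    ∃ Γ : VectorField n, MemBMO Γ ∧ IsGradInvLaplacianModConst Q Γ := by
  obtain ⟨Γ, C, hC0, hΓ, h2⟩ := hQ.exists_modConst (by linarith)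
  obtain ⟨D, c, hD0, -, hc⟩ := exists_oscillation_center (C := C) (α := 0) hΓ.1
    (by simpa using h2)
  have hω := ballVol_pos n
  refine ⟨Γ, ⟨hΓ.1, 2 * D / ballVol n, fun x δ hδ => ?_⟩, hΓ⟩
  have h3 := integral_norm_sub_average_le (f := Γ) (s := Metric.ball x δ)
    (Metric.measure_ball_pos volume x hδ).ne' measure_ball_lt_top.ne
    (hΓ.1.integrableOn_of_isBounded Metric.isBounded_ball) (c x δ)
  rw [setAverage_eq, volume_real_ball x hδ, smul_eq_mul, inv_mul_le_iff₀ (by positivity)]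
  refine (h3.trans (mul_le_mul_of_nonneg_left (hc x δ hδ) zero_le_two)).trans_eq ?_
  rw [add_zero, Real.rpow_natCast]
  field_simp

/-! ### Campanato's characterization of Hölder continuity -/

/-- Halving s until it is comparable with r produces increments that form a geometric series of
ratio 2^{-α}. -/
theorem norm_sub_le_of_doubling {F : Type*} [NormedAddCommGroup F] {c : ℝ → F} {C α : ℝ}
    (hα : 0 < α) (hC : 0 ≤ C)
    (h : ∀ r s, 0 < r → r ≤ s → s ≤ 2 * r → ‖c r - c s‖ ≤ C * s ^ α) {r s : ℝ} (hr : 0 < r)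
    (hrs : r ≤ s) : ‖c r - c s‖ ≤ C / (1 - 2 ^ (-α)) * s ^ α := by
  have hq : (2 : ℝ) ^ (-α) < 1 := Real.rpow_lt_one_of_one_lt_of_neg one_lt_two (by linarith)
  have hq0 : (0 : ℝ) < 2 ^ (-α) := by positivity
  have hq1 : 0 < 1 - (2 : ℝ) ^ (-α) := by linarith
  have hCC : C ≤ C / (1 - 2 ^ (-α)) := by
    rw [le_div_iff₀ hq1]; nlinarith
  have key : ∀ (N : ℕ) (s : ℝ), r ≤ s → s ≤ 2 ^ N * r →
      ‖c r - c s‖ ≤ C / (1 - 2 ^ (-α)) * s ^ α := by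
    intro N
    induction N with
    | zero =>
      intro s hrs hsr
      have : r = s := le_antisymm hrs (by simpa using hsr)
      rw [this, sub_self, norm_zero]
      have := hr.trans_le hrs
      positivity
    | succ N ih =>
      intro s hrs hsr
      have hs := hr.trans_le hrs
      rcases le_total s (2 * r) with h2 | h2
      · exact (h r s hr hrs h2).trans (by gcongr)
      · have h3 := ih (s / 2) (by linarith) (by rw [pow_succ] at hsr; linarith)
        have h4 := h (s / 2) s (by linarith) (by linarith) (by linarith)
        have h5 := norm_sub_le_norm_sub_add_norm_sub (c r) (c (s / 2)) (c s)
        have h6 : (s / 2) ^ α = 2 ^ (-α) * s ^ α := by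
          rw [Real.div_rpow hs.le zero_le_two, Real.rpow_neg zero_le_two]; field_simp
        rw [h6] at h3
        have h7 : C / (1 - 2 ^ (-α)) * (2 ^ (-α) * s ^ α) + C * s ^ α =
            C / (1 - 2 ^ (-α)) * s ^ α := by
          field_simp
          ring
        linarith
  obtain ⟨N, hN⟩ := pow_unbounded_of_one_lt (s / r) one_lt_two
  exact key N s hrs ((div_le_iff₀ hr).1 hN.le)

/-- As r → 0 the centres on balls around x form a Cauchy sequence with rate r^α; its limit g equals
f almost everywhere by Lebesgue differentiation. For two points at distance r, the centres on B(x,r)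
⊆ B(y,2r) differ by O(r^α). -/
theorem exists_holder_representative {F : Type*} [NormedAddCommGroup F] [NormedSpace ℝ F]
    [CompleteSpace F] {f : Rn n → F} (hf : LocallyIntegrable f) {C α : ℝ} (hα : 0 < α)
    (h : ∀ (x : Rn n) (r : ℝ), 0 < r → ∃ c : F,
      ∫⁻ y in Metric.ball x r, ‖f y - c‖ₑ ^ 2 ≤ ENNReal.ofReal (C * r ^ (n + 2 * α))) :
    ∃ (g : Rn n → F) (M : ℝ), f =ᵐ[volume] g ∧ ∀ x y, ‖g x - g y‖ ≤ M * ‖x - y‖ ^ α := by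
  obtain ⟨D, c, hD0, -, hc⟩ := exists_oscillation_center hf h
  have hω := ballVol_pos n
  have hcmp : ∀ x y r s, 0 < r → r ≤ s → s ≤ 2 * r → Metric.ball x r ⊆ Metric.ball y s →
      ‖c x r - c y s‖ ≤ D * (1 + 2 ^ n) / ballVol n * s ^ α := by
    intro x y r s hr hrs hsr hsub
    have hs := hr.trans_le hrs
    rw [div_mul_eq_mul_div, le_div_iff₀ hω]
    have h1 := volume_mul_norm_sub_le hf hr hsub (c x r) (c y s)
    have h2 := hc x r hr
    have h3 := hc y s hs
    rw [Real.rpow_add hr, Real.rpow_natCast] at h2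
    rw [Real.rpow_add hs, Real.rpow_natCast] at h3
    have h4 : D * (r ^ n * r ^ α) ≤ D * (r ^ n * s ^ α) := by gcongr
    have h5 : D * (s ^ n * s ^ α) ≤ D * ((2 * r) ^ n * s ^ α) := by gcongr
    rw [mul_pow] at h5
    have h6 : 0 < r ^ n := by positivity
    refine le_of_mul_le_mul_right ?_ h6
    linarith
  set C₁ := D * (1 + 2 ^ n) / ballVol n with hC₁
  have hC₁0 : 0 ≤ C₁ := by positivity
  set C₂ := C₁ / (1 - 2 ^ (-α)) with hC₂
  have htel : ∀ x r s, 0 < r → r ≤ s → ‖c x r - c x s‖ ≤ C₂ * s ^ α := fun x r s hr hrs =>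
    norm_sub_le_of_doubling (c := c x) hα hC₁0 (fun r s hr hrs hsr => hcmp x x r s hr hrs hsr
      (Metric.ball_subset_ball hrs)) hr hrs
  set t : ℕ → ℝ := fun k => (1 / 2) ^ k with ht
  have ht0 : ∀ k, 0 < t k := fun k => by positivity
  have htlim : Tendsto t atTop (𝓝 0) :=
    tendsto_pow_atTop_nhds_zero_of_lt_one (by norm_num) (by norm_num)
  have htα : Tendsto (fun k => C₂ * t k ^ α) atTop (𝓝 0) := by
    have := (htlim.rpow_const (p := α) (Or.inr hα.le)).const_mul C₂
    rwa [Real.zero_rpow hα.ne', mul_zero] at this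
  have hcauchy : ∀ x, CauchySeq fun k => c x (t k) := by
    intro x
    refine cauchySeq_of_le_tendsto_0' (fun k => C₂ * t k ^ α) (fun k l hkl => ?_) htα
    rw [dist_eq_norm, norm_sub_rev]
    exact htel x _ _ (ht0 l) (pow_le_pow_of_le_one (by norm_num) (by norm_num) hkl)
  choose g hg using fun x => cauchySeq_tendsto_of_complete (hcauchy x)
  have hgc : ∀ x s, 0 < s → ‖g x - c x s‖ ≤ C₂ * s ^ α := by
    intro x s hs
    refine le_of_tendsto ((hg x).sub_const (c x s)).norm ?_
    filter_upwards [htlim.eventually (gt_mem_nhds hs)] with k hk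
    exact htel x _ _ (ht0 k) hk.le
  refine ⟨g, C₂ + C₁ * 2 ^ α + C₂ * 2 ^ α, ?_, fun x y => ?_⟩
  · filter_upwards [(Besicovitch.vitaliFamily (volume : Measure (Rn n))).ae_tendsto_average hf]
      with x hx
    have ht1 : Tendsto t atTop (𝓝[>] 0) :=
      tendsto_nhdsWithin_iff.2 ⟨htlim, Eventually.of_forall ht0⟩
    have h1 : Tendsto (fun k => ⨍ y in Metric.closedBall x (t k), f y) atTop (𝓝 (f x)) :=
      hx.comp ((Besicovitch.tendsto_filterAt volume x).comp ht1)
    refine tendsto_nhds_unique h1 ?_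
    have h2 : ∀ k, dist (⨍ y in Metric.closedBall x (t k), f y) (g x) ≤
        (D * (2 ^ (n + α) / ballVol n) + C₂ * 2 ^ α) * t k ^ α := by
      intro k
      have hk := ht0 k
      have h3 : ‖(⨍ y in Metric.closedBall x (t k), f y) - c x (2 * t k)‖ ≤
          D * (2 ^ (n + α) / ballVol n) * t k ^ α := by
        rw [← setAverage_sub_const (Metric.measure_closedBall_pos volume x hk).ne'
          measure_closedBall_lt_top.ne
          (hf.integrableOn_of_isBounded Metric.isBounded_closedBall)]
        refine (norm_setAverage_le _).trans ?_
        rw [volume_real_closedBall _ hk.le, inv_mul_le_iff₀ (by positivity)]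
        calc ∫ y in Metric.closedBall x (t k), ‖f y - c x (2 * t k)‖
            ≤ ∫ y in Metric.ball x (2 * t k), ‖f y - c x (2 * t k)‖ := by
              refine setIntegral_mono_set ?_ (Eventually.of_forall fun _ => norm_nonneg _)
                (LE.le.eventuallyLE (Metric.closedBall_subset_ball (by linarith)))
              exact (hf.sub (locallyIntegrable_const _)).norm_fun.integrableOn_of_isBounded
                Metric.isBounded_ball
          _ ≤ D * (2 * t k) ^ (n + α) := hc x _ (by positivity)
          _ = _ := by
              rw [Real.mul_rpow zero_le_two hk.le, Real.rpow_add hk, Real.rpow_natCast]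
              field_simp
      have h4 := hgc x (2 * t k) (by positivity)
      rw [Real.mul_rpow zero_le_two hk.le] at h4
      rw [dist_eq_norm]
      have h5 := norm_sub_le_norm_sub_add_norm_sub (⨍ y in Metric.closedBall x (t k), f y)
        (c x (2 * t k)) (g x)
      rw [norm_sub_rev (g x)] at h4
      linarith
    rw [tendsto_iff_dist_tendsto_zero]
    refine squeeze_zero (fun _ => dist_nonneg) h2 ?_
    have := (htlim.rpow_const (p := α) (Or.inr hα.le)).const_mul
      (D * (2 ^ (n + α) / ballVol n) + C₂ * 2 ^ α)
    rwa [Real.zero_rpow hα.ne', mul_zero] at this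
  · rcases eq_or_ne x y with rfl | hxy
    · simp [Real.zero_rpow hα.ne']
    set r := ‖x - y‖ with hr
    have hr0 : 0 < r := norm_pos_iff.2 (sub_ne_zero.2 hxy)
    have h1 := hgc x r hr0
    have h2 := hgc y (2 * r) (by positivity)
    have h3 := hcmp x y r (2 * r) hr0 (by linarith) le_rfl (by
      intro z hz
      rw [mem_ball_iff_norm] at hz ⊢
      have := norm_sub_le_norm_sub_add_norm_sub z x y
      linarith)
    rw [Real.mul_rpow zero_le_two hr0.le] at h2 h3
    have h4 := norm_sub_le_norm_sub_add_norm_sub (g x) (c x r) (g y)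
    have h5 := norm_sub_le_norm_sub_add_norm_sub (c x r) (c y (2 * r)) (g y)
    rw [norm_sub_rev (g y)] at h2
    linarith

theorem LocalBound.exists_memLip {α : ℝ} (hα : 0 < α) (hα1 : α < 1)
    (hQ : LocalBound Q K (n + 2 * α)) :
    ∃ Γ : VectorField n, MemLip α Γ ∧ IsGradInvLaplacianModConst Q Γ := by
  obtain ⟨Γ, C, hC0, hΓ, h2⟩ := hQ.exists_modConst (by linarith)
  obtain ⟨Γ', M, he, hM⟩ := exists_holder_representative hΓ.1 hα h2
  have hL : MemLip α Γ' := ⟨M, hM⟩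
  exact ⟨Γ', hL, hΓ.congr_ae he (hL.continuous hα).locallyIntegrable⟩

end

end NashForm

namespace NashForm

/-! ### Distributions that are bounded by gradients in a subcritical way -/

section

variable {n : ℕ} {Q : Distr n} {K lam : ℝ}

/-- The partial derivative as a linear map on test functions. -/
noncomputable def pderivLinear (j : Fin n) : 𝓓(whole n, ℝ) →ₗ[ℝ] 𝓓(whole n, ℝ) where
  toFun := testPderiv j
  map_add' φ ψ := by
    ext x
    exact pderiv_add j (test_differentiable φ x) (test_differentiable ψ x)
  map_smul' c ψ := by
    ext x
    exact pderiv_const_mul j c (test_differentiable ψ x)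

/-- The gradient of a test function in `L²`. -/
noncomputable def gradToL2 (n : ℕ) : 𝓓(whole n, ℝ) →ₗ[ℝ]
    PiLp 2 (fun _ : Fin n => Lp ℝ 2 (volume : Measure (Rn n))) :=
  (WithLp.linearEquiv 2 ℝ (Fin n → Lp ℝ 2 (volume : Measure (Rn n)))).symm.toLinearMap ∘ₗ
    LinearMap.pi fun j => testToL2 n ∘ₗ pderivLinear j

theorem gradToL2_apply (ψ : 𝓓(whole n, ℝ)) (j : Fin n) :
    gradToL2 n ψ j = testToL2 n (testPderiv j ψ) := rfl

theorem norm_gradToL2 (ψ : 𝓓(whole n, ℝ)) : ‖gradToL2 n ψ‖ = √(gradSq ψ) := by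
  rw [PiLp.norm_eq_of_L2, gradSq_eq_sum]
  congr 1
  refine Finset.sum_congr rfl fun j _ => ?_
  rw [gradToL2_apply, norm_testToL2, Real.sq_sqrt (integral_nonneg fun x => sq_nonneg _)]
  rfl

/-- On a fixed ball T is bounded in terms of ∇u in L², so Riesz makes it a sum of integrals against
∂ⱼu. This form is what allows Fubini in `abs_apply_mollifyTest_le`. -/
theorem exists_grad_representation (T : 𝓓(whole n, ℝ) →ₗ[ℝ] ℝ) {ρ : ℝ} (hK : 0 ≤ K)
    (hT : ∀ u : 𝓓(whole n, ℝ), tsupport u ⊆ Metric.closedBall 0 ρ → |T u| ≤ K * √(gradSq u)) :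
    ∃ y : Fin n → Rn n → ℝ, (∀ j, LocallyIntegrable (y j)) ∧
      ∀ u : 𝓓(whole n, ℝ), tsupport u ⊆ Metric.closedBall 0 ρ →
        T u = ∑ j, ∫ x in Metric.closedBall 0 ρ, pderiv j u x * y j x := by
  obtain ⟨y, -, hy⟩ := exists_riesz_of_le
    ((gradToL2 n).domRestrict (supportedIn (Metric.closedBall 0 ρ)))
    (T.domRestrict (supportedIn (Metric.closedBall 0 ρ))) hK fun u => by
      rw [LinearMap.domRestrict_apply, LinearMap.domRestrict_apply, norm_gradToL2]
      exact hT u (isClosed_tsupport_subset Metric.isClosed_closedBall u.2)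
  refine ⟨fun j => y j, fun j => (Lp.memLp (y j)).locallyIntegrable one_le_two, fun u hu => ?_⟩
  have h1 := hy ⟨u, mem_supportedIn_of_tsupport hu⟩
  rw [LinearMap.domRestrict_apply, LinearMap.domRestrict_apply, PiLp.inner_apply] at h1
  rw [h1]
  refine Finset.sum_congr rfl fun j _ => ?_
  rw [gradToL2_apply, inner_testToL2, setIntegral_eq_integral_of_forall_compl_eq_zero]
  · rfl
  · intro x hx
    rw [pderiv_eq_zero_of_notMem j fun h => hx (hu h), zero_mul]

/-- The mollifier at scale `δ` centered at `x`. -/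
noncomputable def mollifierAt (x : Rn n) (δ : ℝ) : 𝓓(whole n, ℝ) :=
  (∫ y, cutoffAt (0 : Rn n) δ y)⁻¹ • cutoffAt x δ

theorem coe_mollifierAt (x : Rn n) {δ : ℝ} (hδ : 0 < δ) :
    ⇑(mollifierAt x δ) = fun z => mollifier n δ (z - x) := by
  ext z
  change (∫ y, cutoffAt (0 : Rn n) δ y)⁻¹ * cutoffAt x δ z =
    (∫ y, cutoffAt (0 : Rn n) δ y)⁻¹ * cutoffAt (0 : Rn n) δ (z - x)
  rw [cutoffAt, cutoffAt, rescale_apply _ _ hδ, rescale_apply _ _ hδ, sub_zero]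

theorem pderiv_mollifierAt (j : Fin n) (x : Rn n) {δ : ℝ} (hδ : 0 < δ) (z : Rn n) :
    pderiv j (mollifierAt x δ) z = pderiv j (mollifier n δ) (z - x) := by
  rw [coe_mollifierAt x hδ]
  have := pderiv_comp_affine (x := z) j 1 x (test_differentiable (mollifier n δ))
  simpa using this

theorem tsupport_mollifierAt (x : Rn n) {δ : ℝ} (hδ : 0 < δ) :
    tsupport (mollifierAt x δ) ⊆ Metric.closedBall x (2 * δ) := by
  refine isClosed_tsupport_subset Metric.isClosed_closedBall fun z hz => ?_
  rw [coe_mollifierAt x hδ]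
  refine mollifier_eq_zero hδ ?_
  rwa [mem_closedBall_iff_norm, not_le] at hz

/-- The gradient has size δ^{-n-1} on a set of volume of order δⁿ, so the energy is O(δ^{-(n+2)}).
-/
theorem exists_gradSq_mollifierAt_le (n : ℕ) : ∃ C : ℝ, 0 ≤ C ∧ ∀ (x : Rn n) (δ : ℝ), 0 < δ →
    √(gradSq (mollifierAt x δ)) ≤ C * δ ^ (-((n + 2 : ℝ) / 2)) := by
  obtain ⟨M, hM0, hM⟩ := exists_pderiv_mollifier_bound n
  have hω := ballVol_pos n
  refine ⟨√(n * M ^ 2 * (ballVol n)⁻¹ * 2 ^ n), Real.sqrt_nonneg _, fun x δ hδ => ?_⟩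
  have h1 : gradSq (mollifierAt x δ) ≤
      (n * (M * δ⁻¹ * (ballVol n * δ ^ n)⁻¹) ^ 2) * (ballVol n * (2 * δ) ^ n) := by
    refine integral_le_of_support_closedBall (x₀ := x) (by positivity) (fun z => ?_)
      (fun z hz => ?_) (integrable_sum_pderiv_sq _)
    · calc ∑ j, pderiv j (mollifierAt x δ) z ^ 2
          ≤ ∑ _j : Fin n, (M * δ⁻¹ * (ballVol n * δ ^ n)⁻¹) ^ 2 :=
            Finset.sum_le_sum fun j _ => by
              rw [pderiv_mollifierAt j x hδ, ← sq_abs]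
              exact pow_le_pow_left₀ (abs_nonneg _) (hM δ hδ j _) 2
        _ = _ := by simp
    · simp [pderiv_eq_zero_of_notMem _ fun h => hz (tsupport_mollifierAt x hδ h)]
  refine (Real.sqrt_le_sqrt h1).trans_eq ?_
  have h2 : δ ^ (-((n + 2 : ℝ) / 2)) = √((δ ^ (n + 2))⁻¹) := by
    rw [Real.sqrt_eq_rpow, ← Real.rpow_natCast, ← Real.rpow_neg hδ.le, ← Real.rpow_mul hδ.le]
    congr 1
    push_cast
    ring
  rw [h2, ← Real.sqrt_mul (by positivity)]
  congr 1
  rw [mul_pow 2 δ, pow_add]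
  field_simp

/-- The mollification of a test function. -/
noncomputable def mollifyTest (ψ : 𝓓(whole n, ℝ)) (δ : ℝ) : 𝓓(whole n, ℝ) :=
  testOf (mollify ψ δ)
    ((mollifier n δ).hasCompactSupport.contDiff_convolution_right _
      ψ.continuous.locallyIntegrable (mollifier n δ).contDiff)
    (ψ.hasCompactSupport.convolution _ (mollifier n δ).hasCompactSupport)

theorem coe_mollifyTest (ψ : 𝓓(whole n, ℝ)) (δ : ℝ) : ⇑(mollifyTest ψ δ) = mollify ψ δ := rfl

theorem tsupport_mollifyTest {ψ : 𝓓(whole n, ℝ)} {a δ : ℝ} (hδ : 0 < δ)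
    (hψ : tsupport ψ ⊆ Metric.closedBall 0 a) :
    tsupport (mollifyTest ψ δ) ⊆ Metric.closedBall 0 (a + 2 * δ) := by
  refine isClosed_tsupport_subset Metric.isClosed_closedBall fun x hx => ?_
  rw [mem_closedBall_zero_iff, not_le] at hx
  rw [coe_mollifyTest, mollify_apply]
  refine integral_eq_zero_of_ae (Eventually.of_forall fun y => ?_)
  by_cases hy : ψ y = 0
  · simp [hy]
  · have h1 := hψ (subset_tsupport (⇑ψ) hy)
    rw [mem_closedBall_zero_iff] at h1
    have h2 := norm_sub_norm_le x y
    simp [mollifier_eq_zero hδ (x := x - y) (by linarith)]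

theorem pderiv_mollifyTest (ψ : 𝓓(whole n, ℝ)) (δ : ℝ) (j : Fin n) (x : Rn n) :
    pderiv j (mollifyTest ψ δ) x = mollify (pderiv j ψ) δ x := by
  have h1 : ContDiff ℝ 1 (mollifier n δ) := (mollifier n δ).contDiff.of_le (by simp)
  have hψ : ContDiff ℝ 1 ψ := ψ.contDiff.of_le (by simp)
  rw [coe_mollifyTest, pderiv_mollify ψ.continuous.locallyIntegrable, mollify_apply]
  simp only [smul_eq_mul]
  rw [integral_mul_pderiv j (contDiff_comp_const_sub h1 x) hψ ψ.hasCompactSupport]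
  simp_rw [pderiv_comp_const_sub j x (test_differentiable (mollifier n δ)), neg_mul, integral_neg,
    neg_neg]

/-- T passes under the convolution integral: its value on the mollification of ψ is the integral of
ψ(x) times its value on the mollifier centred at x. The condition on a and δ keeps these mollifiers
inside the ball where T is represented. -/
theorem abs_apply_mollifyTest_le (T : 𝓓(whole n, ℝ) →ₗ[ℝ] ℝ) {ρ a δ L : ℝ} (hK : 0 ≤ K)
    (hT : ∀ u : 𝓓(whole n, ℝ), tsupport u ⊆ Metric.closedBall 0 ρ → |T u| ≤ K * √(gradSq u))
    (hδ : 0 < δ) (ha : a + 2 * δ ≤ ρ) {ψ : 𝓓(whole n, ℝ)}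
    (hψ : tsupport ψ ⊆ Metric.closedBall 0 a) (hL : ∀ x : Rn n, |T (mollifierAt x δ)| ≤ L) :
    |T (mollifyTest ψ δ)| ≤ L * ∫ x, |ψ x| := by
  obtain ⟨y, hy, hrep⟩ := exists_grad_representation T hK hT
  set B := Metric.closedBall (0 : Rn n) ρ with hB
  set μ := (volume : Measure (Rn n)).restrict B with hμ
  have : IsFiniteMeasure μ := ⟨by rw [hμ, Measure.restrict_apply_univ]; exact measure_closedBall_lt_top⟩
  obtain ⟨M, hM0, hM⟩ := exists_pderiv_bound (mollifier n δ)
  have hcont : ∀ j, Continuous (pderiv j (mollifier n δ)) := fun j =>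
    (testPderiv j (mollifier n δ)).continuous
  have hint : ∀ j, Integrable (fun q : Rn n × Rn n =>
      pderiv j (mollifier n δ) (q.1 - q.2) * (y j q.1 * ψ q.2)) (μ.prod volume) := by
    intro j
    have h1 : Integrable (y j) μ := (hy j).integrableOn_of_isBounded Metric.isBounded_closedBall
    have h2 := h1.mul_prod (test_integrable ψ)
    refine h2.bdd_mul (c := M) ?_ (Eventually.of_forall fun q => ?_)
    · exact ((hcont j).comp (continuous_fst.sub continuous_snd)).aestronglyMeasurable
    · exact hM j _
  have h1 : T (mollifyTest ψ δ) = ∫ x, ψ x * ∑ j, ∫ z, pderiv j (mollifier n δ) (z - x) * y j z ∂μ := by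
    rw [hrep _ ((tsupport_mollifyTest hδ hψ).trans (Metric.closedBall_subset_closedBall ha))]
    simp_rw [Finset.mul_sum]
    rw [integral_finsetSum]
    · refine Finset.sum_congr rfl fun j _ => ?_
      calc ∫ z in B, pderiv j (mollifyTest ψ δ) z * y j z
          = ∫ z, (∫ x, pderiv j (mollifier n δ) (z - x) * (y j z * ψ x)) ∂μ := by
            refine integral_congr_ae (Eventually.of_forall fun z => ?_)
            simp only
            rw [coe_mollifyTest, pderiv_mollify ψ.continuous.locallyIntegrable,
              ← integral_mul_const]
            refine integral_congr_ae (Eventually.of_forall fun x => ?_)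
            simp only [smul_eq_mul]
            ring
        _ = ∫ x, (∫ z, pderiv j (mollifier n δ) (z - x) * (y j z * ψ x) ∂μ) :=
            integral_integral_swap (hint j)
        _ = _ := by
            refine integral_congr_ae (Eventually.of_forall fun x => ?_)
            simp only
            rw [← integral_const_mul]
            refine integral_congr_ae (Eventually.of_forall fun z => ?_)
            simp only
            ring
    · intro j _
      refine (hint j).integral_prod_right.congr (Eventually.of_forall fun x => ?_)
      simp only
      rw [← integral_const_mul]
      refine integral_congr_ae (Eventually.of_forall fun z => ?_)
      simp only
      ring
  rw [h1, ← integral_const_mul, ← Real.norm_eq_abs]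
  refine norm_integral_le_of_norm_le ((test_integrable ψ).abs.const_mul L)
    (Eventually.of_forall fun x => ?_)
  by_cases h0 : ψ x = 0
  · simp [h0]
  · have hx := hψ (subset_tsupport (⇑ψ) h0)
    rw [mem_closedBall_zero_iff] at hx
    have h2 : tsupport (mollifierAt x δ) ⊆ Metric.closedBall 0 ρ := by
      refine (tsupport_mollifierAt x hδ).trans (Metric.closedBall_subset_closedBall' ?_)
      rw [dist_zero_right]
      linarith
    have h3 := hL x
    rw [hrep _ h2] at h3
    simp_rw [pderiv_mollifierAt _ x hδ] at h3
    rw [norm_mul, mul_comm, Real.norm_eq_abs, Real.norm_eq_abs]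
    gcongr

/-- Mollification commutes with ∂ⱼ, and ∂ⱼψ is Lipschitz, so the error is O(δ) uniformly on a fixed
ball. -/
theorem exists_sqrt_gradSq_mollifyTest_sub_le (ψ : 𝓓(whole n, ℝ)) : ∃ C : ℝ, 0 ≤ C ∧
    ∀ δ : ℝ, 0 < δ → δ ≤ 1 → √(gradSq (mollifyTest ψ δ - ψ)) ≤ C * δ := by
  have hω := ballVol_pos n
  obtain ⟨a, ha0, ha⟩ := ψ.hasCompactSupport.isCompact.isBounded.subset_closedBall_lt 0 (0 : Rn n)
  have hLip : ∀ j : Fin n, ∃ L : ℝ≥0, LipschitzWith L (pderiv j ψ) := fun j =>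
    ((testPderiv j ψ).contDiff.lipschitzWith_of_hasCompactSupport
      (testPderiv j ψ).hasCompactSupport (by simp))
  choose L hL using hLip
  set Λ : ℝ := ∑ j, (L j : ℝ) with hΛ
  have hΛ0 : 0 ≤ Λ := Finset.sum_nonneg fun j _ => (L j).2
  have hLΛ : ∀ j, (L j : ℝ) ≤ Λ := fun j =>
    Finset.single_le_sum (f := fun j => (L j : ℝ)) (fun j _ => (L j).2) (Finset.mem_univ j)
  refine ⟨√(n * (2 ^ n * (Λ * 2)) ^ 2 * (ballVol n * (a + 2) ^ n)), Real.sqrt_nonneg _,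
    fun δ hδ hδ1 => ?_⟩
  have hpt : ∀ j x, |pderiv j (mollifyTest ψ δ - ψ) x| ≤ 2 ^ n * (Λ * 2) * δ := by
    intro j x
    rw [pderiv_test_sub, pderiv_mollifyTest]
    have hloc : LocallyIntegrable (pderiv j ψ) := (testPderiv j ψ).continuous.locallyIntegrable
    refine (norm_mollify_sub_le hloc hδ x (pderiv j ψ x)).trans ?_
    rw [inv_mul_le_iff₀ (by positivity)]
    calc ∫ y in Metric.closedBall x (2 * δ), ‖pderiv j ψ y - pderiv j ψ x‖
        ≤ ∫ y in Metric.closedBall x (2 * δ), Λ * (2 * δ) := by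
          refine setIntegral_mono_on ?_ (integrableOn_const measure_closedBall_lt_top.ne)
            measurableSet_closedBall fun y hy => ?_
          · exact (hloc.sub (locallyIntegrable_const _)).norm_fun.integrableOn_of_isBounded
              Metric.isBounded_closedBall
          · rw [mem_closedBall_iff_norm] at hy
            refine ((hL j).norm_sub_le y x).trans ?_
            have := hLΛ j
            gcongr
      _ = ballVol n * δ ^ n * (2 ^ n * (Λ * 2) * δ) := by
          rw [setIntegral_const, volume_real_closedBall _ (by positivity), smul_eq_mul, mul_pow]
          ring
  have hsupp : tsupport (mollifyTest ψ δ - ψ) ⊆ Metric.closedBall 0 (a + 2) := by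
    refine (tsupport_sub _ _).trans (Set.union_subset ?_ ?_)
    · exact (tsupport_mollifyTest hδ ha).trans (Metric.closedBall_subset_closedBall (by linarith))
    · exact ha.trans (Metric.closedBall_subset_closedBall (by linarith))
  have h1 : gradSq (mollifyTest ψ δ - ψ) ≤
      (n * (2 ^ n * (Λ * 2) * δ) ^ 2) * (ballVol n * (a + 2) ^ n) := by
    refine integral_le_of_support_closedBall (x₀ := 0) (by positivity) (fun z => ?_)
      (fun z hz => ?_) (integrable_sum_pderiv_sq _)
    · calc ∑ j, pderiv j (mollifyTest ψ δ - ψ) z ^ 2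
          ≤ ∑ _j : Fin n, (2 ^ n * (Λ * 2) * δ) ^ 2 :=
            Finset.sum_le_sum fun j _ => by
              rw [← sq_abs]
              exact pow_le_pow_left₀ (abs_nonneg _) (hpt j z) 2
        _ = _ := by simp
    · refine Finset.sum_eq_zero fun j _ => ?_
      rw [pderiv_eq_zero_of_notMem _ fun h => hz (hsupp h), zero_pow two_ne_zero]
  refine (Real.sqrt_le_sqrt h1).trans_eq ?_
  rw [show (n * (2 ^ n * (Λ * 2) * δ) ^ 2) * (ballVol n * (a + 2) ^ n) =
    n * (2 ^ n * (Λ * 2)) ^ 2 * (ballVol n * (a + 2) ^ n) * δ ^ 2 by ring,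
    Real.sqrt_mul (by positivity), Real.sqrt_sq hδ.le]

/-- On a mollifier at scale δ the local bound is of order δ^{lam/2} δ^{-(n+2)/2} = δ^{α-1}, which
transfers to mollifications of ψ. The error of mollification costs C'δ. Only C' depends on ψ; the
factor 2 joins real and imaginary parts. -/
theorem LocalBound.exists_integral_bound (hQ : LocalBound Q K lam) : ∃ C : ℝ, 0 ≤ C ∧
    ∀ ψ : 𝓓(whole n, ℝ), ∃ C' : ℝ, ∀ δ : ℝ, 0 < δ → δ ≤ 1 →
      ‖Q ψ‖ ≤ C * δ ^ ((lam - (n + 2)) / 2) * (∫ x, |ψ x|) + C' * δ := by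
  obtain ⟨C, hC0, hC⟩ := exists_gradSq_mollifierAt_le n
  have hK := hQ.1
  refine ⟨2 * (K * 2 ^ (lam / 2) * C), by positivity, fun ψ => ?_⟩
  obtain ⟨a, ha0, ha⟩ := ψ.hasCompactSupport.isCompact.isBounded.subset_closedBall_lt 0 (0 : Rn n)
  obtain ⟨C', hC'0, hC'⟩ := exists_sqrt_gradSq_mollifyTest_sub_le ψ
  set K' := K * (a + 2) ^ (lam / 2) with hK'
  have hK'0 : 0 ≤ K' := by positivity
  refine ⟨2 * (K' * C'), fun δ hδ hδ1 => ?_⟩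
  set L := K * 2 ^ (lam / 2) * C * δ ^ ((lam - (n + 2)) / 2) with hLdef
  have hQL : ∀ x, ‖Q (mollifierAt x δ)‖ ≤ L := by
    intro x
    refine (hQ.2 x (2 * δ) (by positivity) _ (tsupport_mollifierAt x hδ)).trans ?_
    refine (mul_le_mul_of_nonneg_left (hC x δ hδ) (by positivity)).trans_eq ?_
    rw [hLdef, Real.mul_rpow zero_le_two hδ.le,
      show (lam - (n + 2)) / 2 = lam / 2 + -((n + 2 : ℝ) / 2) by ring, Real.rpow_add hδ]
    ring
  have key : ∀ T : 𝓓(whole n, ℝ) →ₗ[ℝ] ℝ, (∀ u, |T u| ≤ ‖Q u‖) →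
      |T ψ| ≤ L * (∫ x, |ψ x|) + K' * C' * δ := by
    intro T hT
    have hTK : ∀ u : 𝓓(whole n, ℝ), tsupport u ⊆ Metric.closedBall 0 (a + 2) →
        |T u| ≤ K' * √(gradSq u) := fun u hu => (hT u).trans (hQ.2 0 (a + 2) (by positivity) u hu)
    have h1 := abs_apply_mollifyTest_le T hK'0 hTK hδ (by linarith) ha
      fun x => (hT _).trans (hQL x)
    have h2 : |T (mollifyTest ψ δ - ψ)| ≤ K' * (C' * δ) := by
      refine (hTK _ ?_).trans (mul_le_mul_of_nonneg_left (hC' δ hδ hδ1) hK'0)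
      refine (tsupport_sub _ _).trans (Set.union_subset ?_ ?_)
      · exact (tsupport_mollifyTest hδ ha).trans (Metric.closedBall_subset_closedBall (by linarith))
      · exact ha.trans (Metric.closedBall_subset_closedBall (by linarith))
    rw [map_sub] at h2
    have h3 := abs_sub_abs_le_abs_sub (T ψ) (T (mollifyTest ψ δ))
    rw [abs_sub_comm] at h3
    linarith
  set Ql : 𝓓(whole n, ℝ) →ₗ[ℝ] ℂ :=
    { toFun := Q, map_add' := map_add Q, map_smul' := map_smul Q } with hQl
  have h1 := key (Complex.reLm ∘ₗ Ql) fun u => Complex.abs_re_le_norm _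
  have h2 := key (Complex.imLm ∘ₗ Ql) fun u => Complex.abs_im_le_norm _
  have h3 := Complex.norm_le_abs_re_add_abs_im (Q ψ)
  have h4 : |(Q ψ).re| ≤ L * (∫ x, |ψ x|) + K' * C' * δ := h1
  have h5 : |(Q ψ).im| ≤ L * (∫ x, |ψ x|) + K' * C' * δ := h2
  refine h3.trans ((add_le_add h4 h5).trans_eq ?_)
  rw [hLdef]
  ring

/-- For lam > n+2 both powers of δ in `LocalBound.exists_integral_bound` are positive, so everything
vanishes as δ → 0. -/
theorem LocalBound.eq_zero (hQ : LocalBound Q K lam) (hlam : n + 2 < lam) : Q = 0 := by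
  obtain ⟨C, hC0, hC⟩ := hQ.exists_integral_bound
  ext ψ
  obtain ⟨C', hC'⟩ := hC ψ
  change Q ψ = 0
  rw [← norm_le_zero_iff]
  have hpos : 0 < (lam - (n + 2)) / 2 := by linarith
  have h1 : Tendsto (fun δ : ℝ => C * δ ^ ((lam - (n + 2)) / 2) * (∫ x, |ψ x|) + C' * δ)
      (𝓝[>] 0) (𝓝 0) := by
    refine tendsto_nhdsWithin_of_tendsto_nhds ?_
    have h2 : ContinuousAt (fun δ : ℝ => C * δ ^ ((lam - (n + 2)) / 2) * (∫ x, |ψ x|) + C' * δ) 0 :=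
      ((continuousAt_const.mul (Real.continuousAt_rpow_const _ _ (Or.inr hpos.le))).mul
        continuousAt_const).add (continuousAt_const.mul continuousAt_id)
    have h3 := h2.tendsto
    simpa [Real.zero_rpow hpos.ne'] using h3
  refine ge_of_tendsto h1 ?_
  filter_upwards [Ioc_mem_nhdsGT one_pos] with δ hδ
  exact hC' δ hδ.1 hδ.2

theorem LocalBound.exists_norm_le_integral (hQ : LocalBound Q K (n + 2)) :
    ∃ C : ℝ, 0 ≤ C ∧ ∀ ψ : 𝓓(whole n, ℝ), ‖Q ψ‖ ≤ C * ∫ x, |ψ x| := by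
  obtain ⟨C, hC0, hC⟩ := hQ.exists_integral_bound
  refine ⟨C, hC0, fun ψ => ?_⟩
  obtain ⟨C', hC'⟩ := hC ψ
  have h1 : Tendsto (fun δ : ℝ => C * (∫ x, |ψ x|) + C' * δ) (𝓝[>] 0)
      (𝓝 (C * (∫ x, |ψ x|) + C' * 0)) :=
    tendsto_nhdsWithin_of_tendsto_nhds (tendsto_const_nhds.add (tendsto_id.const_mul C'))
  rw [mul_zero, add_zero] at h1
  refine ge_of_tendsto h1 ?_
  filter_upwards [Ioc_mem_nhdsGT one_pos] with δ hδ
  have := hC' δ hδ.1 hδ.2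
  rwa [sub_self, zero_div, Real.rpow_zero, mul_one] at this

/-- On each ball Cauchy–Schwarz gives an L² bound with constant of order the square root of the
volume. The density therefore has uniformly bounded averages of |f| over balls, and Lebesgue
differentiation bounds |f| almost everywhere. -/
theorem isBoundedFunction_of_norm_le_integral {C : ℝ} (hC0 : 0 ≤ C)
    (hC : ∀ ψ : 𝓓(whole n, ℝ), ‖Q ψ‖ ≤ C * ∫ x, |ψ x|) : IsBoundedFunction Q := by
  have hω := ballVol_pos n
  set Ql : 𝓓(whole n, ℝ) →ₗ[ℝ] ℂ :=
    { toFun := Q, map_add' := map_add Q, map_smul' := map_smul Q } with hQl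
  have hL2 : ∀ (x₀ : Rn n) (ρ : ℝ), 0 < ρ → ∀ ψ : 𝓓(whole n, ℝ),
      tsupport ψ ⊆ Metric.closedBall x₀ ρ →
      ‖Ql ψ‖ ≤ C * √(ballVol n * ρ ^ n) * √(∫ x, ψ x ^ 2) := fun x₀ ρ hρ ψ hψ => by
    refine (hC ψ).trans ?_
    rw [mul_assoc]
    exact mul_le_mul_of_nonneg_left (integral_abs_le_of_tsupport ψ hρ.le hψ) hC0
  obtain ⟨f, hf1, hf2⟩ := exists_locallyIntegrable_representation Ql fun ρ hρ =>
    ⟨C * √(ballVol n * ρ ^ n), by positivity, hL2 0 ρ hρ⟩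
  have hball : ∀ (x : Rn n) (r : ℝ), 0 < r → ∫ y in Metric.ball x r, ‖f y‖ ≤
      √2 * C * (ballVol n * r ^ n) := by
    intro x r hr
    obtain ⟨g, hg1, hg2, hg3⟩ := exists_L2_representation Ql
      (supportedIn (Metric.closedBall x r)) (K := C * √(ballVol n * r ^ n)) (by positivity)
      fun ψ hψ => hL2 x r hr ψ (isClosed_tsupport_subset Metric.isClosed_closedBall hψ)
    have h1 := ae_eq_on_ball_of_integral_eq hf1 (hg1.locallyIntegrable one_le_two)
      (x₀ := x) (δ := r) fun ψ hψ => by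
        rw [← hf2 ψ]
        exact hg3 ψ (mem_supportedIn_of_tsupport (hψ.trans Metric.ball_subset_closedBall))
    have h2 : ∫⁻ y in Metric.ball x r, ‖f y‖ₑ ^ 2 ≤
        ENNReal.ofReal (2 * (C * √(ballVol n * r ^ n)) ^ 2) := by
      calc ∫⁻ y in Metric.ball x r, ‖f y‖ₑ ^ 2 = ∫⁻ y in Metric.ball x r, ‖g y‖ₑ ^ 2 := by
            refine setLIntegral_congr_fun_ae measurableSet_ball ?_
            filter_upwards [h1] with y hy hyB
            rw [hy hyB]
        _ ≤ _ := (setLIntegral_le_lintegral _ _).trans hg2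
    refine (setIntegral_norm_le_sqrt (hf1.integrableOn_of_isBounded Metric.isBounded_ball)
      measure_ball_lt_top.ne h2).trans_eq ?_
    rw [volume_real_ball x hr, mul_pow, Real.sq_sqrt (by positivity),
      show ballVol n * r ^ n * (2 * (C ^ 2 * (ballVol n * r ^ n))) =
        2 * (C * (ballVol n * r ^ n)) ^ 2 by ring, Real.sqrt_mul zero_le_two,
      Real.sqrt_sq (by positivity), mul_assoc]
  refine ⟨f, memLp_top_of_bound hf1.aestronglyMeasurable (√2 * C * 2 ^ n) ?_, hf2⟩
  filter_upwards [(Besicovitch.vitaliFamily (volume : Measure (Rn n))).ae_tendsto_average hf1]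
    with x hx
  have h1 := hx.comp (Besicovitch.tendsto_filterAt volume x)
  refine le_of_tendsto h1.norm ?_
  filter_upwards [self_mem_nhdsWithin] with r hr
  have hr0 : 0 < r := hr
  refine (norm_setAverage_le _).trans ?_
  rw [volume_real_closedBall _ hr0.le, inv_mul_le_iff₀ (by positivity)]
  calc ∫ y in Metric.closedBall x r, ‖f y‖ ≤ ∫ y in Metric.ball x (2 * r), ‖f y‖ := by
        refine setIntegral_mono_set ?_ (Eventually.of_forall fun _ => norm_nonneg _)
          (LE.le.eventuallyLE (Metric.closedBall_subset_ball (by linarith)))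
        exact hf1.norm_fun.integrableOn_of_isBounded Metric.isBounded_ball
    _ ≤ √2 * C * (ballVol n * (2 * r) ^ n) := hball x _ (by positivity)
    _ = _ := by rw [mul_pow]; ring

end

end NashForm

open NashForm in
theorem corollary3p9 (n : ℕ) (hn : 2 ≤ n) (p : ℝ) (hp0 : 0 < p) (hp1 : p < 1) (Q : Distr n) :
    (p < n / (n + 2) → (NashInequality Q p ↔ Q = 0)) ∧
    (p = n / (n + 2) → (NashInequality Q p ↔ IsBoundedFunction Q)) ∧
    (n / (n + 2) < p → p < (n + 1) / (n + 2) →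
      [NashInequality Q p,
        ∃ Γ, MemLip (n + 1 - p * (n + 2)) Γ ∧ IsDivergence Q Γ,
        ∃ Γ, MemLip (n + 1 - p * (n + 2)) Γ ∧ IsGradInvLaplacianModConst Q Γ,
        ∃ Γ, MemLip (n + 1 - p * (n + 2)) Γ ∧ IsGradInvLaplacianModConst Q Γ ∧
          IsDivergence Q Γ].TFAE) ∧
    (p = (n + 1) / (n + 2) →
      [NashInequality Q p,
        ∃ Γ, MemBMO Γ ∧ IsDivergence Q Γ,
        ∃ Γ, MemBMO Γ ∧ IsGradInvLaplacianModConst Q Γ,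
        ∃ Γ, MemBMO Γ ∧ IsGradInvLaplacianModConst Q Γ ∧ IsDivergence Q Γ].TFAE) ∧
    ((n + 1) / (n + 2) < p →
      [NashInequality Q p,
        ∃ Γ, MemMorrey (3 * n + 2 - 2 * p * (n + 2)) Γ ∧ IsDivergence Q Γ,
        ∃ Γ, MemMorrey (3 * n + 2 - 2 * p * (n + 2)) Γ ∧ IsGradInvLaplacian Q Γ,
        ∃ Γ, MemMorrey (3 * n + 2 - 2 * p * (n + 2)) Γ ∧ IsGradInvLaplacian Q Γ ∧
          IsDivergence Q Γ].TFAE) := by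
  have hn0 : n ≠ 0 := by omega
  have h2 : (0 : ℝ) < n + 2 := by positivity
  refine ⟨fun hp => ⟨fun h => ?_, fun h => ?_⟩, fun hp => ⟨fun h => ?_, fun h => ?_⟩,
    fun hp hp' => ?_, fun hp => ?_, fun hp => ?_⟩
  · obtain ⟨K, hK⟩ := h.localBound hn hp0 hp1
    rw [lt_div_iff₀ h2] at hp
    exact hK.eq_zero (by linarith)
  · subst h
    exact ⟨0, fun u => by simp [quadForm]⟩
  · obtain ⟨K, hK⟩ := h.localBound hn hp0 hp1
    rw [eq_div_iff h2.ne'] at hp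
    rw [show 3 * (n : ℝ) + 2 - 2 * p * (n + 2) = n + 2 by linarith] at hK
    obtain ⟨C, hC0, hC⟩ := hK.exists_norm_le_integral
    exact isBoundedFunction_of_norm_le_integral hC0 hC
  · rw [hp]
    exact h.nashInequality (Nat.pos_of_ne_zero hn0)
  · rw [div_lt_iff₀ h2] at hp
    rw [lt_div_iff₀ h2] at hp'
    -- In each of the three equivalences the cycle is 1 → 4 → 3 → 2 → 1, with the analytic content
    -- in 1 → 4 and 2 → 1. Here the two conditions on p say 0 < α < 1.
    tfae_have 1 → 4 := fun h => by
      obtain ⟨K, hK⟩ := h.localBound hn hp0 hp1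
      rw [show 3 * (n : ℝ) + 2 - 2 * p * (n + 2) = n + 2 * (n + 1 - p * (n + 2)) by ring] at hK
      obtain ⟨Γ, h1, h3⟩ := hK.exists_memLip (by linarith) (by linarith)
      exact ⟨Γ, h1, h3, h3.isDivergence hn0⟩
    tfae_have 4 → 3 := fun ⟨Γ, h1, h3, _⟩ => ⟨Γ, h1, h3⟩
    tfae_have 3 → 2 := fun ⟨Γ, h1, h3⟩ => ⟨Γ, h1, h3.isDivergence hn0⟩
    tfae_have 2 → 1 := fun ⟨Γ, h1, h3⟩ =>
      nashInequality_of_memLip hp0 hp1 (by linarith) h1 h3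
    tfae_finish
  · tfae_have 1 → 4 := fun h => by
      obtain ⟨K, hK⟩ := h.localBound hn hp0 hp1
      have hp' := (eq_div_iff h2.ne').1 hp
      rw [show 3 * (n : ℝ) + 2 - 2 * p * (n + 2) = n by linarith] at hK
      obtain ⟨Γ, h1, h3⟩ := hK.exists_memBMO
      exact ⟨Γ, h1, h3, h3.isDivergence hn0⟩
    tfae_have 4 → 3 := fun ⟨Γ, h1, h3, _⟩ => ⟨Γ, h1, h3⟩
    tfae_have 3 → 2 := fun ⟨Γ, h1, h3⟩ => ⟨Γ, h1, h3.isDivergence hn0⟩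
    tfae_have 2 → 1 := fun ⟨Γ, h1, h3⟩ => nashInequality_of_memBMO hp0 hp1 hp h1 h3
    tfae_finish
  · rw [div_lt_iff₀ h2] at hp
    tfae_have 1 → 4 := fun h => by
      obtain ⟨K, hK⟩ := h.localBound hn hp0 hp1
      obtain ⟨Γ, h1, h3⟩ := hK.exists_memMorrey (by linarith)
      exact ⟨Γ, h1, h3, h3.modConst.isDivergence hn0⟩
    tfae_have 4 → 3 := fun ⟨Γ, h1, h3, _⟩ => ⟨Γ, h1, h3⟩
    tfae_have 3 → 2 := fun ⟨Γ, h1, h3⟩ => ⟨Γ, h1, h3.modConst.isDivergence hn0⟩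
    tfae_have 2 → 1 := fun ⟨Γ, h1, h3⟩ => nashInequality_of_memMorrey hp0 hp1 h1 h3
    tfae_finish
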